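/- Let $\alpha\in(0,\tfrac12)$, $p\in(1,\infty)$, $q\in(\tfrac1\alpha,\infty]$, and put $\gamma=\frac{q\alpha}{q\alpha-1}$ if $q<\infty$ and $\gamma=1$ if $q=\infty$. Write $\Lambda=(-\Delta)^{1/2}$, $R_1,R_2$ for the Riesz transforms on $\mathbb R^2$ and $R^\perp f=(-R_2f,R_1f)$. Fix a radial $\chi\in C_c^\infty(B_1)$, $\chi\ge 0$, with $\chi=1$ on $B_{1/2}$, and for $J\in\mathbb R$ let $f_{\le J}$ be the function with Fourier transform $\chi(2^{-(J+1)}\xi)\hat f(\xi)$ and $f_{>J}=f-f_{\le J}$. Let $C$ and $M$ be real constants. There is a constant $c_*>0$, depending only on $\alpha,p,q,\chi,C,M$, with the following property. Let $T>0$ and let $\theta_1,\theta_2$ be distributional solutions on $\mathbb R^2\times(0,T)$ of $$\partial_t\theta+R^\perp\theta\cdot\nabla\theta+(-\Delta)^\alpha\theta=0$$ with the same initial data, attained in the sense of distributions as $t\to0^+$. Let $w=\theta_1-\theta_2$ and suppose that 1. $w\in L^\infty([0,T);L^p)$ and $\lim_{t\to0^+}\|w(t)\|_{p}=0$; 2.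 $\nabla\theta_1(t)\in L^q$ for $t\in(0,T)$, and $t\mapsto\|\nabla\theta_1(t)\|_q$ is locally bounded on $(0,T)$; 3. $t\mapsto\|w(t)\|_p^p$ is locally absolutely continuous on $(0,T)$, the quantity $\partial_t\|w\|_p^p+p\|\Lambda^{2\alpha/p}w\|_p^p$ is locally bounded on $(0,T)$, and for a.e. $t\in(0,T)$ the integral below converges absolutely and $$\partial_t\|w\|_p^p+p\|\Lambda^{2\alpha/p}w\|_p^p\le -C\int_{\mathbb R^2}R^\perp w\cdot\nabla\theta_1\,|w|^{p-2}w\,dx .$$ Define $J(t)$ by $$2^{2\alpha J(t)}=c_*\,\|\nabla\theta_1(t)\|_q^{\gamma}$$ (with $J(t)=-\infty$ and $w_{\le J(t)}=0$ where $\nabla\theta_1(t)=0$). If there is $\delta\in(0,T]$ such that $$\frac{\|w_{\le J(t)}(t)\|_p}{\|w_{>J(t)}(t)\|_p}\le M\qquad\text{for all }t\in(0,\delta)$$ (with $0/0=0$ and $a/0=\infty$ for $a>0$), then $w=0$ on $\mathbb R^2\times(0,T)$. -/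

import Mathlib

open MeasureTheory Set Filter Topology
open scoped ENNReal ContDiff FourierTransform Distributions

noncomputable section

namespace SQG

/-- The plane `ℝ²` with its Euclidean norm. -/
abbrev Plane : Type := EuclideanSpace ℝ (Fin 2)

/-! ### Fourier multipliers on test functions

Mathlib's Fourier transform is `𝓕 φ ξ = ∫ exp(-2πi⟨x, ξ⟩) φ x dx`, so that the usual frequency
variable (the one for which `∂ⱼ` has symbol `i ξⱼ`) is `2π ξ`. -/

/-- The fractional Laplacian `Λˢ φ = (-Δ)^{s/2} φ` of a test function: the multiplier `|2π ξ|ˢ`. -/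
def fracLapTest (s : ℝ) (φ : Plane → ℝ) (x : Plane) : ℝ :=
  (𝓕⁻ (fun ξ : Plane => (((2 * Real.pi * ‖ξ‖) ^ s : ℝ) : ℂ) *
    𝓕 (fun y : Plane => (φ y : ℂ)) ξ) x).re

/-- The Riesz transform `Rⱼ φ` of a test function: the multiplier `-i ξⱼ / |ξ|`. -/
def rieszTest (j : Fin 2) (φ : Plane → ℝ) (x : Plane) : ℝ :=
  (𝓕⁻ (fun ξ : Plane => (-Complex.I * ((ξ j / ‖ξ‖ : ℝ) : ℂ)) *
    𝓕 (fun y : Plane => (φ y : ℂ)) ξ) x).re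

/-- `f ∈ L¹((1 + |x|)⁻² dx)`. It contains `Lʳ(ℝ²)` for every `1 ≤ r < ∞`. For test functions `φ`,
`Rⱼ φ = O(|x|⁻²)` and `Λˢ φ = O(|x|^{-2-s})` at infinity, so on this class `Rⱼ f` and `Λˢ f` are
well-defined distributions. -/
def TempIntegrable (f : Plane → ℝ) : Prop :=
  Integrable (fun x => f x / (1 + ‖x‖) ^ 2) volume

/-- `g = Λˢ f` in the sense of distributions, `g` being a locally integrable function. -/
structure IsFracLap (s : ℝ) (f g : Plane → ℝ) : Prop where
  source : TempIntegrable f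
  target : LocallyIntegrable g volume
  duality : ∀ φ : 𝓓((⊤ : TopologicalSpace.Opens Plane), ℝ),
    ∫ x, g x * φ x = ∫ x, f x * fracLapTest s φ x

/-- `g = Rⱼ f` in the sense of distributions (`Rⱼ` is skew-adjoint), `g` being a locally integrable
function. -/
structure IsRiesz (j : Fin 2) (f g : Plane → ℝ) : Prop where
  source : TempIntegrable f
  target : LocallyIntegrable g volume
  duality : ∀ φ : 𝓓((⊤ : TopologicalSpace.Opens Plane), ℝ),
    ∫ x, g x * φ x = - ∫ x, f x * rieszTest j φ x

/-- `u = R^⊥ f = (-R₂ f, R₁ f)`; the coordinates `1, 2` are the indices `0, 1` of `Fin 2`. -/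
def IsPerpRiesz (f : Plane → ℝ) (u : Plane → Plane) : Prop :=
  IsRiesz 1 f (fun x => - u x 0) ∧ IsRiesz 0 f (fun x => u x 1)

/-- `G = ∇ f` in the sense of distributions. -/
structure IsWeakGradient (f : Plane → ℝ) (G : Plane → Plane) : Prop where
  source : LocallyIntegrable f volume
  target : LocallyIntegrable G volume
  duality : ∀ (φ : 𝓓((⊤ : TopologicalSpace.Opens Plane), ℝ)) (i : Fin 2),
    ∫ x, G x i * φ x = - ∫ x, f x * fderiv ℝ φ x (EuclideanSpace.single i 1)

/-! ### Solutions -/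

/-- The open slab `(0, T) × ℝ²`. -/
def slab (T : ℝ) : TopologicalSpace.Opens (ℝ × Plane) :=
  ⟨Ioo 0 T ×ˢ univ, isOpen_Ioo.prod isOpen_univ⟩

/-- `θ` is a distributional solution on `ℝ² × (0, T)` of
`∂ₜθ + u · ∇θ + (-Δ)^α θ = 0`, `u = (-R₂ θ, R₁ θ)`, with initial data the distribution `θ₀`.
As `div u = 0`, the transport term is the distribution `div (θ u)`. -/
structure IsSolution (α T : ℝ) (θ₀ : 𝓓'((⊤ : TopologicalSpace.Opens Plane), ℝ))
    (θ : ℝ → Plane → ℝ) : Prop where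
  /-- every time slice lies in the class on which `R^⊥` and `Λ^{2α}` are defined -/
  slice : ∀ t ∈ Ioo 0 T, TempIntegrable (θ t)
  /-- and so does `θ` as a function of space and time, locally in time -/
  integrable : ∀ a b : ℝ, 0 < a → b < T →
    IntegrableOn (fun z : ℝ × Plane => θ z.1 z.2 / (1 + ‖z.2‖) ^ 2) (Icc a b ×ˢ univ) volume
  /-- the equation, tested with `φ ∈ C_c^∞(ℝ² × (0, T))` -/
  equation : ∃ u : ℝ → Plane → Plane,
    (∀ᵐ t, t ∈ Ioo 0 T → IsPerpRiesz (θ t) (u t)) ∧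
    LocallyIntegrableOn (fun z : ℝ × Plane => θ z.1 z.2 • u z.1 z.2) (slab T) volume ∧
    ∀ φ : 𝓓(slab T, ℝ),
      ∫ t in Ioo 0 T, ∫ x,
        (θ t x * deriv (fun s => φ (s, x)) t
          + θ t x * fderiv ℝ (fun y => φ (t, y)) x (u t x)
          - θ t x * fracLapTest (2 * α) (fun y => φ (t, y)) x) = 0
  /-- the initial data are attained in the sense of distributions -/
  initial : ∀ φ : 𝓓((⊤ : TopologicalSpace.Opens Plane), ℝ),
    Tendsto (fun t => ∫ x, θ t x * φ x) (𝓝[>] 0) (𝓝 (θ₀ φ))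

/-! ### Littlewood-Paley truncations -/

/-- A Littlewood-Paley cut-off: a non-negative radial `χ ∈ C_c^∞(B₁)` with `χ = 1` on `B_{1/2}`. -/
structure Cutoff where
  toFun : Plane → ℝ
  smooth : ContDiff ℝ ∞ toFun
  nonneg : ∀ ξ, 0 ≤ toFun ξ
  radial : ∀ ξ η, ‖ξ‖ = ‖η‖ → toFun ξ = toFun η
  support_subset : tsupport toFun ⊆ Metric.ball 0 1
  eq_one : ∀ ξ ∈ Metric.ball (0 : Plane) (1 / 2), toFun ξ = 1

/-- The convolution kernel of `Δ_{≤ J}`, `J ∈ ℝ`: the inverse Fourier transform of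
`χ(2^{-(J+1)} ξ)`, which for integer `J` is the sum over `j ≤ J` of the dyadic symbols
`χ(2^{-(j+1)} ξ) - χ(2^{-j} ξ)`. It is real because `χ` is even. -/
def lowKernel (χ : Cutoff) (J : ℝ) (x : Plane) : ℝ :=
  (𝓕⁻ (fun ξ : Plane => (χ.toFun (((2 : ℝ) ^ (-(J + 1)) * (2 * Real.pi)) • ξ) : ℂ)) x).re

/-- `f_{≤ J} = Δ_{≤ J} f`. -/
def lowFreq (χ : Cutoff) (J : ℝ) (f : Plane → ℝ) (x : Plane) : ℝ :=
  ∫ y, lowKernel χ J (x - y) * f y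

/-- `f_{> J} = f - f_{≤ J}`. -/
def highFreq (χ : Cutoff) (J : ℝ) (f : Plane → ℝ) (x : Plane) : ℝ :=
  f x - lowFreq χ J f x

/-! ### Norms and the energy inequality -/

/-- The `Lᵖ(ℝ²)` norm, for real `p`, with values in `[0, ∞]`. -/
def lpNorm (p : ℝ) (f : Plane → ℝ) : ℝ≥0∞ := eLpNorm f (ENNReal.ofReal p) volume

/-- `‖f‖_pᵖ` as a real number, for `f ∈ Lᵖ`. -/
def lpPow (p : ℝ) (f : Plane → ℝ) : ℝ := (lpNorm p f).toReal ^ p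

/-- The `Lᵖ` energy inequality on `(0, T)`
`∂ₜ ‖w‖_pᵖ + p ‖Λ^{2α/p} w‖_pᵖ ≤ - C ∫ (R^⊥ w · G) |w|^{p-2} w dx`, with left-hand side locally
bounded on `(0, T)`. Here `v = R^⊥ w`, `V = Λ^{2α/p} w`; both are determined by `w`. -/
def EnergyInequality (p α C T : ℝ) (w : ℝ → Plane → ℝ) (G : ℝ → Plane → Plane) : Prop :=
  ∃ (v : ℝ → Plane → Plane) (V : ℝ → Plane → ℝ),
    (∀ᵐ t, t ∈ Ioo 0 T → IsPerpRiesz (w t) (v t)) ∧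
    (∀ᵐ t, t ∈ Ioo 0 T → IsFracLap (2 * α / p) (w t) (V t) ∧
      MemLp (V t) (ENNReal.ofReal p) volume) ∧
    (∀ a b : ℝ, 0 < a → a < b → b < T →
      AbsolutelyContinuousOnInterval (fun t => lpPow p (w t)) a b) ∧
    (∀ a b : ℝ, 0 < a → a < b → b < T → ∃ B : ℝ, ∀ᵐ t, t ∈ Ioo a b →
      |deriv (fun s => lpPow p (w s)) t + p * lpPow p (V t)| ≤ B) ∧
    (∀ᵐ t, t ∈ Ioo 0 T →
      Integrable (fun x => inner ℝ (v t x) (G t x) * (|w t x| ^ (p - 2) * w t x)) volume ∧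
      deriv (fun s => lpPow p (w s)) t + p * lpPow p (V t) ≤
        - C * ∫ x, inner ℝ (v t x) (G t x) * (|w t x| ^ (p - 2) * w t x))

/-- The scaling-invariant power of `‖∇θ‖_q`: `qα / (qα - 1)` for `1/α < q < ∞`, and `1` for
`q = ∞`. -/
def gradExponent (α : ℝ) (q : ℝ≥0∞) : ℝ :=
  if q = ⊤ then 1 else q.toReal * α / (q.toReal * α - 1)

end SQG

end

/-! Put `κ = 1/q`, `β = 2α/p`, `r = p/(1-κ)`, `V = Λ^β w` and `g = ‖∇θ₁‖_q`. Hölder's inequality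
with exponents `q` and `1/(1-κ)`, together with the boundedness of the Riesz transforms on `Lʳ`,
bounds the transport integral by a multiple of `g ‖w‖_r^p` (`exists_transport_bound`).

With `λ = 2^(J+1)`, Bernstein's inequalities (`exists_freq_bounds`) read `‖w_{≤J}‖_r ≲ λ^(2κ/p)
‖w‖_p`, `‖w_{>J}‖_r ≲ λ^(2κ/p-β) ‖V‖_p` and `‖w_{>J}‖_p ≲ λ^(-β) ‖V‖_p`. If the low frequencies are
at most `M` times the high ones in `Lᵖ`, then `‖V‖_p` controls all of `w`, and the transport term is
at most `P g λ^(-2αη) ‖V‖_p^p`, where `η = 1 - κ/α = 1/γ`. The scale `J(t)` is the one at which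
`λ^(2αη)` is comparable to `g`, and a large `c_*` makes the bound at most `p ‖V‖_p^p`: the
dissipation absorbs the transport term. Hence `‖w‖_p` is nonincreasing on `(0, δ)`, and since it
tends to `0` at time `0` it vanishes there.

After that the ratio condition is no longer needed. On `[δ/2, b]` the norm `g` is bounded, so one
fixed large `J` lets the dissipation absorb the high-frequency contribution, while the low-frequency
contribution is a multiple of `‖w‖_p^p`. Gronwall's inequality started from `0` finishes the proof.

Two results of harmonic analysis carry the estimates. The Riesz transforms are bounded by the method
of rotations (`rieszApprox`), which reduces them to M. Riesz's theorem on the line; that theorem is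
obtained by integrating `F^p` for a holomorphic `F` with positive real part
(`exists_conjPoisson_bound_of_nonneg`). The high-frequency inequalities come from writing `w_{>J} =
K * V` (`highFreq_ae_eq`), with `K` a superposition of heat kernels stripped of their low
frequencies (`highKernel`). First-order cancellation in these kernels suffices because `β < 1`. -/

noncomputable section

namespace SQG

/-! ### Jensen's and Minkowski's inequalities for lower integrals. -/

section LpTools

variable {X Y : Type*} [MeasurableSpace X] [MeasurableSpace Y] {μ : Measure Y} {ν : Measure X}

/-- Jensen's inequality for powers. -/
theorem rpow_lintegral_le {r : ℝ} (hr : 1 ≤ r) {f : Y → ℝ≥0∞} (hf : AEMeasurable f μ) :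
    (∫⁻ t, f t ∂μ) ^ r ≤ μ univ ^ (r - 1) * ∫⁻ t, f t ^ r ∂μ := by
  rcases hr.eq_or_lt with rfl | hr
  · simp
  have hc := Real.HolderConjugate.conjExponent hr
  have h := ENNReal.lintegral_mul_le_Lp_mul_Lq μ hc hf (aemeasurable_const (b := 1))
  have h0 : 0 < r := hc.pos
  calc (∫⁻ t, f t ∂μ) ^ r = (∫⁻ t, (f * (fun _ => 1 : Y → ℝ≥0∞)) t ∂μ) ^ r := by simp
    _ ≤ ((∫⁻ t, f t ^ r ∂μ) ^ (1 / r) * (∫⁻ _, 1 ^ r.conjExponent ∂μ) ^ (1 / r.conjExponent)) ^ r :=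
        ENNReal.rpow_le_rpow h h0.le
    _ = μ univ ^ (r - 1) * ∫⁻ t, f t ^ r ∂μ := by
        rw [ENNReal.mul_rpow_of_nonneg _ _ h0.le, ← ENNReal.rpow_mul, ← ENNReal.rpow_mul,
          one_div_mul_cancel h0.ne', ENNReal.rpow_one, mul_comm]
        congr 1
        simp only [ENNReal.one_rpow, lintegral_one]
        congr 1
        have h1 : r - 1 ≠ 0 := by linarith
        simp only [Real.conjExponent]
        field_simp

/-- Minkowski's integral inequality, with a uniform bound on the total mass. -/
theorem lintegral_rpow_lintegral_le [SFinite μ] [SFinite ν] {r : ℝ} (hr : 1 ≤ r)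
    {f : Y → X → ℝ≥0∞} (hf : Measurable (Function.uncurry f)) :
    ∫⁻ x, (∫⁻ t, f t x ∂μ) ^ r ∂ν ≤ μ univ ^ (r - 1) * ∫⁻ t, ∫⁻ x, f t x ^ r ∂ν ∂μ := by
  have hf' : ∀ x, Measurable fun t => f t x := fun x => hf.comp (measurable_id.prodMk measurable_const)
  have h2 : Measurable fun z : X × Y => f z.2 z.1 ^ r :=
    (hf.comp (measurable_snd.prodMk measurable_fst)).pow_const r
  calc ∫⁻ x, (∫⁻ t, f t x ∂μ) ^ r ∂ν ≤ ∫⁻ x, μ univ ^ (r - 1) * ∫⁻ t, f t x ^ r ∂μ ∂ν :=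
        lintegral_mono fun x => rpow_lintegral_le hr (hf' x).aemeasurable
    _ = μ univ ^ (r - 1) * ∫⁻ x, ∫⁻ t, f t x ^ r ∂μ ∂ν :=
        lintegral_const_mul _ h2.lintegral_prod_right'
    _ = _ := by rw [lintegral_lintegral_swap h2.aemeasurable]

/-- Minkowski's integral inequality, when the norms of the slices have a known bound `b`. -/
theorem lintegral_rpow_lintegral_le_of_le [SFinite μ] [SFinite ν] {r : ℝ} (hr : 1 ≤ r)
    {f : Y → X → ℝ≥0∞} (hf : Measurable (Function.uncurry f)) {b : Y → ℝ≥0∞} (hb : Measurable b)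
    (hb0 : ∀ᵐ t ∂μ, b t ≠ 0) (hbt : ∀ᵐ t ∂μ, b t ≠ ⊤) {S : ℝ≥0∞}
    (h : ∀ᵐ t ∂μ, ∫⁻ x, f t x ^ r ∂ν ≤ b t ^ r * S) :
    ∫⁻ x, (∫⁻ t, f t x ∂μ) ^ r ∂ν ≤ (∫⁻ t, b t ∂μ) ^ r * S := by
  have h0 : 0 < r := by linarith
  -- The weight `b` is moved into the measure: the uniform version is applied to `f / b` under `b
  -- dμ`, whose slices all satisfy the bound `S`. This is why `b` must be nonzero and finite almost
  -- everywhere.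
  have hm : Measurable (Function.uncurry fun t x => (b t)⁻¹ * f t x) :=
    (hb.comp measurable_fst).inv.mul hf
  have key := lintegral_rpow_lintegral_le (μ := μ.withDensity b) (ν := ν) hr hm
  have e1 : ∀ x, ∫⁻ t, (b t)⁻¹ * f t x ∂(μ.withDensity b) = ∫⁻ t, f t x ∂μ := by
    intro x
    have hf' : Measurable fun t => f t x := hf.comp (measurable_id.prodMk measurable_const)
    rw [lintegral_withDensity_eq_lintegral_mul _ hb
      (show Measurable fun t => (b t)⁻¹ * f t x from hb.inv.mul hf')]
    refine lintegral_congr_ae ?_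
    filter_upwards [hb0, hbt] with t h1 h2
    simp only [Pi.mul_apply]
    rw [← mul_assoc, ENNReal.mul_inv_cancel h1 h2, one_mul]
  simp only [e1, withDensity_apply _ MeasurableSet.univ, Measure.restrict_univ] at key
  refine key.trans ?_
  have e2 : ∀ᵐ t ∂μ, ∫⁻ x, ((b t)⁻¹ * f t x) ^ r ∂ν ≤ S := by
    filter_upwards [hb0, hbt, h] with t h1 h2 h3
    have hf' : Measurable fun x => f t x := hf.comp (measurable_const.prodMk measurable_id)
    simp only [ENNReal.mul_rpow_of_nonneg _ _ h0.le]
    rw [lintegral_const_mul _ (hf'.pow_const r)]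
    calc _ ≤ (b t)⁻¹ ^ r * (b t ^ r * S) := by gcongr
      _ = S := by
        rw [← mul_assoc, ← ENNReal.mul_rpow_of_nonneg _ _ h0.le,
          ENNReal.inv_mul_cancel h1 h2, ENNReal.one_rpow, one_mul]
  calc _ ≤ (∫⁻ t, b t ∂μ) ^ (r - 1) * ∫⁻ t, S ∂(μ.withDensity b) := by
        refine mul_le_mul' le_rfl ?_
        exact lintegral_mono_ae ((withDensity_absolutelyContinuous μ b).ae_le e2)
    _ = (∫⁻ t, b t ∂μ) ^ (r - 1) * (∫⁻ t, b t ∂μ) * S := by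
        rw [lintegral_const, withDensity_apply _ MeasurableSet.univ, Measure.restrict_univ]; ring
    _ = _ := by
        congr 1
        conv_lhs => rw [← ENNReal.rpow_one (∫⁻ t, b t ∂μ), ← ENNReal.rpow_mul]
        rw [← ENNReal.rpow_add_of_nonneg _ _ (by linarith) (by norm_num)]
        ring_nf

end LpTools

/-! ### Young's convolution inequalities. -/

section Convolution

variable {E : Type*} [NormedAddCommGroup E] [MeasurableSpace E] [BorelSpace E]
  [SecondCountableTopology E] {μ : Measure E} [SFinite μ] [μ.IsAddHaarMeasure]

theorem measurable_mul_comp_sub {k f : E → ℝ≥0∞} (hk : Measurable k) (hf : Measurable f) :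
    Measurable (Function.uncurry fun y x => k y * f (x - y)) :=
  (hk.comp measurable_fst).mul (hf.comp (measurable_snd.sub measurable_fst))

/-- Young's inequality `‖k * f‖_r ≤ ‖k‖₁ ‖f‖_r`. -/
theorem lintegral_rpow_conv_le {r : ℝ} (hr : 1 ≤ r) {k f : E → ℝ≥0∞}
    (hk : Measurable k) (hf : Measurable f) :
    ∫⁻ x, (∫⁻ y, k y * f (x - y) ∂μ) ^ r ∂μ ≤ (∫⁻ y, k y ∂μ) ^ r * ∫⁻ x, f x ^ r ∂μ := by
  have hm : Measurable (Function.uncurry fun y x => f (x - y)) :=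
    hf.comp (measurable_snd.sub measurable_fst)
  -- The kernel is absorbed into the measure, so that its mass becomes the constant in Minkowski's
  -- inequality.
  have key := lintegral_rpow_lintegral_le (μ := μ.withDensity k) (ν := μ) hr hm
  have e1 : ∀ x, ∫⁻ y, f (x - y) ∂(μ.withDensity k) = ∫⁻ y, k y * f (x - y) ∂μ := by
    intro x
    rw [lintegral_withDensity_eq_lintegral_mul _ hk
      (show Measurable fun y => f (x - y) from hf.comp (measurable_const.sub measurable_id))]
    rfl
  simp only [e1, withDensity_apply _ MeasurableSet.univ, Measure.restrict_univ,
    lintegral_sub_right_eq_self (μ := μ) (fun x => f x ^ r)] at key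
  refine key.trans_eq ?_
  rw [lintegral_const, withDensity_apply _ MeasurableSet.univ, Measure.restrict_univ]
  conv_lhs => rw [mul_left_comm, mul_comm, ← ENNReal.rpow_one (∫⁻ t, k t ∂μ), ← ENNReal.rpow_mul]
  rw [← ENNReal.rpow_add_of_nonneg _ _ (by linarith) (by norm_num)]
  ring_nf

/-- Young's inequality `‖k * f‖_r ≤ ‖k‖_m ‖f‖_p`, with `‖k‖_m` estimated by interpolation between
`‖k‖₁` and `‖k‖_∞`. -/
theorem lintegral_rpow_conv_le_interpolate [μ.IsNegInvariant] {p r : ℝ} (hp : 1 < p)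
    (hpr : p ≤ r) {k f : E → ℝ≥0∞} (hk : Measurable k) (hf : Measurable f) {K₁ K : ℝ≥0∞}
    (hK₁ : ∫⁻ y, k y ∂μ ≤ K₁)
    (hK : ∀ y, k y ≤ K) :
    ∫⁻ x, (∫⁻ y, k y * f (x - y) ∂μ) ^ r ∂μ ≤
      (K ^ (1 / p - 1 / r) * K₁ ^ (1 - (1 / p - 1 / r))) ^ r * (∫⁻ x, f x ^ p ∂μ) ^ (r / p) := by
  have h0 : 0 < p := by linarith
  have hr0 : 0 < r := by linarith
  have hc := Real.HolderConjugate.conjExponent hp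
  set p' := p.conjExponent
  have hp' : 1 < p' := hc.symm.lt
  have hinv : p'⁻¹ = 1 - p⁻¹ := by have := hc.inv_add_inv_eq_one; linarith
  set F := ∫⁻ x, f x ^ p ∂μ
  -- Hölder's inequality gives a pointwise bound by `‖k‖_{p'} ‖f‖_p`, and `k ^ p' ≤ K ^ (p' - 1) *
  -- k` interpolates `‖k‖_{p'}`.
  have hsup : ∀ x, ∫⁻ y, k y * f (x - y) ∂μ ≤ K ^ (1 / p) * K₁ ^ (1 / p') * F ^ (1 / p) := by
    intro x
    have h1 := ENNReal.lintegral_mul_le_Lp_mul_Lq μ hc.symm hk.aemeasurable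
      (hf.comp (measurable_const.sub measurable_id) : Measurable fun y => f (x - y)).aemeasurable
    have h2 : ∫⁻ y, f (x - y) ^ p ∂μ = F :=
      lintegral_sub_left_eq_self (μ := μ) (fun y => f y ^ p) x
    have h3 : ∫⁻ y, k y ^ p' ∂μ ≤ K ^ (p' - 1) * K₁ := by
      calc ∫⁻ y, k y ^ p' ∂μ = ∫⁻ y, k y ^ (p' - 1) * k y ∂μ := by
            refine lintegral_congr fun y => ?_
            conv_rhs => rw [← ENNReal.rpow_one (k y), ← ENNReal.rpow_mul]
            rw [← ENNReal.rpow_add_of_nonneg _ _ (by linarith) (by norm_num)]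
            ring_nf
        _ ≤ ∫⁻ y, K ^ (p' - 1) * k y ∂μ := by
            refine lintegral_mono fun y => ?_
            dsimp only
            gcongr
            exact hK y
        _ = K ^ (p' - 1) * ∫⁻ y, k y ∂μ := lintegral_const_mul _ hk
        _ ≤ _ := by gcongr
    simp only [Pi.mul_apply] at h1
    change _ ≤ _ * (∫⁻ y, f (x - y) ^ p ∂μ) ^ (1 / p) at h1
    rw [h2] at h1
    refine h1.trans ?_
    gcongr
    calc (∫⁻ y, k y ^ p' ∂μ) ^ (1 / p') ≤ (K ^ (p' - 1) * K₁) ^ (1 / p') := by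
          gcongr
      _ = K ^ (1 / p) * K₁ ^ (1 / p') := by
          rw [ENNReal.mul_rpow_of_nonneg _ _ (by positivity), ← ENNReal.rpow_mul]
          congr 2
          rw [one_div, one_div, sub_mul, mul_inv_cancel₀ (by linarith), one_mul, hinv]; ring
  have hrp : 0 ≤ r - p := by linarith
  -- Of the `r` powers of the convolution, `r - p` are estimated by the supremum and the remaining
  -- `p` by the `L¹` form of Young's inequality.
  calc ∫⁻ x, (∫⁻ y, k y * f (x - y) ∂μ) ^ r ∂μ
      = ∫⁻ x, (∫⁻ y, k y * f (x - y) ∂μ) ^ (r - p) * (∫⁻ y, k y * f (x - y) ∂μ) ^ p ∂μ := by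
        refine lintegral_congr fun x => ?_
        rw [← ENNReal.rpow_add_of_nonneg _ _ hrp h0.le, sub_add_cancel]
    _ ≤ ∫⁻ x, (K ^ (1 / p) * K₁ ^ (1 / p') * F ^ (1 / p)) ^ (r - p) *
          (∫⁻ y, k y * f (x - y) ∂μ) ^ p ∂μ := by
        refine lintegral_mono fun x => ?_
        dsimp only
        gcongr
        exact hsup x
    _ = (K ^ (1 / p) * K₁ ^ (1 / p') * F ^ (1 / p)) ^ (r - p) *
          ∫⁻ x, (∫⁻ y, k y * f (x - y) ∂μ) ^ p ∂μ := by
        refine lintegral_const_mul _ (Measurable.pow_const ?_ p)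
        exact (measurable_mul_comp_sub hk hf).lintegral_prod_left'
    _ ≤ (K ^ (1 / p) * K₁ ^ (1 / p') * F ^ (1 / p)) ^ (r - p) * (K₁ ^ p * F) := by
        gcongr
        refine (lintegral_rpow_conv_le hp.le hk hf).trans ?_
        gcongr
    _ = _ := by
        have hd : 1 / r ≤ 1 / p := one_div_le_one_div_of_le h0 hpr
        have hp1 : 1 / p < 1 := by rw [div_lt_one h0]; exact hp
        have hr1 : 0 < 1 / r := by positivity
        rw [ENNReal.mul_rpow_of_nonneg _ _ hrp, ENNReal.mul_rpow_of_nonneg _ _ hrp,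
          ENNReal.mul_rpow_of_nonneg _ _ hr0.le, ← ENNReal.rpow_mul, ← ENNReal.rpow_mul,
          ← ENNReal.rpow_mul, ← ENNReal.rpow_mul, ← ENNReal.rpow_mul]
        have a1 : (1 / p - 1 / r) * r = 1 / p * (r - p) := by field_simp
        have a2 : (1 - (1 / p - 1 / r)) * r = 1 / p' * (r - p) + p := by
          rw [one_div p', hinv]; field_simp; ring
        have a3 : r / p = 1 / p * (r - p) + 1 := by field_simp; ring
        rw [a1, a2, a3, ENNReal.rpow_add_of_nonneg _ _ (by positivity) h0.le,
          ENNReal.rpow_add_of_nonneg _ _ (by positivity) zero_le_one, ENNReal.rpow_one]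
        ring

end Convolution

/-! ### The `Lʳ` norm by duality with test functions. -/

section Duality

/-- A shrinking sequence of smooth bump functions. -/
def bump (n : ℕ) : ContDiffBump (0 : Plane) where
  rIn := 1 / (n + 1)
  rOut := 2 / (n + 1)
  rIn_pos := by positivity
  rIn_lt_rOut := by gcongr; norm_num

theorem bump_rOut_le (n : ℕ) : (bump n).rOut ≤ 2 := by
  change (2 : ℝ) / (n + 1) ≤ 2
  rw [div_le_iff₀ (by positivity)]
  have : (0 : ℝ) ≤ n := by positivity
  linarith

theorem tendsto_bump_rOut : Tendsto (fun n => (bump n).rOut) atTop (𝓝 0) := by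
  have := (tendsto_one_div_add_atTop_nhds_zero_nat (𝕜 := ℝ)).const_mul 2
  simp only [mul_zero] at this
  refine this.congr fun n => ?_
  change _ = (2 : ℝ) / (n + 1)
  ring

/-- A locally integrable function whose pairing with test functions is controlled by the `L^{r'}`
norm: the same bound holds for the pairing with bounded functions of bounded support. -/
theorem enorm_integral_mul_le_of_dual {r' : ℝ} (hr' : 1 ≤ r') {g : Plane → ℝ}
    (hg : LocallyIntegrable g volume) {N : ℝ≥0∞}
    (H : ∀ φ : Plane → ℝ, ContDiff ℝ ∞ φ → HasCompactSupport φ →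
      ‖∫ x, g x * φ x‖ₑ ≤ N * (∫⁻ x, ‖φ x‖ₑ ^ r') ^ (1 / r'))
    {h : Plane → ℝ} (hm : Measurable h) {B R : ℝ} (hB : ∀ x, |h x| ≤ B)
    (hR : ∀ x, R < ‖x‖ → h x = 0) :
    ‖∫ x, g x * h x‖ₑ ≤ N * (∫⁻ x, ‖h x‖ₑ ^ r') ^ (1 / r') := by
  have hB0 : 0 ≤ B := (abs_nonneg _).trans (hB 0)
  have hsupp : Function.support h ⊆ Metric.closedBall 0 R := by
    intro x hx
    by_contra hcon
    exact hx (hR x (by simpa using hcon))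
  have hcs : HasCompactSupport h := HasCompactSupport.intro (isCompact_closedBall (0 : Plane) R)
    fun x hx => hR x (by simpa using hx)
  have hint : Integrable h := by
    have hon : IntegrableOn h (Metric.closedBall 0 R) := by
      refine Measure.integrableOn_of_bounded (M := B) measure_closedBall_lt_top.ne
        hm.aestronglyMeasurable (Eventually.of_forall fun x => hB x)
    exact (integrableOn_iff_integrable_of_support_subset hsupp).1 hon
  have hloc : LocallyIntegrable h volume := hint.locallyIntegrable
  -- Mollification of `h`: it does not increase the `L^{r'}` norm, and it keeps a common bound and a
  -- common compact support, so that dominated convergence applies against the merely locally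
  -- integrable `g`.
  set hn : ℕ → Plane → ℝ := fun n =>
    MeasureTheory.convolution ((bump n).normed volume) h (ContinuousLinearMap.lsmul ℝ ℝ) volume
    with hn_def
  have hn_eq : ∀ n x, hn n x = ∫ t, (bump n).normed volume t * h (x - t) := fun n x => rfl
  have hsm : ∀ n, ContDiff ℝ ∞ (hn n) := fun n =>
    HasCompactSupport.contDiff_convolution_left _ (bump n).hasCompactSupport_normed
      (bump n).contDiff_normed hloc
  have hcsn : ∀ n, HasCompactSupport (hn n) := fun n =>
    HasCompactSupport.convolution _ (bump n).hasCompactSupport_normed hcs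
  have hbd : ∀ n x, |hn n x| ≤ B := by
    intro n x
    rw [hn_eq, ← Real.norm_eq_abs]
    calc ‖∫ t, (bump n).normed volume t * h (x - t)‖
        ≤ ∫ t, (bump n).normed volume t * B := by
          refine norm_integral_le_of_norm_le ((bump n).integrable_normed.mul_const B)
            (Eventually.of_forall fun t => ?_)
          rw [norm_mul, Real.norm_of_nonneg ((bump n).nonneg_normed t)]
          exact mul_le_mul_of_nonneg_left (hB _) ((bump n).nonneg_normed t)
      _ = B := by rw [integral_mul_const, (bump n).integral_normed, one_mul]
  have hzero : ∀ n x, x ∉ Metric.closedBall (0 : Plane) (R + 2) → hn n x = 0 := by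
    intro n x hx
    rw [hn_eq]
    refine integral_eq_zero_of_ae (Eventually.of_forall fun t => ?_)
    by_cases ht : t ∈ Function.support ((bump n).normed volume)
    · rw [(bump n).support_normed_eq] at ht
      have ht' : ‖t‖ < 2 := by
        have := (mem_ball_zero_iff.1 ht).trans_le (bump_rOut_le n); exact this
      have hx' : R + 2 < ‖x‖ := by simpa using hx
      have : R < ‖x - t‖ := by have := norm_sub_norm_le x t; linarith
      simp [hR _ this]
    · simp [Function.notMem_support.1 ht]
  -- Almost everywhere convergence requires the ratio of outer to inner radius of the bumps to stay
  -- bounded; here it is always `2`.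
  have hlim : ∀ᵐ x, Tendsto (fun n => hn n x) atTop (𝓝 (h x)) :=
    ContDiffBump.ae_convolution_tendsto_right_of_locallyIntegrable (K := 2)
      tendsto_bump_rOut (Eventually.of_forall fun n => by
        change (2 : ℝ) / (n + 1) ≤ 2 * (1 / (n + 1)); apply le_of_eq; ring) hloc
  have hnorm : ∀ n, ∫⁻ x, ‖hn n x‖ₑ ^ r' ≤ ∫⁻ x, ‖h x‖ₑ ^ r' := by
    intro n
    have h1 : ∫⁻ t, ‖(bump n).normed volume t‖ₑ = 1 := by
      rw [← ofReal_integral_norm_eq_lintegral_enorm (bump n).integrable_normed]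
      simp only [Real.norm_of_nonneg ((bump n).nonneg_normed _), (bump n).integral_normed,
        ENNReal.ofReal_one]
    calc ∫⁻ x, ‖hn n x‖ₑ ^ r'
        ≤ ∫⁻ x, (∫⁻ t, ‖(bump n).normed volume t‖ₑ * ‖h (x - t)‖ₑ) ^ r' := by
          refine lintegral_mono fun x => ENNReal.rpow_le_rpow ?_ (by linarith)
          rw [hn_eq]
          refine (enorm_integral_le_lintegral_enorm _).trans_eq ?_
          simp only [enorm_mul]
      _ ≤ _ := lintegral_rpow_conv_le hr' (bump n).continuous_normed.measurable.enorm hm.enorm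
      _ = _ := by rw [h1]; simp
  have htend : Tendsto (fun n => ∫ x, g x * hn n x) atTop (𝓝 (∫ x, g x * h x)) := by
    have hgK : IntegrableOn g (Metric.closedBall (0 : Plane) (R + 2)) :=
      hg.integrableOn_isCompact (isCompact_closedBall _ _)
    refine tendsto_integral_of_dominated_convergence
      ((Metric.closedBall (0 : Plane) (R + 2)).indicator fun x => B * ‖g x‖) ?_ ?_ ?_ ?_
    · exact fun n => hg.aestronglyMeasurable.mul (hsm n).continuous.aestronglyMeasurable
    · rw [integrable_indicator_iff measurableSet_closedBall]
      exact hgK.norm.const_mul B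
    · refine fun n => Eventually.of_forall fun x => ?_
      by_cases hx : x ∈ Metric.closedBall (0 : Plane) (R + 2)
      · rw [indicator_of_mem hx, norm_mul, mul_comm]
        exact mul_le_mul_of_nonneg_right (hbd n x) (norm_nonneg _)
      · rw [indicator_of_notMem hx, hzero n x hx]; simp
    · filter_upwards [hlim] with x hx using hx.const_mul _
  refine le_of_tendsto (htend.enorm) (Eventually.of_forall fun n => ?_)
  refine (H _ (hsm n) (hcsn n)).trans ?_
  exact mul_le_mul' le_rfl (ENNReal.rpow_le_rpow (hnorm n) (by positivity))

/-- The dual characterisation of the `L^r` norm, with smooth compactly supported test functions. -/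
theorem lintegral_rpow_le_of_dual {r r' : ℝ} (hr : r.HolderConjugate r') {g : Plane → ℝ}
    (hg : LocallyIntegrable g volume) {N : ℝ≥0∞}
    (H : ∀ φ : Plane → ℝ, ContDiff ℝ ∞ φ → HasCompactSupport φ →
      ‖∫ x, g x * φ x‖ₑ ≤ N * (∫⁻ x, ‖φ x‖ₑ ^ r') ^ (1 / r')) :
    ∫⁻ x, ‖g x‖ₑ ^ r ≤ N ^ r := by
  wlog hgm : Measurable g generalizing g
  · have hae := hg.aestronglyMeasurable.ae_eq_mk
    have := this (g := hg.aestronglyMeasurable.mk g) (fun x => by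
        obtain ⟨s, hs, hs'⟩ := hg x
        exact ⟨s, hs, hs'.congr (ae_restrict_of_ae hae)⟩) (fun φ h1 h2 => by
          rw [← integral_congr_ae (hae.mono fun x hx => by
            change g x * φ x = hg.aestronglyMeasurable.mk g x * φ x; rw [hx])]
          exact H φ h1 h2) hg.aestronglyMeasurable.stronglyMeasurable_mk.measurable
    rwa [lintegral_congr_ae (hae.mono fun x hx => by
      change ‖g x‖ₑ ^ r = ‖hg.aestronglyMeasurable.mk g x‖ₑ ^ r; rw [hx])]
  have hr0 : 0 < r := hr.pos
  have hr1 : 1 < r := hr.lt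
  have hr'0 : 0 < r' := hr.symm.pos
  -- Both `x` and `g x` are truncated: this makes the extremal function bounded with bounded
  -- support, hence admissible, and the truncated norm finite.
  set S : ℕ → Set Plane := fun n => Metric.closedBall 0 n ∩ {x | |g x| ≤ n} with hS
  have hSm : ∀ n, MeasurableSet (S n) := fun n =>
    measurableSet_closedBall.inter (measurableSet_le hgm.abs measurable_const)
  have hmono : Monotone S := by
    intro m n hmn x hx
    have : (m : ℝ) ≤ n := by exact_mod_cast hmn
    exact ⟨Metric.closedBall_subset_closedBall this hx.1, le_trans hx.2 this⟩
  have hU : ⋃ n, S n = univ := by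
    refine eq_univ_of_forall fun x => mem_iUnion.2 ?_
    obtain ⟨n, hn⟩ := exists_nat_ge (max ‖x‖ |g x|)
    exact ⟨n, by simpa using (le_max_left _ _).trans hn, (le_max_right _ _).trans hn⟩
  have key : ∀ n, ∫⁻ x in S n, ‖g x‖ₑ ^ r ≤ N ^ r := by
    intro n
    -- The extremal function in Hölder's inequality: on `S n`, both `g * h` and `|h| ^ r'` equal
    -- `|g| ^ r`.
    set h : Plane → ℝ := (S n).indicator fun x => SignType.sign (g x) * |g x| ^ (r - 1) with hh
    have hm : Measurable h := by
      refine Measurable.indicator ?_ (hSm n)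
      have h1 : Measurable fun x => ((SignType.sign (g x) : SignType) : ℝ) := by
        have : Measurable fun y : ℝ => ((SignType.sign y : SignType) : ℝ) := by
          have e : (fun y : ℝ => ((SignType.sign y : SignType) : ℝ)) =
              fun y => if 0 < y then 1 else if y < 0 then -1 else 0 := by
            ext y
            simp only [sign_apply]
            split_ifs <;> simp
          rw [e]
          exact Measurable.ite measurableSet_Ioi measurable_const
            (Measurable.ite measurableSet_Iio measurable_const measurable_const)
        exact this.comp hgm
      exact h1.mul (hgm.abs.pow_const _)
    have hgh : ∀ x, g x * h x = (S n).indicator (fun x => |g x| ^ r) x := by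
      intro x
      by_cases hx : x ∈ S n
      · rw [hh, indicator_of_mem hx, indicator_of_mem hx, ← mul_assoc, mul_comm (g x),
          sign_mul_self]
        rcases eq_or_ne (g x) 0 with h0 | h0
        · simp [h0, Real.zero_rpow hr0.ne']
        · conv_lhs => rw [← Real.rpow_one |g x|, ← Real.rpow_mul (abs_nonneg _)]
          rw [← Real.rpow_add (abs_pos.2 h0)]
          congr 1; ring
      · simp [hh, indicator_of_notMem hx]
    have habs : ∀ x, |h x| ≤ (S n).indicator (fun x => |g x| ^ (r - 1)) x := by
      intro x
      by_cases hx : x ∈ S n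
      · rw [hh, indicator_of_mem hx, indicator_of_mem hx, abs_mul,
          abs_of_nonneg (Real.rpow_nonneg (abs_nonneg _) _)]
        refine mul_le_of_le_one_left (Real.rpow_nonneg (abs_nonneg _) _) ?_
        rcases lt_trichotomy (g x) 0 with h | h | h <;> simp [h]
      · simp [hh, indicator_of_notMem hx]
    have hbd : ∀ x, |h x| ≤ (n : ℝ) ^ (r - 1) := by
      intro x
      refine (habs x).trans ?_
      by_cases hx : x ∈ S n
      · rw [indicator_of_mem hx]
        exact Real.rpow_le_rpow (abs_nonneg _) hx.2 (by linarith)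
      · rw [indicator_of_notMem hx]; positivity
    have hzero : ∀ x, (n : ℝ) < ‖x‖ → h x = 0 := by
      intro x hx
      rw [hh, indicator_of_notMem]
      intro hx'
      have : ‖x‖ ≤ n := by simpa using hx'.1
      linarith
    have h1 := enorm_integral_mul_le_of_dual hr.symm.lt.le hg H hm hbd hzero
    set Z := ∫⁻ x in S n, ‖g x‖ₑ ^ r with hZ
    have hrp : ∀ y : ℝ, ‖|y| ^ r‖ₑ = ‖y‖ₑ ^ r := fun y => by
      rw [Real.enorm_rpow_of_nonneg (abs_nonneg _) hr0.le, Real.enorm_abs]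
    -- Finiteness is what allows `Z ≤ N * Z ^ (1 / r')` to be divided by `Z ^ (1 / r')` below.
    have hZfin : Z ≠ ⊤ := by
      refine ne_top_of_le_ne_top (b := ∫⁻ x in S n, ENNReal.ofReal (n : ℝ) ^ r) ?_ ?_
      · rw [lintegral_const, Measure.restrict_apply_univ]
        refine ENNReal.mul_ne_top (ENNReal.rpow_ne_top_of_nonneg hr0.le ENNReal.ofReal_ne_top) ?_
        exact ((measure_mono inter_subset_left).trans_lt measure_closedBall_lt_top).ne
      · refine setLIntegral_mono_ae (by fun_prop) (Eventually.of_forall fun x hx => ?_)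
        gcongr
        rw [← ofReal_norm]
        exact ENNReal.ofReal_le_ofReal hx.2
    have h2 : ‖∫ x, g x * h x‖ₑ = Z := by
      simp_rw [hgh]
      rw [integral_indicator (hSm n), Real.enorm_eq_ofReal (integral_nonneg fun x => by positivity),
        ofReal_integral_eq_lintegral_ofReal]
      · refine lintegral_congr fun x => ?_
        rw [← hrp, Real.enorm_eq_ofReal (by positivity)]
      · refine ⟨(hgm.abs.pow_const r).aestronglyMeasurable, ?_⟩
        rw [HasFiniteIntegral]
        simp_rw [hrp]
        exact hZfin.lt_top
      · exact Eventually.of_forall fun x => by positivity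
    have h3 : ∫⁻ x, ‖h x‖ₑ ^ r' ≤ Z := by
      rw [hZ, ← lintegral_indicator (hSm n)]
      refine lintegral_mono fun x => ?_
      by_cases hx : x ∈ S n
      · rw [indicator_of_mem hx]
        have := habs x
        rw [indicator_of_mem hx] at this
        calc ‖h x‖ₑ ^ r' ≤ (‖g x‖ₑ ^ (r - 1)) ^ r' := by
              gcongr
              rw [← Real.enorm_abs (g x), ← Real.enorm_rpow_of_nonneg (abs_nonneg _) (by linarith)]
              refine enorm_le_iff_norm_le.2 ?_
              rwa [Real.norm_eq_abs, Real.norm_of_nonneg (by positivity)]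
          _ = ‖g x‖ₑ ^ r := by
              rw [← ENNReal.rpow_mul, hr.sub_one_mul_conj]
      · rw [indicator_of_notMem hx, hh, indicator_of_notMem hx]
        simp [hr'0]
    rw [h2] at h1
    have h4 : Z ≤ N * Z ^ (1 / r') := h1.trans (by gcongr)
    rcases eq_or_ne Z 0 with h0 | h0
    · rw [h0]; exact zero_le
    have hinv : 1 / r = 1 - 1 / r' := by
      have := hr.inv_add_inv_eq_one; rw [one_div, one_div]; linarith
    have h5 : Z ^ (1 / r) ≤ N := by
      rw [hinv, ENNReal.rpow_sub _ _ h0 hZfin, ENNReal.rpow_one]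
      exact ENNReal.div_le_of_le_mul h4
    calc Z = (Z ^ (1 / r)) ^ r := by
          rw [← ENNReal.rpow_mul, one_div_mul_cancel hr0.ne', ENNReal.rpow_one]
      _ ≤ N ^ r := by gcongr
  have hd : Directed (· ⊆ ·) S := hmono.directed_le
  rw [← setLIntegral_univ, ← hU, setLIntegral_iUnion_of_directed _ hd]
  exact iSup_le key

end Duality

/-! ### Poisson kernels and Cauchy integrals in the upper half plane. -/

section Hilbert

/-- The Poisson kernel of the upper half plane. -/
def poisson (y s : ℝ) : ℝ := y / (Real.pi * (s ^ 2 + y ^ 2))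

/-- The conjugate Poisson kernel of the upper half plane. -/
def conjPoisson (y s : ℝ) : ℝ := s / (Real.pi * (s ^ 2 + y ^ 2))

theorem continuous_poisson {y : ℝ} (hy : 0 < y) : Continuous (poisson y) := by
  unfold poisson
  exact continuous_const.div (by fun_prop) fun s => by positivity

theorem continuous_conjPoisson {y : ℝ} (hy : 0 < y) : Continuous (conjPoisson y) := by
  unfold conjPoisson
  exact continuous_id.div (by fun_prop) fun s => by positivity

theorem lintegral_poisson {y : ℝ} (hy : 0 < y) : ∫⁻ s, ‖poisson y s‖ₑ = 1 := by
  lift y to NNReal using hy.le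
  rw [← ProbabilityTheory.lintegral_cauchyPDF_eq_one 0 (γ := y) (by exact_mod_cast hy.ne')]
  refine lintegral_congr fun s => ?_
  rw [ProbabilityTheory.cauchyPDF_def, ProbabilityTheory.cauchyPDFReal_def,
    Real.enorm_eq_ofReal (by unfold poisson; positivity)]
  congr 1
  simp only [poisson, sub_zero]
  have : (s ^ 2 + (y : ℝ) ^ 2) ≠ 0 := by positivity
  field_simp

/-- The elementary inequality behind M. Riesz's theorem on conjugate functions. -/
theorem exists_norm_rpow_le_re {p : ℝ} (hp : 1 < p) (hp2 : p ≤ 2) :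
    ∃ A B : ℝ, 0 ≤ A ∧ 0 ≤ B ∧
      ∀ z : ℂ, 0 < z.re → ‖z‖ ^ p ≤ A * z.re ^ p - B * (z ^ (p : ℂ)).re := by
  have hpi := Real.pi_pos
  have hp0 : 0 < p := by linarith
  -- The midpoint of `π/(2p)` and `π/2`, so that `p θ₀` lies strictly between `π/2` and `π`. For
  -- `|arg z| ≥ θ₀` the real part of `z ^ p` is negative and supplies the bound; for smaller angles
  -- `re z` is comparable to `‖z‖`. The hypothesis `p ≤ 2` keeps `p * |arg z|` below `π`, where the
  -- cosine decreases.
  set θ₀ : ℝ := (Real.pi / (2 * p) + Real.pi / 2) / 2 with hθ₀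
  have e : p * θ₀ = Real.pi / 4 + p * Real.pi / 4 := by rw [hθ₀]; field_simp; ring
  have h1 : Real.pi / 2 < p * θ₀ := by rw [e]; nlinarith
  have h2 : θ₀ < Real.pi / 2 := by
    have : Real.pi / (2 * p) < Real.pi / 2 := by gcongr; linarith
    rw [hθ₀]; linarith
  have h0 : 0 < θ₀ := by positivity
  have h3 : p * θ₀ < Real.pi := by rw [e]; nlinarith
  set κ := -Real.cos (p * θ₀) with hκ
  have hκ0 : 0 < κ := by
    have := Real.cos_neg_of_pi_div_two_lt_of_lt h1 (by linarith)
    linarith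
  set c := Real.cos θ₀ with hc
  have hc0 : 0 < c := Real.cos_pos_of_mem_Ioo ⟨by linarith, h2⟩
  -- `B = 1/κ` gives exactly `1` in the outer sector. In the inner sector `A * cos ^ p ≥ 1 + 1/κ`,
  -- which still leaves `1` after the loss of at most `B`.
  refine ⟨(1 + 1 / κ) / c ^ p, 1 / κ, by positivity, by positivity, fun z hz => ?_⟩
  have hz0 : z ≠ 0 := by rintro rfl; simp at hz
  have hn : 0 < ‖z‖ := norm_pos_iff.2 hz0
  set θ := |Complex.arg z| with hθ
  have hθ2 : θ < Real.pi / 2 := Complex.abs_arg_lt_pi_div_two_iff.2 (Or.inl hz)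
  have hre : z.re = ‖z‖ * Real.cos θ := by
    rw [hθ, Real.cos_abs, Complex.norm_mul_cos_arg]
  have hcos : 0 < Real.cos θ := Real.cos_pos_of_mem_Ioo ⟨by have := abs_nonneg z.arg; linarith, hθ2⟩
  have hpow : (z ^ (p : ℂ)).re = ‖z‖ ^ p * Real.cos (p * θ) := by
    rw [Complex.cpow_ofReal_re, ← Real.cos_abs (z.arg * p), abs_mul, abs_of_pos hp0, mul_comm p]
  have key : 1 ≤ (1 + 1 / κ) / c ^ p * Real.cos θ ^ p - 1 / κ * Real.cos (p * θ) := by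
    rcases le_or_gt θ₀ θ with h | h
    · have h4 : Real.cos (p * θ) ≤ -κ := by
        rw [hκ, neg_neg]
        exact Real.cos_le_cos_of_nonneg_of_le_pi (by positivity) (by nlinarith) (by gcongr)
      have h5 : 0 ≤ (1 + 1 / κ) / c ^ p * Real.cos θ ^ p := by positivity
      have h6 : 1 / κ * Real.cos (p * θ) ≤ 1 / κ * (-κ) := by gcongr
      have h7 : 1 / κ * (-κ) = -1 := by field_simp
      linarith
    · have h4 : c ≤ Real.cos θ :=
        Real.cos_le_cos_of_nonneg_of_le_pi (abs_nonneg _) (by linarith) h.le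
      have h5 : (1 + 1 / κ) / c ^ p * c ^ p ≤ (1 + 1 / κ) / c ^ p * Real.cos θ ^ p := by gcongr
      have h6 : (1 + 1 / κ) / c ^ p * c ^ p = 1 + 1 / κ := by field_simp
      have h7 : 1 / κ * Real.cos (p * θ) ≤ 1 / κ * 1 := by gcongr; exact Real.cos_le_one _
      linarith
  rw [hpow, hre, Real.mul_rpow hn.le hcos.le]
  calc ‖z‖ ^ p = ‖z‖ ^ p * 1 := (mul_one _).symm
    _ ≤ ‖z‖ ^ p * ((1 + 1 / κ) / c ^ p * Real.cos θ ^ p - 1 / κ * Real.cos (p * θ)) := by gcongr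
    _ = _ := by ring

/-- The Cauchy integral of `φ`, normalised so that its real part is the Poisson integral. -/
def cauchyInt (φ : ℝ → ℝ) (z : ℂ) : ℂ := ∫ t, (Complex.I / Real.pi) * (φ t / (z - t))

variable {φ : ℝ → ℝ}

theorem sub_ofReal_ne_zero {z : ℂ} (hz : 0 < z.im) (t : ℝ) : z - t ≠ 0 := by
  intro h
  have := congrArg Complex.im h
  simp at this
  linarith

theorem continuous_cauchyInt_integrand (hφ : Continuous φ) {z : ℂ} (hz : 0 < z.im) :
    Continuous fun t : ℝ => (Complex.I / Real.pi) * ((φ t : ℂ) / (z - t)) :=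
  continuous_const.mul ((Complex.continuous_ofReal.comp hφ).div (by fun_prop)
    fun t => sub_ofReal_ne_zero hz t)

theorem integrable_cauchyInt_integrand (hφ : Continuous φ) (hc : HasCompactSupport φ) {z : ℂ}
    (hz : 0 < z.im) : Integrable fun t : ℝ => (Complex.I / Real.pi) * ((φ t : ℂ) / (z - t)) := by
  refine (continuous_cauchyInt_integrand hφ hz).integrable_of_hasCompactSupport ?_
  refine hc.mono fun t ht => ?_
  contrapose! ht
  simp [Function.notMem_support.1 ht]

theorem norm_cauchyInt_le (hφ : Continuous φ) (hc : HasCompactSupport φ) {z : ℂ}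
    {c : ℝ} (hc0 : 0 < c) (h : ∀ t, φ t ≠ 0 → c ≤ ‖z - t‖) :
    ‖cauchyInt φ z‖ ≤ (∫ t, |φ t|) / c := by
  have hφi : Integrable fun t => |φ t| := (hφ.integrable_of_hasCompactSupport hc).abs
  rw [← integral_div]
  refine norm_integral_le_of_norm_le (hφi.div_const c) (Eventually.of_forall fun t => ?_)
  by_cases ht : φ t = 0
  · simp [ht]
  have h1 := h t ht
  have hpi : 1 ≤ Real.pi := by linarith [Real.pi_gt_three]
  rw [norm_mul, norm_div, norm_div, Complex.norm_I, Complex.norm_real, Complex.norm_real,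
    Real.norm_eq_abs, Real.norm_eq_abs, abs_of_pos Real.pi_pos]
  calc 1 / Real.pi * (|φ t| / ‖z - t‖) ≤ 1 * (|φ t| / c) := by
        gcongr
        exact (div_le_one Real.pi_pos).2 hpi
    _ = _ := one_mul _

theorem differentiableAt_cauchyInt (hφ : Continuous φ) (hc : HasCompactSupport φ) {z : ℂ}
    (hz : 0 < z.im) : DifferentiableAt ℂ (cauchyInt φ) z := by
  have hb : ∀ x ∈ Metric.ball z (z.im / 2), z.im / 2 < x.im := by
    intro x hx
    have h1 : |(x - z).im| < z.im / 2 :=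
      (Complex.abs_im_le_norm _).trans_lt (by simpa [dist_eq_norm] using hx)
    have := (abs_lt.1 h1).1
    simp at this
    linarith
  have hφi : Integrable fun t => |φ t| := (hφ.integrable_of_hasCompactSupport hc).abs
  have key := hasDerivAt_integral_of_dominated_loc_of_deriv_le (μ := volume) (𝕜 := ℂ)
    (F := fun z (t : ℝ) => (Complex.I / Real.pi) * ((φ t : ℂ) / (z - t)))
    (F' := fun z (t : ℝ) => (Complex.I / Real.pi) * (-(φ t : ℂ) / (z - t) ^ 2)) (x₀ := z)
    (bound := fun t => |φ t| / (z.im / 2) ^ 2)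
    (Metric.ball_mem_nhds z (half_pos hz)) ?_ (integrable_cauchyInt_integrand hφ hc hz) ?_ ?_ ?_ ?_
  · exact key.2.differentiableAt
  · filter_upwards [Metric.ball_mem_nhds z (half_pos hz)] with x hx
    exact (continuous_cauchyInt_integrand hφ
      ((half_pos hz).trans (hb x hx))).aestronglyMeasurable
  · refine Continuous.aestronglyMeasurable (continuous_const.mul (Continuous.div (by fun_prop)
      (by fun_prop) fun t => pow_ne_zero _ (sub_ofReal_ne_zero hz t)))
  · refine Eventually.of_forall fun t x hx => ?_
    have h1 := hb x hx
    have h2 : z.im / 2 ≤ ‖x - t‖ := by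
      have := (Complex.abs_im_le_norm (x - t))
      simp at this
      exact h1.le.trans ((le_abs_self _).trans this)
    have hpi : 1 ≤ Real.pi := by linarith [Real.pi_gt_three]
    rw [norm_mul, norm_div, norm_div, norm_neg, Complex.norm_I, Complex.norm_real,
      Complex.norm_real, Real.norm_eq_abs, Real.norm_eq_abs, abs_of_pos Real.pi_pos, norm_pow]
    calc 1 / Real.pi * (|φ t| / ‖x - t‖ ^ 2) ≤ 1 * (|φ t| / (z.im / 2) ^ 2) := by
          gcongr
          exact (div_le_one Real.pi_pos).2 hpi
      _ = _ := one_mul _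
  · exact hφi.div_const _
  · refine Eventually.of_forall fun t x hx => ?_
    have h1 := sub_ofReal_ne_zero ((half_pos hz).trans (hb x hx)) t
    have h2 : HasDerivAt (fun x : ℂ => x - t) 1 x := (hasDerivAt_id x).sub_const _
    have h3 := ((hasDerivAt_const x (φ t : ℂ)).div h2 h1).const_mul (Complex.I / Real.pi)
    exact h3.congr_deriv (by simp)

/-- Since `i / (s + i y) = (y + i s) / (s² + y²)`, the Poisson and conjugate Poisson integrals are
the real and imaginary parts of one holomorphic function. A bound for that function in terms of its
real part is therefore a bound for the conjugate kernel. -/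
theorem cauchyInt_eq (hφ : Continuous φ) (hc : HasCompactSupport φ) {y : ℝ} (hy : 0 < y) (x : ℝ) :
    cauchyInt φ (x + y * Complex.I) = ((∫ s, poisson y s * φ (x - s) : ℝ) : ℂ) +
      ((∫ s, conjPoisson y s * φ (x - s) : ℝ) : ℂ) * Complex.I := by
  have hcs : ∀ k : ℝ → ℝ, Continuous k → Integrable fun s => k s * φ (x - s) := by
    intro k hk
    refine (hk.mul (hφ.comp (by fun_prop))).integrable_of_hasCompactSupport ?_
    exact (hc.comp_homeomorph (Homeomorph.subLeft x)).mul_left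
  have hz : 0 < (x + y * Complex.I : ℂ).im := by simp [hy]
  rw [cauchyInt, ← integral_sub_left_eq_self _ _ x, ← integral_complex_ofReal,
    ← integral_complex_ofReal, ← integral_mul_const, ← integral_add]
  · refine integral_congr_ae (Eventually.of_forall fun s => ?_)
    have h1 : (x + y * Complex.I : ℂ) - ((x - s : ℝ) : ℂ) ≠ 0 := sub_ofReal_ne_zero hz _
    have h2 : ((s : ℂ) ^ 2 + (y : ℂ) ^ 2) ≠ 0 := by
      have : (s ^ 2 + y ^ 2 : ℝ) ≠ 0 := by positivity
      exact_mod_cast this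
    have h3 : (Real.pi : ℂ) ≠ 0 := by exact_mod_cast Real.pi_ne_zero
    have h4 : (x + y * Complex.I : ℂ) - ((x - s : ℝ) : ℂ) = s + y * Complex.I := by
      push_cast; ring
    rw [h4] at h1
    have h5 : (s + y * Complex.I : ℂ)⁻¹ = (s - y * Complex.I) / ((s : ℂ) ^ 2 + (y : ℂ) ^ 2) := by
      rw [inv_eq_one_div, div_eq_div_iff h1 h2]
      linear_combination (y : ℂ) ^ 2 * Complex.I_sq
    simp only [poisson, conjPoisson]
    rw [h4, div_eq_mul_inv _ (s + y * Complex.I : ℂ), h5]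
    push_cast
    field_simp
    linear_combination (-(y : ℂ) * φ (x - s)) * Complex.I_sq
  · exact (hcs _ (continuous_poisson hy)).ofReal
  · exact (hcs _ (continuous_conjPoisson hy)).ofReal.mul_const _

end Hilbert

/-! ### M. Riesz's theorem on conjugate functions. -/

section Hilbert

variable {φ : ℝ → ℝ}

/-- The two decay rates serve the contour argument: decay in `re z` handles the vertical sides and
integrability along horizontal lines, decay in `im z` handles the top side. Both come from the
distance of `z` to the compact support of `φ`. -/
theorem exists_norm_cauchyInt_le (hφ : Continuous φ) (hc : HasCompactSupport φ) {y : ℝ}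
    (hy : 0 < y) : ∃ D : ℝ, 0 < D ∧ ∀ z : ℂ, y ≤ z.im → ‖cauchyInt φ z‖ ≤ D / (1 + |z.re|) ∧
      ‖cauchyInt φ z‖ ≤ D / z.im := by
  obtain ⟨R, hR0, hR⟩ : ∃ R : ℝ, 0 < R ∧ ∀ t, φ t ≠ 0 → |t| ≤ R := by
    obtain ⟨R, hR⟩ := hc.isCompact.isBounded.subset_closedBall (0 : ℝ)
    refine ⟨max R 1, by positivity, fun t ht => ?_⟩
    have := hR (subset_tsupport _ ht)
    rw [mem_closedBall_zero_iff] at this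
    exact this.trans (le_max_left _ _)
  set I := ∫ t, |φ t|
  have hI : 0 ≤ I := integral_nonneg fun t => abs_nonneg _
  set c := (1 + R) / y + 1
  have hc1 : 1 ≤ c := by have : 0 ≤ (1 + R) / y := by positivity
                         linarith
  have hc0 : 0 < c := by linarith
  refine ⟨(I + 1) * c, by positivity, fun z hz => ?_⟩
  have hz0 : 0 < z.im := hy.trans_le hz
  constructor
  · refine (norm_cauchyInt_le hφ hc (c := (1 + |z.re|) / c) (by positivity) fun t ht => ?_).trans ?_
    · have h1 := Complex.abs_im_le_norm (z - t)
      have h2 := Complex.abs_re_le_norm (z - t)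
      simp only [Complex.sub_im, Complex.ofReal_im, sub_zero, Complex.sub_re,
        Complex.ofReal_re] at h1 h2
      have h3 := hR t ht
      have h4 : |z.re| - |t| ≤ |z.re - t| := abs_sub_abs_le_abs_sub _ _
      have h5 : y ≤ ‖z - t‖ := hz.trans ((le_abs_self _).trans h1)
      rw [div_le_iff₀ hc0]
      have h6 : (1 + R) ≤ ‖z - t‖ * ((1 + R) / y) := by
        rw [mul_div_assoc', le_div_iff₀ hy]
        nlinarith
      have : ‖z - t‖ * c = ‖z - t‖ * ((1 + R) / y) + ‖z - t‖ := by ring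
      linarith
    · rw [div_div_eq_mul_div]
      gcongr
      linarith
  · refine (norm_cauchyInt_le hφ hc hz0 fun t _ => ?_).trans ?_
    · have h1 := Complex.abs_im_le_norm (z - t)
      simp only [Complex.sub_im, Complex.ofReal_im, sub_zero] at h1
      exact (le_abs_self _).trans h1
    · gcongr
      nlinarith

/-- The real part is an average of `φ ≥ 0` against a strictly positive kernel. The values thus stay
in the right half plane, where `z ^ p` is holomorphic and the elementary inequality holds. -/
theorem re_cauchyInt_pos (hφ : Continuous φ) (hc : HasCompactSupport φ) (h0 : ∀ t, 0 ≤ φ t)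
    (hne : φ ≠ 0) {z : ℂ} (hz : 0 < z.im) : 0 < (cauchyInt φ z).re := by
  have e : cauchyInt φ z = cauchyInt φ (z.re + z.im * Complex.I) := by rw [Complex.re_add_im]
  rw [e, cauchyInt_eq hφ hc hz]
  simp only [Complex.add_re, Complex.ofReal_re, Complex.mul_re, Complex.I_re, mul_zero,
    Complex.ofReal_im, Complex.I_im, zero_mul, sub_zero, add_zero]
  obtain ⟨t, ht⟩ := Function.ne_iff.1 hne
  have hpos : ∀ s, 0 < poisson z.im s := fun s => by unfold poisson; positivity
  refine Continuous.integral_pos_of_hasCompactSupport_nonneg_nonzero (x := z.re - t)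
    ((continuous_poisson hz).mul (hφ.comp (by fun_prop)))
    (hc.comp_homeomorph (Homeomorph.subLeft z.re)).mul_left (fun s => ?_) ?_
  · exact mul_nonneg (hpos s).le (h0 _)
  · simpa using ⟨(hpos _).ne', ht⟩

theorem integrable_one_add_abs_rpow {p : ℝ} (hp : 1 < p) (D : ℝ) (hD : 0 < D) :
    Integrable fun x : ℝ => (D / (1 + |x|)) ^ p := by
  have h := (integrable_one_add_norm (E := ℝ) (μ := volume) (r := p) (by simpa using hp)).const_mul
    (D ^ p)
  refine h.congr (Eventually.of_forall fun x => ?_)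
  simp only [Real.norm_eq_abs]
  rw [Real.div_rpow hD.le (by positivity), Real.rpow_neg (by positivity)]
  rfl

/-- The integral of `F^p` along a horizontal line vanishes. -/
theorem integral_cauchyInt_cpow (hφ : Continuous φ) (hc : HasCompactSupport φ) (h0 : ∀ t, 0 ≤ φ t)
    (hne : φ ≠ 0) {p : ℝ} (hp : 1 < p) {y : ℝ} (hy : 0 < y) :
    Integrable (fun x : ℝ => cauchyInt φ (x + y * Complex.I) ^ (p : ℂ)) ∧
    ∫ x : ℝ, cauchyInt φ (x + y * Complex.I) ^ (p : ℂ) = 0 := by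
  have hp0 : 0 < p := by linarith
  obtain ⟨D, hD, hb⟩ := exists_norm_cauchyInt_le hφ hc hy
  set Φ : ℂ → ℂ := fun z => cauchyInt φ z ^ (p : ℂ) with hΦ
  have hdiff : ∀ z : ℂ, 0 < z.im → DifferentiableAt ℂ Φ z := fun z hz =>
    (differentiableAt_cauchyInt hφ hc hz).cpow_const (Or.inl (re_cauchyInt_pos hφ hc h0 hne hz))
  have hn : ∀ z, ‖Φ z‖ = ‖cauchyInt φ z‖ ^ p := fun z => Complex.norm_cpow_real _ _
  have hn1 : ∀ z : ℂ, y ≤ z.im → ‖Φ z‖ ≤ (D / (1 + |z.re|)) ^ p := fun z hz => by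
    rw [hn]; exact Real.rpow_le_rpow (norm_nonneg _) (hb z hz).1 hp0.le
  have hn2 : ∀ z : ℂ, y ≤ z.im → ‖Φ z‖ ≤ (D / z.im) ^ p := fun z hz => by
    rw [hn]; exact Real.rpow_le_rpow (norm_nonneg _) (hb z hz).2 hp0.le
  have hcont : Continuous fun x : ℝ => Φ (x + y * Complex.I) := by
    refine continuous_iff_continuousAt.2 fun x => ?_
    have h1 : 0 < (x + y * Complex.I : ℂ).im := by simp [hy]
    exact ContinuousAt.comp (f := fun x : ℝ => (x + y * Complex.I : ℂ)) (hdiff _ h1).continuousAt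
      (by fun_prop)
  have hint : Integrable fun x : ℝ => Φ (x + y * Complex.I) := by
    refine (integrable_one_add_abs_rpow hp D hD).mono' hcont.aestronglyMeasurable
      (Eventually.of_forall fun x => ?_)
    have := hn1 (x + y * Complex.I) (by simp)
    simpa using this
  refine ⟨hint, ?_⟩
  -- Cauchy's theorem on the rectangle over `[-S, S]` with heights from `y` to `y + S`. The three
  -- far sides have total length `4 S` and the integrand there is at most `(D / S) ^ p`; the product
  -- tends to `0` because `p > 1`.
  have hrect : ∀ S : ℝ, 0 < S → ‖∫ x in (-S)..S, Φ (x + y * Complex.I)‖ ≤ 4 * S * (D / S) ^ p := by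
    intro S hS
    have key := Complex.integral_boundary_rect_eq_zero_of_differentiableOn Φ
      (-S + y * Complex.I) (S + (y + S : ℝ) * Complex.I) (by
        intro z hz
        have h1 : z.im ∈ uIcc y (y + S) := by simpa using hz.2
        rw [uIcc_of_le (by linarith)] at h1
        exact (hdiff z (hy.trans_le h1.1)).differentiableWithinAt)
    simp only [Complex.add_re, Complex.neg_re, Complex.ofReal_re, Complex.mul_re, Complex.I_re,
      mul_zero, Complex.ofReal_im, Complex.I_im, mul_one, sub_zero, add_zero, Complex.add_im,
      Complex.neg_im, Complex.mul_im, neg_zero, zero_add] at key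
    have e2 : ‖∫ x in (-S)..S, Φ (x + (y + S : ℝ) * Complex.I)‖ ≤ (D / S) ^ p * |S - (-S)| := by
      refine intervalIntegral.norm_integral_le_of_norm_le_const fun x _ => ?_
      have := hn2 (x + (y + S : ℝ) * Complex.I) (by simp; linarith)
      refine this.trans (Real.rpow_le_rpow (by simp; positivity) ?_ hp0.le)
      have : (x + (y + S : ℝ) * Complex.I : ℂ).im = y + S := by simp
      rw [this]
      gcongr
      linarith
    have e3 : ∀ a : ℝ, |a| = S → ‖∫ t in y..(y + S), Φ (a + t * Complex.I)‖ ≤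
        (D / S) ^ p * |y + S - y| := by
      intro a ha
      refine intervalIntegral.norm_integral_le_of_norm_le_const fun t ht => ?_
      rw [uIoc_of_le (by linarith)] at ht
      have := hn1 (a + t * Complex.I) (by simpa using ht.1.le)
      refine this.trans (Real.rpow_le_rpow (by positivity) ?_ hp0.le)
      have : (a + t * Complex.I : ℂ).re = a := by simp
      rw [this, ha]
      gcongr
      linarith
    have e4 := e3 S (abs_of_pos hS)
    have e5 := e3 (-S) (by rw [abs_neg, abs_of_pos hS])
    have e6 : |S - (-S)| = 2 * S := by rw [abs_of_pos (by linarith)]; ring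
    have e7 : |y + S - y| = S := by rw [abs_of_pos (by linarith)]; ring
    rw [e6] at e2
    rw [e7] at e4 e5
    have key' : (∫ x in (-S)..S, Φ (x + y * Complex.I)) =
        (∫ x in (-S)..S, Φ (x + (y + S : ℝ) * Complex.I)) -
        Complex.I • (∫ t in y..(y + S), Φ (S + t * Complex.I)) +
        Complex.I • (∫ t in y..(y + S), Φ ((-S : ℝ) + t * Complex.I)) := by
      linear_combination key
    rw [key']
    refine (norm_add_le _ _).trans ?_
    refine (add_le_add (norm_sub_le _ _) le_rfl).trans ?_
    simp only [norm_smul, Complex.norm_I, one_mul]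
    linarith
  have hlim : Tendsto (fun S : ℝ => ∫ x in (-S)..S, Φ (x + y * Complex.I)) atTop
      (𝓝 (∫ x : ℝ, Φ (x + y * Complex.I))) :=
    intervalIntegral_tendsto_integral hint tendsto_neg_atTop_atBot tendsto_id
  have hzero : Tendsto (fun S : ℝ => 4 * S * (D / S) ^ p) atTop (𝓝 0) := by
    have h1 := (tendsto_rpow_neg_atTop (y := p - 1) (by linarith)).const_mul (4 * D ^ p)
    rw [mul_zero] at h1
    refine h1.congr' ?_
    filter_upwards [eventually_gt_atTop 0] with S hS
    rw [Real.div_rpow hD.le hS.le, neg_sub, Real.rpow_sub hS, Real.rpow_one]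
    ring
  refine tendsto_nhds_unique hlim (squeeze_zero_norm' ?_ hzero)
  filter_upwards [eventually_gt_atTop 0] with S hS using hrect S hS

/-- M. Riesz's theorem for non-negative functions, `1 < p ≤ 2`. -/
theorem exists_conjPoisson_bound_of_nonneg {p : ℝ} (hp : 1 < p) (hp2 : p ≤ 2) :
    ∃ A : ℝ, 0 ≤ A ∧ ∀ φ : ℝ → ℝ, Continuous φ → HasCompactSupport φ → (∀ t, 0 ≤ φ t) →
      ∀ y : ℝ, 0 < y → ∫⁻ x, ‖∫ s, conjPoisson y s * φ (x - s)‖ₑ ^ p ≤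
        ENNReal.ofReal A * ∫⁻ x, ‖φ x‖ₑ ^ p := by
  have hp0 : 0 < p := by linarith
  obtain ⟨A, B, hA, hB, hAB⟩ := exists_norm_rpow_le_re hp hp2
  refine ⟨A, hA, fun φ hφ hc h0 y hy => ?_⟩
  rcases eq_or_ne φ 0 with rfl | hne
  · simp [hp0]
  set u : ℝ → ℝ := fun x => ∫ s, poisson y s * φ (x - s)
  set v : ℝ → ℝ := fun x => ∫ s, conjPoisson y s * φ (x - s)
  set F : ℝ → ℂ := fun x => cauchyInt φ (x + y * Complex.I)
  have hF : ∀ x, F x = u x + v x * Complex.I := fun x => cauchyInt_eq hφ hc hy x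
  have him : ∀ x : ℝ, 0 < (x + y * Complex.I : ℂ).im := fun x => by simp [hy]
  have hre : ∀ x, (F x).re = u x := fun x => by rw [hF]; simp
  have hu : ∀ x, 0 < u x := fun x => by
    rw [← hre]; exact re_cauchyInt_pos hφ hc h0 hne (him x)
  have hv : ∀ x, |v x| ≤ ‖F x‖ := fun x => by
    have := Complex.abs_im_le_norm (F x)
    have e : (F x).im = v x := by rw [hF]; simp
    rwa [e] at this
  obtain ⟨hi, hz⟩ := integral_cauchyInt_cpow hφ hc h0 hne hp hy
  have hFc : Continuous F := by
    refine continuous_iff_continuousAt.2 fun x => ?_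
    exact ContinuousAt.comp (f := fun x : ℝ => (x + y * Complex.I : ℂ))
      (differentiableAt_cauchyInt hφ hc (him x)).continuousAt (by fun_prop)
  have hin : Integrable fun x => ‖F x‖ ^ p := by
    refine hi.norm.congr (Eventually.of_forall fun x => ?_)
    exact Complex.norm_cpow_real _ _
  have hiu : Integrable fun x => u x ^ p := by
    refine hin.mono' ?_ (Eventually.of_forall fun x => ?_)
    · have : Continuous u := by
        have := Complex.continuous_re.comp hFc
        exact this.congr hre
      exact (this.rpow_const fun x => Or.inl (hu x).ne').aestronglyMeasurable
    · rw [Real.norm_of_nonneg (Real.rpow_nonneg (hu x).le _), ← hre]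
      exact Real.rpow_le_rpow ((hre x).symm ▸ (hu x).le) (Complex.re_le_norm _) hp0.le
  -- The elementary inequality is integrated along the line: the term in `F ^ p` drops out and only
  -- the `p`-th power of the Poisson integral `u` remains. Young's inequality with a kernel of mass
  -- `1` then bounds `u` by `φ`.
  have hint : ∫ x, ‖F x‖ ^ p ≤ A * ∫ x, u x ^ p := by
    have hi' : Integrable fun x => (F x ^ (p : ℂ)).re := hi.re
    have hz' : ∫ x, (F x ^ (p : ℂ)).re = 0 := by
      have := integral_re hi
      rw [hz] at this
      simpa using this
    calc ∫ x, ‖F x‖ ^ p ≤ ∫ x, (A * u x ^ p - B * (F x ^ (p : ℂ)).re) := by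
          refine integral_mono hin ((hiu.const_mul A).sub (hi'.const_mul B)) fun x => ?_
          have := hAB (F x) (by rw [hre]; exact hu x)
          rwa [hre] at this
      _ = A * ∫ x, u x ^ p := by
          rw [integral_sub (hiu.const_mul A) (hi'.const_mul B), integral_const_mul,
            integral_const_mul, hz', mul_zero, sub_zero]
  calc ∫⁻ x, ‖v x‖ₑ ^ p ≤ ∫⁻ x, ENNReal.ofReal (‖F x‖ ^ p) := by
        refine lintegral_mono fun x => ?_
        dsimp only
        rw [← ENNReal.ofReal_rpow_of_nonneg (norm_nonneg _) hp0.le]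
        gcongr
        rw [Real.enorm_eq_ofReal_abs]
        exact ENNReal.ofReal_le_ofReal (hv x)
    _ = ENNReal.ofReal (∫ x, ‖F x‖ ^ p) :=
        (ofReal_integral_eq_lintegral_ofReal hin (Eventually.of_forall fun x => by positivity)).symm
    _ ≤ ENNReal.ofReal (A * ∫ x, u x ^ p) := ENNReal.ofReal_le_ofReal hint
    _ = ENNReal.ofReal A * ∫⁻ x, ENNReal.ofReal (u x ^ p) := by
        rw [ENNReal.ofReal_mul hA, ofReal_integral_eq_lintegral_ofReal hiu
          (Eventually.of_forall fun x => Real.rpow_nonneg (hu x).le _)]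
    _ ≤ ENNReal.ofReal A * ∫⁻ x, (∫⁻ s, ‖poisson y s‖ₑ * ‖φ (x - s)‖ₑ) ^ p := by
        gcongr with x
        rw [← ENNReal.ofReal_rpow_of_nonneg (hu x).le hp0.le]
        gcongr
        rw [← Real.enorm_eq_ofReal (hu x).le]
        refine (enorm_integral_le_lintegral_enorm _).trans_eq ?_
        simp only [enorm_mul]
    _ ≤ ENNReal.ofReal A * ((∫⁻ s, ‖poisson y s‖ₑ) ^ p * ∫⁻ x, ‖φ x‖ₑ ^ p) := by
        gcongr
        exact lintegral_rpow_conv_le hp.le (continuous_poisson hy).measurable.enorm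
          hφ.measurable.enorm
    _ = _ := by rw [lintegral_poisson hy]; simp

/-- M. Riesz's theorem: `φ ↦ Q_y * φ` is bounded on `L^p(ℝ)`, `1 < p ≤ 2`, uniformly in `y`. -/
theorem exists_conjPoisson_bound {p : ℝ} (hp : 1 < p) (hp2 : p ≤ 2) :
    ∃ A : ℝ≥0∞, A ≠ ⊤ ∧ ∀ φ : ℝ → ℝ, Continuous φ → HasCompactSupport φ →
      ∀ y : ℝ, 0 < y → ∫⁻ x, ‖∫ s, conjPoisson y s * φ (x - s)‖ₑ ^ p ≤
        A * ∫⁻ x, ‖φ x‖ₑ ^ p := by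
  have hp0 : 0 < p := by linarith
  obtain ⟨A, -, h⟩ := exists_conjPoisson_bound_of_nonneg hp hp2
  refine ⟨2 ^ (p - 1) * (ENNReal.ofReal A + ENNReal.ofReal A), by finiteness,
    fun φ hφ hc y hy => ?_⟩
  have hcs : ∀ ψ : ℝ → ℝ, Continuous ψ → HasCompactSupport ψ → ∀ x,
      Integrable fun s => conjPoisson y s * ψ (x - s) := by
    intro ψ hψ hψc x
    refine ((continuous_conjPoisson hy).mul (hψ.comp (by fun_prop))).integrable_of_hasCompactSupport
      (hψc.comp_homeomorph (Homeomorph.subLeft x)).mul_left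
  -- Positive and negative parts preserve continuity but not smoothness, which is why the
  -- non-negative case is stated for continuous functions.
  set φ₁ : ℝ → ℝ := fun t => max (φ t) 0
  set φ₂ : ℝ → ℝ := fun t => max (-φ t) 0
  have hφ₁ : Continuous φ₁ := hφ.max continuous_const
  have hφ₂ : Continuous φ₂ := hφ.neg.max continuous_const
  have hc₁ : HasCompactSupport φ₁ := hc.comp_left (g := fun t : ℝ => max t 0) (by simp)
  have hc₂ : HasCompactSupport φ₂ := hc.comp_left (g := fun t : ℝ => max (-t) 0) (by simp)
  have hle : ∀ ψ : ℝ → ℝ, (∀ t, |ψ t| ≤ |φ t|) → ∫⁻ x, ‖ψ x‖ₑ ^ p ≤ ∫⁻ x, ‖φ x‖ₑ ^ p := by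
    intro ψ hψ
    refine lintegral_mono fun x => ENNReal.rpow_le_rpow (enorm_le_iff_norm_le.2 (hψ x)) hp0.le
  have hle₁ := hle φ₁ fun t => by
    rw [abs_of_nonneg (le_max_right _ _)]; exact max_le (le_abs_self _) (abs_nonneg _)
  have hle₂ := hle φ₂ fun t => by
    rw [abs_of_nonneg (le_max_right _ _)]; exact max_le (neg_le_abs _) (abs_nonneg _)
  have hm : ∀ ψ : ℝ → ℝ, Continuous ψ →
      Measurable fun x => ‖∫ s, conjPoisson y s * ψ (x - s)‖ₑ ^ p := by
    intro ψ hψ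
    refine (StronglyMeasurable.measurable ?_).enorm.pow_const p
    refine StronglyMeasurable.integral_prod_right (f := fun x s => conjPoisson y s * ψ (x - s)) ?_
    refine Continuous.stronglyMeasurable ?_
    exact ((continuous_conjPoisson hy).comp continuous_snd).mul
      (hψ.comp (continuous_fst.sub continuous_snd))
  have hsplit : ∀ x, ∫ s, conjPoisson y s * φ (x - s) =
      (∫ s, conjPoisson y s * φ₁ (x - s)) - ∫ s, conjPoisson y s * φ₂ (x - s) := by
    intro x
    rw [← integral_sub (hcs _ hφ₁ hc₁ x) (hcs _ hφ₂ hc₂ x)]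
    refine integral_congr_ae (Eventually.of_forall fun s => ?_)
    have : φ (x - s) = φ₁ (x - s) - φ₂ (x - s) := by
      simp only [φ₁, φ₂]
      rw [max_comm (φ (x - s)), max_comm (-φ (x - s))]
      exact (max_zero_sub_max_neg_zero_eq_self _).symm.trans (by rw [max_comm, max_comm (-_)])
    simp only [this]
    ring
  calc ∫⁻ x, ‖∫ s, conjPoisson y s * φ (x - s)‖ₑ ^ p
      ≤ ∫⁻ x, 2 ^ (p - 1) * (‖∫ s, conjPoisson y s * φ₁ (x - s)‖ₑ ^ p +
          ‖∫ s, conjPoisson y s * φ₂ (x - s)‖ₑ ^ p) := by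
        refine lintegral_mono fun x => ?_
        dsimp only
        rw [hsplit]
        exact (ENNReal.rpow_le_rpow enorm_sub_le hp0.le).trans
          (ENNReal.rpow_add_le_mul_rpow_add_rpow _ _ hp.le)
    _ = 2 ^ (p - 1) * ((∫⁻ x, ‖∫ s, conjPoisson y s * φ₁ (x - s)‖ₑ ^ p) +
          ∫⁻ x, ‖∫ s, conjPoisson y s * φ₂ (x - s)‖ₑ ^ p) := by
        rw [lintegral_const_mul _ (by exact (hm _ hφ₁).add (hm _ hφ₂)), lintegral_add_left (hm _ hφ₁)]
    _ ≤ 2 ^ (p - 1) * (ENNReal.ofReal A * (∫⁻ x, ‖φ x‖ₑ ^ p) +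
          ENNReal.ofReal A * ∫⁻ x, ‖φ x‖ₑ ^ p) := by
        gcongr
        · exact (h _ hφ₁ hc₁ (fun t => le_max_right _ _) y hy).trans (by gcongr)
        · exact (h _ hφ₂ hc₂ (fun t => le_max_right _ _) y hy).trans (by gcongr)
    _ = _ := by ring

end Hilbert

/-! ### Fourier inversion, multipliers and Fubini's theorem. -/

section FourierTools

/-- The character `a ↦ exp(2πi a)`. -/
def ex (a : ℝ) : ℂ := Complex.exp (((2 * Real.pi * a : ℝ) : ℂ) * Complex.I)

@[simp] theorem norm_ex (a : ℝ) : ‖ex a‖ = 1 := Complex.norm_exp_ofReal_mul_I _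

@[simp] theorem ex_zero : ex 0 = 1 := by simp [ex]

theorem ex_add (a b : ℝ) : ex (a + b) = ex a * ex b := by
  rw [ex, ex, ex, ← Complex.exp_add]; congr 1; push_cast; ring

@[fun_prop]
theorem continuous_ex : Continuous ex := by unfold ex; fun_prop

theorem fourierInv_eq_integral {V : Type*} [NormedAddCommGroup V] [InnerProductSpace ℝ V]
    [MeasurableSpace V] [BorelSpace V] [FiniteDimensional ℝ V] (ψ : V → ℂ) (x : V) :
    𝓕⁻ ψ x = ∫ ξ, ex (inner ℝ ξ x) * ψ ξ := by
  rw [Real.fourierInv_eq']; rfl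

theorem fourier_eq_integral {V : Type*} [NormedAddCommGroup V] [InnerProductSpace ℝ V]
    [MeasurableSpace V] [BorelSpace V] [FiniteDimensional ℝ V] (ψ : V → ℂ) (ξ : V) :
    𝓕 ψ ξ = ∫ x, ex (-inner ℝ x ξ) * ψ x := by
  rw [Real.fourier_eq']
  refine integral_congr_ae (Eventually.of_forall fun x => ?_)
  simp [ex]

variable {S : Type*} [MeasurableSpace S] {μ : Measure S}

/-- Integration of inverse Fourier transforms with respect to a parameter. -/
theorem integral_fourierInv [SFinite μ] {b : S → Plane → ℂ}
    (hb : Integrable (Function.uncurry b) (μ.prod volume)) (x : Plane) :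
    ∫ s, 𝓕⁻ (b s) x ∂μ = 𝓕⁻ (fun ξ => ∫ s, b s ξ ∂μ) x := by
  simp only [fourierInv_eq_integral]
  rw [integral_integral_swap]
  · simp only [integral_const_mul]
  · refine hb.bdd_mul (c := 1) (f := fun z : S × Plane => ex (inner ℝ z.2 x)) ?_ ?_
    · exact Continuous.comp_aestronglyMeasurable (g := fun ξ : Plane => ex (inner ℝ ξ x))
        (by fun_prop) measurable_snd.aestronglyMeasurable
    · exact Eventually.of_forall fun z => by simp

/-- Averages of translates are Fourier multipliers. -/
theorem integral_mul_fourierInv_sub [SFinite μ] {k : S → ℂ} (hk : Integrable k μ) {a : S → Plane}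
    (ha : Measurable a) {ψ : Plane → ℂ} (hψ : Integrable ψ) (x : Plane) :
    ∫ s, k s * 𝓕⁻ ψ (x - a s) ∂μ = 𝓕⁻ (fun ξ => (∫ s, k s * ex (-inner ℝ ξ (a s)) ∂μ) * ψ ξ) x := by
  have h1 : ∀ s, k s * 𝓕⁻ ψ (x - a s) = 𝓕⁻ (fun ξ => k s * ex (-inner ℝ ξ (a s)) * ψ ξ) x := by
    intro s
    simp only [fourierInv_eq_integral]
    rw [← integral_const_mul]
    refine integral_congr_ae (Eventually.of_forall fun ξ => ?_)
    simp only
    rw [inner_sub_right, sub_eq_add_neg, ex_add]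
    ring
  simp only [h1]
  rw [integral_fourierInv]
  · simp only [integral_mul_const]
  · have h2 : Integrable (fun z : S × Plane => k z.1 * ψ z.2) (μ.prod volume) := hk.mul_prod hψ
    have h3 : Measurable fun z : S × Plane => ex (-inner ℝ z.2 (a z.1)) :=
      continuous_ex.measurable.comp (measurable_snd.inner (ha.comp measurable_fst)).neg
    refine (h2.bdd_mul (c := 1) h3.aestronglyMeasurable
      (Eventually.of_forall fun z => by simp)).congr (Eventually.of_forall fun z => ?_)
    simp only [Function.uncurry]
    ring

variable {φ : Plane → ℝ}

/-- The Fourier transform of a real test function. -/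
def testHat (φ : Plane → ℝ) : Plane → ℂ := 𝓕 fun y : Plane => (φ y : ℂ)

theorem exists_schwartz (hφ : ContDiff ℝ ∞ φ) (hc : HasCompactSupport φ) :
    ∃ f : SchwartzMap Plane ℂ, (f : Plane → ℂ) = fun y => (φ y : ℂ) := by
  have h1 : HasCompactSupport fun y => (φ y : ℂ) := hc.comp_left (g := ((↑) : ℝ → ℂ)) rfl
  have h2 : ContDiff ℝ ∞ fun y => (φ y : ℂ) := Complex.ofRealCLM.contDiff.comp hφ
  exact ⟨h1.toSchwartzMap h2, rfl⟩

theorem integrable_norm_pow_mul_testHat (hφ : ContDiff ℝ ∞ φ) (hc : HasCompactSupport φ) (k : ℕ) :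
    Integrable fun ξ => ‖ξ‖ ^ k * ‖testHat φ ξ‖ := by
  obtain ⟨f, hf⟩ := exists_schwartz hφ hc
  have := (𝓕 f).integrable_pow_mul volume k
  rwa [SchwartzMap.fourier_coe, hf] at this

theorem continuous_testHat (hφ : ContDiff ℝ ∞ φ) (hc : HasCompactSupport φ) :
    Continuous (testHat φ) := by
  obtain ⟨f, hf⟩ := exists_schwartz hφ hc
  have := (𝓕 f).continuous
  rwa [SchwartzMap.fourier_coe, hf] at this

theorem integrable_testHat (hφ : ContDiff ℝ ∞ φ) (hc : HasCompactSupport φ) :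
    Integrable (testHat φ) := by
  obtain ⟨f, hf⟩ := exists_schwartz hφ hc
  have := (𝓕 f).integrable (μ := volume)
  rwa [SchwartzMap.fourier_coe, hf] at this

theorem fourierInv_testHat (hφ : ContDiff ℝ ∞ φ) (hc : HasCompactSupport φ) (x : Plane) :
    𝓕⁻ (testHat φ) x = φ x := by
  obtain ⟨f, hf⟩ := exists_schwartz hφ hc
  have h : (𝓕⁻ (𝓕 f)) x = f x := by
    rw [FourierTransform.fourierInv_fourier_eq (E := SchwartzMap Plane ℂ) (F := SchwartzMap Plane ℂ)]
  rw [SchwartzMap.fourierInv_coe, SchwartzMap.fourier_coe, hf] at h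
  exact h

theorem continuous_fourierInv {ψ : Plane → ℂ} (hψ : Integrable ψ) : Continuous (𝓕⁻ ψ) := by
  have h : 𝓕⁻ ψ = fun x => ∫ ξ, ex (inner ℝ ξ x) * ψ ξ := funext fun x => fourierInv_eq_integral ψ x
  rw [h]
  refine continuous_of_dominated (bound := fun ξ => ‖ψ ξ‖) (fun x => ?_) (fun x => ?_) hψ.norm ?_
  · exact (Continuous.aestronglyMeasurable (by fun_prop)).mul hψ.aestronglyMeasurable
  · exact Eventually.of_forall fun ξ => by simp
  · exact Eventually.of_forall fun ξ => by fun_prop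

theorem norm_fourierInv_le {ψ : Plane → ℂ} (x : Plane) : ‖𝓕⁻ ψ x‖ ≤ ∫ ξ, ‖ψ ξ‖ := by
  rw [fourierInv_eq_integral]
  refine (norm_integral_le_integral_norm _).trans_eq ?_
  simp

end FourierTools

/-! ### Truncated conjugate Poisson kernels and their Fourier transform. -/

section LineKernel

/-- The difference of two conjugate Poisson kernels, which is integrable. -/
def lineKernel (y Y s : ℝ) : ℝ := conjPoisson y s - conjPoisson Y s

/-- The Fourier transform of `lineKernel y Y`. -/
def lineSymbol (y Y a : ℝ) : ℂ :=
  -Complex.I * ((SignType.sign a : ℝ) * (Real.exp (-(2 * Real.pi * y * |a|)) -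
    Real.exp (-(2 * Real.pi * Y * |a|))) : ℝ)

theorem integrable_poisson {y : ℝ} (hy : 0 < y) : Integrable (poisson y) := by
  refine ⟨(continuous_poisson hy).aestronglyMeasurable, ?_⟩
  rw [HasFiniteIntegral, lintegral_poisson hy]
  exact ENNReal.one_lt_top

/-- A single conjugate Poisson kernel decays like `1/s` and is not integrable. In the difference the
leading tails cancel, and what remains is dominated by a multiple of `poisson y`. This makes
Fubini's theorem and Fourier transforms available. -/
theorem integrable_lineKernel {y Y : ℝ} (hy : 0 < y) (hY : 0 < Y) :
    Integrable (lineKernel y Y) := by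
  refine ((integrable_poisson hy).const_mul (|Y ^ 2 - y ^ 2| / (Y * y))).mono'
    ((continuous_conjPoisson hy).sub (continuous_conjPoisson hY)).aestronglyMeasurable
    (Eventually.of_forall fun s => ?_)
  have e : lineKernel y Y s = s * (Y ^ 2 - y ^ 2) / (Real.pi * (s ^ 2 + y ^ 2) * (s ^ 2 + Y ^ 2)) := by
    simp only [lineKernel, conjPoisson]
    have h1 : s ^ 2 + y ^ 2 ≠ 0 := by positivity
    have h2 : s ^ 2 + Y ^ 2 ≠ 0 := by positivity
    field_simp
    ring
  rw [e, Real.norm_eq_abs, abs_div, abs_mul, abs_of_pos (a := Real.pi * _ * _) (by positivity),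
    poisson]
  have h3 : |s| * Y ≤ s ^ 2 + Y ^ 2 := by
    rw [← sq_abs s]; nlinarith [sq_nonneg (|s| - Y), abs_nonneg s]
  rw [div_mul_div_comm, div_le_div_iff₀ (by positivity) (by positivity)]
  have h4 : 0 ≤ |Y ^ 2 - y ^ 2| := abs_nonneg _
  have h5 : 0 ≤ |Y ^ 2 - y ^ 2| * y * (Real.pi * (s ^ 2 + y ^ 2)) := by positivity
  nlinarith [mul_le_mul_of_nonneg_left h3 h5]

/-- The jump of the sign at `0` is multiplied by a difference of exponentials which vanishes there.
Continuity is used for pointwise Fourier inversion. -/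
theorem continuous_lineSymbol (y Y : ℝ) : Continuous (lineSymbol y Y) := by
  unfold lineSymbol
  refine continuous_const.mul (Complex.continuous_ofReal.comp ?_)
  refine continuous_iff_continuousAt.2 fun a => ?_
  rcases eq_or_ne a 0 with rfl | ha
  · rw [ContinuousAt]
    simp only [sign_zero, SignType.coe_zero, zero_mul]
    have h1 : Tendsto (fun a : ℝ => Real.exp (-(2 * Real.pi * y * |a|)) -
        Real.exp (-(2 * Real.pi * Y * |a|))) (𝓝 0) (𝓝 0) := by
      have : Continuous (fun a : ℝ => Real.exp (-(2 * Real.pi * y * |a|)) -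
        Real.exp (-(2 * Real.pi * Y * |a|))) := by fun_prop
      have := this.tendsto 0
      simpa using this
    refine squeeze_zero_norm (fun a => ?_) (tendsto_zero_iff_norm_tendsto_zero.1 h1)
    rw [norm_mul]
    refine mul_le_of_le_one_left (norm_nonneg _) ?_
    rcases lt_trichotomy a 0 with h | h | h <;> simp [h]
  · refine ContinuousAt.mul ?_ (by fun_prop)
    rcases ha.lt_or_gt with h | h
    · refine ContinuousAt.congr (f := fun _ => (-1 : ℝ)) continuousAt_const ?_
      filter_upwards [gt_mem_nhds h] with b hb
      simp [sign_neg hb]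
    · refine ContinuousAt.congr (f := fun _ => (1 : ℝ)) continuousAt_const ?_
      filter_upwards [lt_mem_nhds h] with b hb
      simp [sign_pos hb]

theorem norm_lineSymbol_le {y Y : ℝ} (hyY : y ≤ Y) (a : ℝ) :
    ‖lineSymbol y Y a‖ ≤ Real.exp (-(2 * Real.pi * y * |a|)) := by
  have h1 : Real.exp (-(2 * Real.pi * Y * |a|)) ≤ Real.exp (-(2 * Real.pi * y * |a|)) := by
    gcongr
  have h2 := Real.exp_pos (-(2 * Real.pi * Y * |a|))
  rw [lineSymbol, norm_mul, norm_neg, Complex.norm_I, one_mul, Complex.norm_real, norm_mul,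
    Real.norm_of_nonneg (sub_nonneg.2 h1)]
  calc _ ≤ 1 * (Real.exp (-(2 * Real.pi * y * |a|)) - Real.exp (-(2 * Real.pi * Y * |a|))) := by
        refine mul_le_mul_of_nonneg_right ?_ (sub_nonneg.2 h1)
        rcases lt_trichotomy a 0 with h | h | h <;> simp [h]
    _ ≤ _ := by linarith

/-- On each half line the integrand is a single complex exponential. Subtracting the two halves
inserts the factor `sign a`. -/
theorem integral_half_lines {y : ℝ} (hy : 0 < y) (s : ℝ) :
    IntegrableOn (fun a : ℝ => ex (a * s) * Real.exp (-(2 * Real.pi * y * |a|))) (Ioi 0) ∧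
    IntegrableOn (fun a : ℝ => ex (a * s) * Real.exp (-(2 * Real.pi * y * |a|))) (Iic 0) ∧
    (∫ a in Ioi (0 : ℝ), ex (a * s) * Real.exp (-(2 * Real.pi * y * |a|))) -
    (∫ a in Iic (0 : ℝ), ex (a * s) * Real.exp (-(2 * Real.pi * y * |a|))) =
      Complex.I * conjPoisson y s := by
  have hpi := Real.pi_pos
  set c₁ : ℂ := 2 * Real.pi * (-y + s * Complex.I)
  set c₂ : ℂ := 2 * Real.pi * (y + s * Complex.I)
  have hc₁ : c₁.re < 0 := by simp [c₁]; positivity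
  have hc₂ : 0 < c₂.re := by simp [c₂]; positivity
  have e₁ : EqOn (fun a : ℝ => ex (a * s) * Real.exp (-(2 * Real.pi * y * |a|)))
      (fun a : ℝ => Complex.exp (c₁ * a)) (Ioi 0) := by
    intro a ha
    simp only [ex]
    rw [abs_of_pos ha, Complex.ofReal_exp, ← Complex.exp_add]
    congr 1
    simp only [c₁]; push_cast; ring
  have e₂ : EqOn (fun a : ℝ => ex (a * s) * Real.exp (-(2 * Real.pi * y * |a|)))
      (fun a : ℝ => Complex.exp (c₂ * a)) (Iic 0) := by
    intro a ha
    simp only [ex]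
    rw [abs_of_nonpos ha, Complex.ofReal_exp, ← Complex.exp_add]
    congr 1
    simp only [c₂]; push_cast; ring
  refine ⟨(integrableOn_exp_mul_complex_Ioi hc₁ 0).congr_fun e₁.symm measurableSet_Ioi,
    (integrableOn_exp_mul_complex_Iic hc₂ 0).congr_fun e₂.symm measurableSet_Iic, ?_⟩
  rw [setIntegral_congr_fun measurableSet_Ioi e₁, setIntegral_congr_fun measurableSet_Iic e₂,
    integral_exp_mul_complex_Ioi hc₁, integral_exp_mul_complex_Iic hc₂]
  have h₁ : (-y + s * Complex.I : ℂ) ≠ 0 := by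
    intro h; have := congrArg Complex.re h; simp at this; exact hy.ne' this
  have h₂ : (y + s * Complex.I : ℂ) ≠ 0 := by
    intro h; have := congrArg Complex.re h; simp at this; exact hy.ne' this
  have h₃ : ((s : ℂ) ^ 2 + (y : ℂ) ^ 2) ≠ 0 := by
    have : (s ^ 2 + y ^ 2 : ℝ) ≠ 0 := by positivity
    exact_mod_cast this
  have h₄ : (Real.pi : ℂ) ≠ 0 := by exact_mod_cast Real.pi_ne_zero
  simp only [Complex.ofReal_zero, mul_zero, Complex.exp_zero, c₁, c₂, conjPoisson]
  have i₁ : (-y + s * Complex.I : ℂ)⁻¹ = (-y - s * Complex.I) / ((s : ℂ) ^ 2 + (y : ℂ) ^ 2) := by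
    rw [inv_eq_one_div, div_eq_div_iff h₁ h₃]
    linear_combination (s : ℂ) ^ 2 * Complex.I_sq
  have i₂ : (y + s * Complex.I : ℂ)⁻¹ = (y - s * Complex.I) / ((s : ℂ) ^ 2 + (y : ℂ) ^ 2) := by
    rw [inv_eq_one_div, div_eq_div_iff h₂ h₃]
    linear_combination (s : ℂ) ^ 2 * Complex.I_sq
  rw [div_eq_mul_inv, div_eq_mul_inv, mul_inv, mul_inv (2 * (Real.pi : ℂ)), i₁, i₂]
  push_cast
  field_simp
  ring

theorem integrable_exp_neg_abs {y : ℝ} (hy : 0 < y) :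
    Integrable fun a : ℝ => Real.exp (-(2 * Real.pi * y * |a|)) := by
  obtain ⟨h1, h2, -⟩ := integral_half_lines hy 0
  have h3 := h2.union h1
  rw [Iic_union_Ioi, integrableOn_univ] at h3
  refine h3.norm.congr (Eventually.of_forall fun a => ?_)
  beta_reduce
  rw [norm_mul, norm_ex, one_mul, Complex.norm_real, Real.norm_of_nonneg (Real.exp_pos _).le]

theorem fourierInv_lineSymbol {y Y : ℝ} (hy : 0 < y) (hY : 0 < Y) (s : ℝ) :
    𝓕⁻ (lineSymbol y Y) s = lineKernel y Y s := by
  rw [fourierInv_eq_integral]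
  obtain ⟨h1, h2, h3⟩ := integral_half_lines hy s
  obtain ⟨H1, H2, H3⟩ := integral_half_lines hY s
  have hs : ∀ a : ℝ, inner ℝ a s = a * s := fun a => by
    simp [mul_comm]
  have e₁ : EqOn (fun a : ℝ => ex (inner ℝ a s) * lineSymbol y Y a)
      (fun a : ℝ => -Complex.I * (ex (a * s) * Real.exp (-(2 * Real.pi * y * |a|)) -
        ex (a * s) * Real.exp (-(2 * Real.pi * Y * |a|)))) (Ioi 0) := by
    intro a ha
    simp only [hs, lineSymbol, sign_pos (mem_Ioi.1 ha), SignType.coe_one]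
    push_cast; ring
  have e₂ : EqOn (fun a : ℝ => ex (inner ℝ a s) * lineSymbol y Y a)
      (fun a : ℝ => Complex.I * (ex (a * s) * Real.exp (-(2 * Real.pi * y * |a|)) -
        ex (a * s) * Real.exp (-(2 * Real.pi * Y * |a|)))) (Iic 0) := by
    intro a ha
    rcases (mem_Iic.1 ha).eq_or_lt with h | h
    · simp [h, lineSymbol]
    · simp only [hs, lineSymbol, sign_neg h, SignType.coe_neg_one]
      push_cast; ring
  have i₁ := IntegrableOn.congr_fun (Integrable.const_mul (h1.sub H1) (-Complex.I)) e₁.symm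
    measurableSet_Ioi
  have i₂ := IntegrableOn.congr_fun (Integrable.const_mul (h2.sub H2) Complex.I) e₂.symm
    measurableSet_Iic
  rw [← setIntegral_univ, ← Iic_union_Ioi (a := (0 : ℝ)), setIntegral_union (by
    rw [Set.disjoint_left]; intro a ha hb; exact absurd (mem_Iic.1 ha) (not_le.2 hb))
    measurableSet_Ioi i₂ i₁, setIntegral_congr_fun measurableSet_Ioi e₁,
    setIntegral_congr_fun measurableSet_Iic e₂, integral_const_mul, integral_const_mul,
    integral_sub h1 H1, integral_sub h2 H2, lineKernel, Complex.ofReal_sub]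
  linear_combination (-Complex.I) * h3 + Complex.I * H3 -
    (conjPoisson y s - conjPoisson Y s) * Complex.I_sq

/-- Obtained by Fourier inversion from the inverse transform of the symbol, which is an explicit
exponential integral. The transform of the rational kernel is never computed directly. -/
theorem fourier_lineKernel {y Y : ℝ} (hy : 0 < y) (hyY : y ≤ Y) (a : ℝ) :
    ∫ s, (lineKernel y Y s : ℂ) * ex (-(a * s)) = lineSymbol y Y a := by
  have hY := hy.trans_le hyY
  have h1 : Integrable (lineSymbol y Y) := (integrable_exp_neg_abs hy).mono'
    (continuous_lineSymbol y Y).aestronglyMeasurable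
    (Eventually.of_forall fun a => norm_lineSymbol_le hyY a)
  have h2 : 𝓕⁻ (lineSymbol y Y) = fun s => (lineKernel y Y s : ℂ) :=
    funext fun s => fourierInv_lineSymbol hy hY s
  have h3 := (continuous_lineSymbol y Y).fourier_fourierInv_eq h1 (by
    have h4 : 𝓕 (lineSymbol y Y) = fun s => (lineKernel y Y (-s) : ℂ) := by
      ext s
      rw [← fourierInv_lineSymbol hy hY, Real.fourierInv_eq_fourier_neg, neg_neg]
    rw [h4]
    exact (integrable_lineKernel hy hY).comp_neg.ofReal)
  rw [h2] at h3
  rw [← congrFun h3 a, fourier_eq_integral]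
  refine integral_congr_ae (Eventually.of_forall fun s => ?_)
  simp only [RCLike.inner_apply, conj_trivial]
  ring

end LineKernel

/-! ### The method of rotations. -/

section Rotations

variable {φ : Plane → ℝ}

/-- The unit vector with angle `θ`. -/
def dir (θ : ℝ) : Plane := WithLp.toLp 2 ![Real.cos θ, Real.sin θ]

theorem norm_dir (θ : ℝ) : ‖dir θ‖ = 1 := by
  simp [dir, EuclideanSpace.norm_eq, Fin.sum_univ_two]

theorem continuous_dir : Continuous dir := by
  unfold dir
  refine (PiLp.continuous_toLp 2 _).comp ?_
  refine continuous_pi fun i => ?_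
  fin_cases i
  · exact Real.continuous_cos
  · exact Real.continuous_sin

theorem abs_dir_le (θ : ℝ) (j : Fin 2) : |dir θ j| ≤ 1 := by
  fin_cases j
  · exact Real.abs_cos_le_one θ
  · exact Real.abs_sin_le_one θ

theorem continuous_dir_apply (j : Fin 2) : Continuous fun θ => dir θ j := by
  fin_cases j
  · exact Real.continuous_cos
  · exact Real.continuous_sin

/-- Fubini's theorem in an orthonormal frame with a given first vector. -/
theorem exists_frame {e : Plane} (he : ‖e‖ = 1) : ∃ η : Plane, ‖η‖ = 1 ∧
    ∀ h : Plane → ℝ≥0∞, Measurable h → ∫⁻ x, h x = ∫⁻ b : ℝ, ∫⁻ a : ℝ, h (a • e + b • η) := by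
  have hon : Orthonormal ℝ (({0} : Set (Fin 2)).domRestrict fun _ : Fin 2 => e) := by
    constructor
    · intro i; exact he
    · intro i j hij; exact absurd (Subsingleton.elim i j) hij
  obtain ⟨b, hb⟩ := hon.exists_orthonormalBasis_extension_of_card_eq (by simp)
  have hb0 : b 0 = e := hb 0 rfl
  refine ⟨b 1, b.norm_eq_one 1, fun h hh => ?_⟩
  have m1 := (volume_preserving_finTwoArrow ℝ).symm
  have m2 := PiLp.volume_preserving_toLp (Fin 2)
  have m3 := b.measurePreserving_repr_symm
  have m := m3.comp (m2.comp m1)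
  rw [← m.lintegral_comp hh]
  have hrep : ∀ z : ℝ × ℝ, b.repr.symm (WithLp.toLp 2 (MeasurableEquiv.finTwoArrow.symm z)) =
      z.1 • e + z.2 • b 1 := by
    intro z
    rw [← b.sum_repr_symm, Fin.sum_univ_two, hb0]
    rfl
  have hm : Measurable fun z : ℝ × ℝ => h (z.1 • e + z.2 • b 1) :=
    hh.comp (by fun_prop)
  simp only [Function.comp_apply, hrep]
  exact lintegral_prod_symm' _ hm

theorem hasCompactSupport_line (hc : HasCompactSupport φ) {e : Plane} (he : ‖e‖ = 1) (v : Plane) :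
    HasCompactSupport fun a : ℝ => φ (a • e + v) := by
  obtain ⟨R, hR⟩ := hc.isCompact.isBounded.subset_closedBall (0 : Plane)
  refine HasCompactSupport.intro (isCompact_closedBall (0 : ℝ) (R + ‖v‖)) fun a ha => ?_
  by_contra h
  have h1 := hR (subset_tsupport _ h)
  rw [mem_closedBall_zero_iff] at h1 ha
  have h2 : ‖a • e‖ ≤ ‖a • e + v‖ + ‖v‖ := by
    have := norm_sub_le (a • e + v) v
    simpa using this
  rw [norm_smul, he, mul_one] at h2
  linarith

/-- The directional conjugate Poisson transform is bounded on `L^p(ℝ²)`, `1 < p ≤ 2`. -/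
theorem lintegral_directional_le {p : ℝ} {A : ℝ≥0∞}
    (hA : ∀ φ : ℝ → ℝ, Continuous φ → HasCompactSupport φ →
      ∀ y : ℝ, 0 < y → ∫⁻ x, ‖∫ s, conjPoisson y s * φ (x - s)‖ₑ ^ p ≤ A * ∫⁻ x, ‖φ x‖ₑ ^ p)
    (hφ : Continuous φ) (hc : HasCompactSupport φ) {e : Plane} (he : ‖e‖ = 1)
    {y : ℝ} (hy : 0 < y) :
    ∫⁻ x, ‖∫ s, conjPoisson y s * φ (x - s • e)‖ₑ ^ p ≤ A * ∫⁻ x, ‖φ x‖ₑ ^ p := by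
  -- On each line parallel to `e` the transform is the one-dimensional one, so the bound is applied
  -- line by line and integrated over the orthogonal coordinate.
  obtain ⟨η, -, hη⟩ := exists_frame he
  have hm : Measurable fun x => ‖∫ s, conjPoisson y s * φ (x - s • e)‖ₑ ^ p := by
    refine (StronglyMeasurable.measurable ?_).enorm.pow_const p
    refine StronglyMeasurable.integral_prod_right
      (f := fun x s => conjPoisson y s * φ (x - s • e)) ?_
    refine Continuous.stronglyMeasurable ?_
    exact ((continuous_conjPoisson hy).comp continuous_snd).mul (hφ.comp (by fun_prop))
  have hm2 : Measurable fun x => ‖φ x‖ₑ ^ p := hφ.measurable.enorm.pow_const p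
  rw [hη _ hm, hη _ hm2, ← lintegral_const_mul]
  · refine lintegral_mono fun b => ?_
    have := hA (fun a => φ (a • e + b • η)) (by fun_prop) (hasCompactSupport_line hc he _) y hy
    convert this using 6 with a
    simp only [sub_smul]
    ext s
    congr 2
    abel
  · exact Measurable.lintegral_prod_right' (f := fun z : ℝ × ℝ => ‖φ (z.2 • e + z.1 • η)‖ₑ ^ p)
      (hm2.comp (by fun_prop))

/-- The method of rotations: an average of directional transforms which approximates `R_j`. -/
def rieszApprox (y Y : ℝ) (j : Fin 2) (φ : Plane → ℝ) (x : Plane) : ℝ :=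
  -- The factor `1/4` cancels the `4` in `integral_dir_mul_sign`.
  ∫ z, (1 / 4 * dir z.1 j * lineKernel y Y z.2) * φ (x - z.2 • dir z.1)
    ∂((volume.restrict (Ioc 0 (2 * Real.pi))).prod volume)

theorem continuous_lineKernel {y Y : ℝ} (hy : 0 < y) (hY : 0 < Y) : Continuous (lineKernel y Y) :=
  (continuous_conjPoisson hy).sub (continuous_conjPoisson hY)

theorem integrable_rotation_kernel {y Y : ℝ} (hy : 0 < y) (hY : 0 < Y) (j : Fin 2) :
    Integrable (fun z : ℝ × ℝ => 1 / 4 * dir z.1 j * lineKernel y Y z.2)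
      ((volume.restrict (Ioc 0 (2 * Real.pi))).prod volume) := by
  refine Integrable.mul_prod (f := fun θ => 1 / 4 * dir θ j) ?_ (integrable_lineKernel hy hY)
  exact (continuous_const.mul (continuous_dir_apply j)).integrableOn_Ioc

theorem integrable_rieszApprox_integrand {y Y : ℝ} (hy : 0 < y) (hY : 0 < Y) (j : Fin 2)
    (hφ : Continuous φ) (hc : HasCompactSupport φ) (x : Plane) :
    Integrable (fun z : ℝ × ℝ => (1 / 4 * dir z.1 j * lineKernel y Y z.2) *
      φ (x - z.2 • dir z.1)) ((volume.restrict (Ioc 0 (2 * Real.pi))).prod volume) := by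
  obtain ⟨B, hB⟩ := hφ.bounded_above_of_compact_support hc
  refine (integrable_rotation_kernel hy hY j).mul_bdd (c := B) ?_ (Eventually.of_forall fun z => hB _)
  refine Continuous.aestronglyMeasurable (hφ.comp ?_)
  exact continuous_const.sub (continuous_snd.smul (continuous_dir.comp continuous_fst))

/-- M. Riesz's bound does not depend on the height, so each directional transform is bounded
uniformly in `y` and `Y`. Minkowski's inequality averages over the angles, whose total mass is
finite. -/
theorem exists_lintegral_rieszApprox_le {p : ℝ} (hp : 1 < p) (hp2 : p ≤ 2) :
    ∃ C : ℝ≥0∞, C ≠ ⊤ ∧ ∀ (j : Fin 2) (φ : Plane → ℝ), Continuous φ → HasCompactSupport φ →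
      ∀ y Y : ℝ, 0 < y → 0 < Y →
      ∫⁻ x, ‖rieszApprox y Y j φ x‖ₑ ^ p ≤ C * ∫⁻ x, ‖φ x‖ₑ ^ p := by
  obtain ⟨A, hAt, hA⟩ := exists_conjPoisson_bound hp hp2
  have hp0 : 0 < p := by linarith
  set W := ENNReal.ofReal (2 * Real.pi)
  refine ⟨W ^ (p - 1) * (W * (2 ^ (p - 1) * (A + A))), by finiteness, fun j φ hφ hc y Y hy hY => ?_⟩
  set I := ∫⁻ x, ‖φ x‖ₑ ^ p
  set μ : Measure ℝ := volume.restrict (Ioc 0 (2 * Real.pi))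
  have hμ : μ univ = W := by simp [μ, W]
  have hcsupp : ∀ θ x, HasCompactSupport fun s : ℝ => φ (x - s • dir θ) := by
    intro θ x
    have h := hasCompactSupport_line hc (norm_dir θ) x
    have := h.comp_homeomorph (Homeomorph.neg ℝ)
    convert this using 1
    ext s
    simp [sub_eq_neg_add]
  have hi : ∀ (k : ℝ → ℝ), Continuous k → ∀ θ x,
      Integrable fun s => k s * φ (x - s • dir θ) := fun k hk θ x =>
    (hk.mul (hφ.comp (by fun_prop))).integrable_of_hasCompactSupport (hcsupp θ x).mul_left
  have hmk : ∀ (k : ℝ → ℝ), Continuous k → Measurable (Function.uncurry fun (θ : ℝ) (x : Plane) =>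
      ‖∫ s, k s * φ (x - s • dir θ)‖ₑ) := by
    intro k hk
    refine (StronglyMeasurable.measurable ?_).enorm
    refine StronglyMeasurable.integral_prod_right
      (f := fun (z : ℝ × Plane) s => k s * φ (z.2 - s • dir z.1)) ?_
    refine Continuous.stronglyMeasurable ?_
    refine (hk.comp continuous_snd).mul (hφ.comp ?_)
    exact (continuous_snd.comp continuous_fst).sub
      (continuous_snd.smul (continuous_dir.comp (continuous_fst.comp continuous_fst)))
  have hslice : ∀ θ, ∫⁻ x, ‖∫ s, lineKernel y Y s * φ (x - s • dir θ)‖ₑ ^ p ≤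
      2 ^ (p - 1) * (A + A) * I := by
    intro θ
    have hm1 : ∀ y : ℝ, 0 < y →
        Measurable fun x => ‖∫ s, conjPoisson y s * φ (x - s • dir θ)‖ₑ ^ p := fun y hy =>
      ((hmk _ (continuous_conjPoisson hy)).comp (measurable_const.prodMk measurable_id)).pow_const p
    calc ∫⁻ x, ‖∫ s, lineKernel y Y s * φ (x - s • dir θ)‖ₑ ^ p
        ≤ ∫⁻ x, 2 ^ (p - 1) * (‖∫ s, conjPoisson y s * φ (x - s • dir θ)‖ₑ ^ p +
            ‖∫ s, conjPoisson Y s * φ (x - s • dir θ)‖ₑ ^ p) := by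
          refine lintegral_mono fun x => ?_
          dsimp only
          have : ∫ s, lineKernel y Y s * φ (x - s • dir θ) =
              (∫ s, conjPoisson y s * φ (x - s • dir θ)) -
              ∫ s, conjPoisson Y s * φ (x - s • dir θ) := by
            rw [← integral_sub (hi _ (continuous_conjPoisson hy) _ _)
              (hi _ (continuous_conjPoisson hY) _ _)]
            refine integral_congr_ae (Eventually.of_forall fun s => ?_)
            simp only [lineKernel]; ring
          rw [this]
          exact (ENNReal.rpow_le_rpow enorm_sub_le hp0.le).trans
            (ENNReal.rpow_add_le_mul_rpow_add_rpow _ _ hp.le)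
      _ = 2 ^ (p - 1) * ((∫⁻ x, ‖∫ s, conjPoisson y s * φ (x - s • dir θ)‖ₑ ^ p) +
            ∫⁻ x, ‖∫ s, conjPoisson Y s * φ (x - s • dir θ)‖ₑ ^ p) := by
          rw [lintegral_const_mul _ (by exact (hm1 y hy).add (hm1 Y hY)),
            lintegral_add_left (hm1 y hy)]
      _ ≤ 2 ^ (p - 1) * (A * I + A * I) := by
          gcongr
          · exact lintegral_directional_le hA hφ hc (norm_dir θ) hy
          · exact lintegral_directional_le hA hφ hc (norm_dir θ) hY
      _ = _ := by ring
  calc ∫⁻ x, ‖rieszApprox y Y j φ x‖ₑ ^ p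
      ≤ ∫⁻ x, (∫⁻ θ, ‖∫ s, lineKernel y Y s * φ (x - s • dir θ)‖ₑ ∂μ) ^ p := by
        refine lintegral_mono fun x => ENNReal.rpow_le_rpow ?_ hp0.le
        rw [rieszApprox, integral_prod _ (integrable_rieszApprox_integrand hy hY j hφ hc x)]
        refine (enorm_integral_le_lintegral_enorm _).trans (lintegral_mono fun θ => ?_)
        dsimp only
        simp only [mul_assoc]
        rw [integral_const_mul, integral_const_mul, ← mul_assoc, enorm_mul]
        refine mul_le_of_le_one_left (zero_le) ?_
        have h1 : ‖(1 / 4 * dir θ j : ℝ)‖ ≤ 1 := by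
          rw [norm_mul, Real.norm_eq_abs (dir θ j)]
          have := abs_dir_le θ j
          norm_num
          linarith
        calc ‖(1 / 4 * dir θ j : ℝ)‖ₑ ≤ ‖(1 : ℝ)‖ₑ := enorm_le_iff_norm_le.2 (by simpa using h1)
          _ = 1 := by simp
    _ ≤ μ univ ^ (p - 1) *
          ∫⁻ θ, ∫⁻ x, ‖∫ s, lineKernel y Y s * φ (x - s • dir θ)‖ₑ ^ p ∂volume ∂μ :=
        lintegral_rpow_lintegral_le hp.le (hmk _ (continuous_lineKernel hy hY))
    _ ≤ μ univ ^ (p - 1) * ∫⁻ θ, 2 ^ (p - 1) * (A + A) * I ∂μ := by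
        gcongr with θ
        exact hslice θ
    _ = _ := by rw [lintegral_const, hμ]; ring

/-- The multiplier of `rieszApprox`. -/
def rieszApproxSymbol (y Y : ℝ) (j : Fin 2) (ξ : Plane) : ℂ :=
  ∫ θ in Ioc 0 (2 * Real.pi), ((1 / 4 * dir θ j : ℝ) : ℂ) * lineSymbol y Y (inner ℝ ξ (dir θ))

theorem rieszApprox_eq {y Y : ℝ} (hy : 0 < y) (hyY : y ≤ Y) (j : Fin 2)
    (hφ : ContDiff ℝ ∞ φ) (hc : HasCompactSupport φ) (x : Plane) :
    (rieszApprox y Y j φ x : ℂ) = 𝓕⁻ (fun ξ => rieszApproxSymbol y Y j ξ * testHat φ ξ) x := by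
  have hY := hy.trans_le hyY
  have hk : Integrable (fun z : ℝ × ℝ => ((1 / 4 * dir z.1 j * lineKernel y Y z.2 : ℝ) : ℂ))
      ((volume.restrict (Ioc 0 (2 * Real.pi))).prod volume) :=
    (integrable_rotation_kernel hy hY j).ofReal
  have ha : Measurable fun z : ℝ × ℝ => z.2 • dir z.1 :=
    (continuous_snd.smul (continuous_dir.comp continuous_fst)).measurable
  have h := integral_mul_fourierInv_sub hk ha (integrable_testHat hφ hc) x
  simp only [fourierInv_testHat hφ hc] at h
  rw [rieszApprox, ← integral_complex_ofReal]
  push_cast at h ⊢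
  refine h.trans ?_
  refine congrArg (fun F : Plane → ℂ => 𝓕⁻ F x) (funext fun ξ => ?_)
  congr 1
  have hint : Integrable (fun z : ℝ × ℝ => (1 / 4 * (dir z.1 j : ℂ) * (lineKernel y Y z.2 : ℂ)) *
      ex (-inner ℝ ξ (z.2 • dir z.1))) ((volume.restrict (Ioc 0 (2 * Real.pi))).prod volume) := by
    refine Integrable.mul_bdd (c := 1) (by simpa using hk) ?_ (Eventually.of_forall fun z => by simp)
    exact (continuous_ex.measurable.comp ((measurable_const.inner ha).neg)).aestronglyMeasurable
  rw [integral_prod _ hint, rieszApproxSymbol]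
  refine integral_congr_ae (Eventually.of_forall fun θ => ?_)
  simp only
  rw [← fourier_lineKernel hy hyY, ← integral_const_mul]
  refine integral_congr_ae (Eventually.of_forall fun s => ?_)
  simp only [inner_smul_right]
  push_cast
  rw [mul_comm s]
  ring

end Rotations

/-! ### Boundedness of the Riesz transforms on `Lᵖ`. -/

section RieszBound

variable {φ : Plane → ℝ}

/-- By periodicity the period may start at `ψ - π/2`; the sign is then `1` on the first half and
`-1` on the second, apart from endpoints. -/
theorem integral_cos_mul_sign (c ψ : ℝ) :
    ∫ θ in (0)..(2 * Real.pi), Real.cos (θ - c) * (SignType.sign (Real.cos (θ - ψ)) : ℝ) =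
      4 * Real.cos (ψ - c) := by
  have hpi := Real.pi_pos
  set g : ℝ → ℝ := fun θ => Real.cos (θ - c) * (SignType.sign (Real.cos (θ - ψ)) : ℝ)
  have hper : Function.Periodic g (2 * Real.pi) := fun θ => by
    simp only [g]
    rw [show θ + 2 * Real.pi - c = θ - c + 2 * Real.pi by ring,
      show θ + 2 * Real.pi - ψ = θ - ψ + 2 * Real.pi by ring, Real.cos_add_two_pi,
      Real.cos_add_two_pi]
  have h1 : ∫ θ in (0)..(2 * Real.pi), g θ =
      ∫ θ in (ψ - Real.pi / 2)..(ψ - Real.pi / 2 + 2 * Real.pi), g θ := by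
    have := hper.intervalIntegral_add_eq 0 (ψ - Real.pi / 2)
    rwa [zero_add] at this
  have e1 : EqOn (fun θ => Real.cos (θ - c)) g (Ioo (ψ - Real.pi / 2) (ψ + Real.pi / 2)) := by
    intro θ hθ
    have : 0 < Real.cos (θ - ψ) :=
      Real.cos_pos_of_mem_Ioo ⟨by linarith [hθ.1], by linarith [hθ.2]⟩
    simp [g, sign_pos this]
  have e2 : EqOn (fun θ => -Real.cos (θ - c)) g
      (Ioo (ψ + Real.pi / 2) (ψ - Real.pi / 2 + 2 * Real.pi)) := by
    intro θ hθ
    have : Real.cos (θ - ψ) < 0 :=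
      Real.cos_neg_of_pi_div_two_lt_of_lt (by linarith [hθ.1]) (by linarith [hθ.2])
    simp [g, sign_neg this]
  have ae_of : ∀ {f : ℝ → ℝ} {a b : ℝ}, a ≤ b → EqOn f g (Ioo a b) →
      ∀ᵐ θ, θ ∈ uIoc a b → f θ = g θ := by
    intro f a b hab he
    filter_upwards [compl_mem_ae_iff.2 (measure_singleton b)] with θ hne hθ
    rw [uIoc_of_le hab] at hθ
    exact he ⟨hθ.1, lt_of_le_of_ne hθ.2 hne⟩
  have a1 := ae_of (by linarith) e1
  have a2 := ae_of (by linarith) e2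
  have c1 : Continuous fun θ => Real.cos (θ - c) := by fun_prop
  have i1 : IntervalIntegrable g volume (ψ - Real.pi / 2) (ψ + Real.pi / 2) :=
    (c1.intervalIntegrable _ _).congr_ae ((ae_restrict_iff' measurableSet_uIoc).2 a1)
  have i2 : IntervalIntegrable g volume (ψ + Real.pi / 2) (ψ - Real.pi / 2 + 2 * Real.pi) :=
    (c1.neg.intervalIntegrable _ _).congr_ae ((ae_restrict_iff' measurableSet_uIoc).2 a2)
  rw [h1, ← intervalIntegral.integral_add_adjacent_intervals i1 i2,
    ← intervalIntegral.integral_congr_ae a1, ← intervalIntegral.integral_congr_ae a2,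
    intervalIntegral.integral_neg, intervalIntegral.integral_comp_sub_right,
    intervalIntegral.integral_comp_sub_right, integral_cos, integral_cos]
  rw [show ψ + Real.pi / 2 - c = ψ - c + Real.pi / 2 by ring,
    show ψ - Real.pi / 2 - c = ψ - c - Real.pi / 2 by ring,
    show ψ - Real.pi / 2 + 2 * Real.pi - c = ψ - c - Real.pi / 2 + 2 * Real.pi by ring,
    Real.sin_add_two_pi, Real.sin_add_pi_div_two, Real.sin_sub_pi_div_two]
  ring

/-- In polar coordinates `⟨ξ, dir θ⟩ = ‖ξ‖ cos (θ - arg ξ)`, and the two components of `dir θ` are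
`cos θ` and `cos (θ - π/2)`. This identity turns averages of directional multipliers into the Riesz
multiplier. -/
theorem integral_dir_mul_sign {ξ : Plane} (hξ : ξ ≠ 0) (j : Fin 2) :
    ∫ θ in Ioc 0 (2 * Real.pi), dir θ j * (SignType.sign (inner ℝ ξ (dir θ)) : ℝ) =
      4 * (ξ j / ‖ξ‖) := by
  have hρ : 0 < ‖ξ‖ := norm_pos_iff.2 hξ
  set z : ℂ := ⟨ξ 0, ξ 1⟩
  have hz : ‖z‖ = ‖ξ‖ := by
    rw [EuclideanSpace.norm_eq, Fin.sum_univ_two, Complex.norm_def, Complex.normSq_apply]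
    simp [z, sq]
  have h0 : ξ 0 = ‖ξ‖ * Real.cos z.arg := by rw [← hz, Complex.norm_mul_cos_arg]
  have h1 : ξ 1 = ‖ξ‖ * Real.sin z.arg := by rw [← hz, Complex.norm_mul_sin_arg]
  have hin : ∀ θ, (SignType.sign (inner ℝ ξ (dir θ)) : ℝ) = SignType.sign (Real.cos (θ - z.arg)) := by
    intro θ
    have : inner ℝ ξ (dir θ) = ‖ξ‖ * Real.cos (θ - z.arg) := by
      rw [PiLp.inner_apply, Fin.sum_univ_two]
      simp only [dir, RCLike.inner_apply, conj_trivial, Matrix.cons_val_zero, Matrix.cons_val_one]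
      rw [h0, h1, Real.cos_sub]
      ring
    rw [this, sign_mul, sign_pos hρ, one_mul]
  simp only [hin]
  rw [← intervalIntegral.integral_of_le (by positivity)]
  fin_cases j
  · have := integral_cos_mul_sign 0 z.arg
    simp only [sub_zero] at this
    change ∫ θ in (0)..(2 * Real.pi), Real.cos θ * _ = _
    rw [this]
    congr 1
    rw [eq_div_iff hρ.ne', mul_comm]
    exact h0.symm
  · have := integral_cos_mul_sign (Real.pi / 2) z.arg
    simp only [Real.cos_sub_pi_div_two] at this
    change ∫ θ in (0)..(2 * Real.pi), Real.sin θ * _ = _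
    rw [this]
    congr 1
    rw [eq_div_iff hρ.ne', mul_comm]
    exact h1.symm

/-- As `y → 0` and `Y → ∞` one exponential tends to `1` and the other to `0`, which leaves the
multiplier of the Hilbert transform. -/
theorem tendsto_lineSymbol (a : ℝ) :
    Tendsto (fun n : ℕ => lineSymbol (1 / (n + 1)) (n + 1) a) atTop
      (𝓝 (-Complex.I * ((SignType.sign a : ℝ) : ℂ))) := by
  refine Tendsto.const_mul _ ((Complex.continuous_ofReal.tendsto _).comp ?_)
  rcases eq_or_ne a 0 with rfl | ha
  · simp
  have ha' : 0 < 2 * Real.pi * |a| := by have := abs_pos.2 ha; positivity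
  have h1 : Tendsto (fun n : ℕ => Real.exp (-(2 * Real.pi * (1 / ((n : ℝ) + 1)) * |a|))) atTop
      (𝓝 1) := by
    have := ((tendsto_one_div_add_atTop_nhds_zero_nat (𝕜 := ℝ)).const_mul (-(2 * Real.pi * |a|)))
    rw [mul_zero] at this
    have h2 := (Real.continuous_exp.tendsto 0).comp this
    rw [Real.exp_zero] at h2
    refine h2.congr fun n => ?_
    simp only [Function.comp]
    congr 1; ring
  have h2 : Tendsto (fun n : ℕ => Real.exp (-(2 * Real.pi * ((n : ℝ) + 1) * |a|))) atTop
      (𝓝 0) := by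
    refine Real.tendsto_exp_atBot.comp ?_
    have h3 : Tendsto (fun n : ℕ => (2 * Real.pi * |a|) * ((n : ℝ) + 1)) atTop atTop :=
      (tendsto_natCast_atTop_atTop.atTop_add (tendsto_const_nhds (x := (1 : ℝ)))).const_mul_atTop ha'
    refine (tendsto_neg_atTop_atBot.comp h3).congr fun n => ?_
    simp only [Function.comp]
    ring
  have := (h1.sub h2).const_mul ((SignType.sign a : ℝ))
  simpa using this

theorem norm_lineSymbol_le_one (n : ℕ) (a : ℝ) : ‖lineSymbol (1 / (n + 1)) (n + 1) a‖ ≤ 1 := by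
  have hn : (0 : ℝ) < n + 1 := by positivity
  refine (norm_lineSymbol_le ?_ a).trans (Real.exp_le_one_iff.2 ?_)
  · rw [div_le_iff₀ hn]
    have : (0 : ℝ) ≤ n := by positivity
    nlinarith
  · have := Real.pi_pos
    have := abs_nonneg a
    have : 0 ≤ 2 * Real.pi * (1 / ((n : ℝ) + 1)) * |a| := by positivity
    linarith

theorem norm_rotation_integrand_le (n : ℕ) (j : Fin 2) (ξ : Plane) (θ : ℝ) :
    ‖((1 / 4 * dir θ j : ℝ) : ℂ) * lineSymbol (1 / (n + 1)) (n + 1) (inner ℝ ξ (dir θ))‖ ≤ 1 := by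
  rw [norm_mul, Complex.norm_real, norm_mul, Real.norm_eq_abs (dir θ j)]
  have h1 := abs_dir_le θ j
  have h2 := norm_lineSymbol_le_one n (inner ℝ ξ (dir θ))
  have h3 : ‖(1 / 4 : ℝ)‖ ≤ 1 := by norm_num
  calc _ ≤ (1 * 1 : ℝ) * 1 := by gcongr
    _ = 1 := by norm_num

theorem norm_rieszApproxSymbol_le (n : ℕ) (j : Fin 2) (ξ : Plane) :
    ‖rieszApproxSymbol (1 / (n + 1)) (n + 1) j ξ‖ ≤ 2 * Real.pi := by
  have hpi := Real.pi_pos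
  have := norm_setIntegral_le_of_norm_le_const (μ := volume) (s := Ioc 0 (2 * Real.pi)) (C := 1)
    (by rw [Real.volume_Ioc]; exact ENNReal.ofReal_lt_top)
    (fun θ _ => norm_rotation_integrand_le n j ξ θ)
  refine this.trans_eq ?_
  rw [measureReal_def, Real.volume_Ioc, ENNReal.toReal_ofReal (by linarith)]
  ring

theorem continuous_inner_dir : Continuous fun z : Plane × ℝ => inner ℝ z.1 (dir z.2) :=
  continuous_fst.inner (continuous_dir.comp continuous_snd)

theorem continuous_lineSymbol_inner (y Y : ℝ) (ξ : Plane) :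
    Continuous fun θ => lineSymbol y Y (inner ℝ ξ (dir θ)) :=
  (continuous_lineSymbol y Y).comp (continuous_const.inner continuous_dir)

theorem tendsto_rieszApproxSymbol {ξ : Plane} (hξ : ξ ≠ 0) (j : Fin 2) :
    Tendsto (fun n : ℕ => rieszApproxSymbol (1 / (n + 1)) (n + 1) j ξ) atTop
      (𝓝 (-Complex.I * ((ξ j / ‖ξ‖ : ℝ) : ℂ))) := by
  have key : Tendsto (fun n : ℕ => rieszApproxSymbol (1 / (n + 1)) (n + 1) j ξ) atTop
      (𝓝 (∫ θ in Ioc 0 (2 * Real.pi), ((1 / 4 * dir θ j : ℝ) : ℂ) *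
        (-Complex.I * ((SignType.sign (inner ℝ ξ (dir θ)) : ℝ) : ℂ)))) := by
    unfold rieszApproxSymbol
    refine tendsto_integral_of_dominated_convergence (fun _ => (1 : ℝ)) (fun n => ?_) ?_
      (fun n => ?_) ?_
    · refine Continuous.aestronglyMeasurable ?_
      refine (Complex.continuous_ofReal.comp (continuous_const.mul (continuous_dir_apply j))).mul ?_
      exact continuous_lineSymbol_inner _ _ ξ
    · exact integrable_const _
    · exact Eventually.of_forall fun θ => norm_rotation_integrand_le n j ξ θ
    · exact Eventually.of_forall fun θ =>
        (tendsto_lineSymbol (inner ℝ ξ (dir θ))).const_mul ((1 / 4 * dir θ j : ℝ) : ℂ)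
  convert key using 2
  have h := integral_dir_mul_sign hξ j
  have e : ∀ θ, ((1 / 4 * dir θ j : ℝ) : ℂ) *
        (-Complex.I * ((SignType.sign (inner ℝ ξ (dir θ)) : ℝ) : ℂ)) =
      (-Complex.I / 4) * ((dir θ j * (SignType.sign (inner ℝ ξ (dir θ)) : ℝ) : ℝ) : ℂ) := by
    intro θ; push_cast; ring
  simp only [e]
  rw [integral_const_mul, integral_complex_ofReal, h]
  push_cast
  ring

/-- The multiplier of the Riesz transform. -/
def rieszSymbol (j : Fin 2) (ξ : Plane) : ℂ := -Complex.I * ((ξ j / ‖ξ‖ : ℝ) : ℂ)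

theorem measurable_rieszSymbol (j : Fin 2) : Measurable (rieszSymbol j) := by
  unfold rieszSymbol
  have h1 : Measurable fun ξ : Plane => ξ j / ‖ξ‖ :=
    (by fun_prop : Continuous fun ξ : Plane => ξ j).measurable.div measurable_norm
  exact measurable_const.mul (Complex.measurable_ofReal.comp h1)

theorem norm_rieszSymbol_le (j : Fin 2) (ξ : Plane) : ‖rieszSymbol j ξ‖ ≤ 1 := by
  rw [rieszSymbol, norm_mul, norm_neg, Complex.norm_I, one_mul, Complex.norm_real, norm_div,
    norm_norm]
  exact div_le_one_of_le₀ (PiLp.norm_apply_le ξ j) (norm_nonneg _)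

theorem integrable_rieszSymbol_mul (j : Fin 2) (hφ : ContDiff ℝ ∞ φ) (hc : HasCompactSupport φ) :
    Integrable fun ξ => rieszSymbol j ξ * testHat φ ξ :=
  (integrable_testHat hφ hc).bdd_mul (measurable_rieszSymbol j).aestronglyMeasurable
    (Eventually.of_forall fun ξ => norm_rieszSymbol_le j ξ)

theorem rieszTest_eq (j : Fin 2) (φ : Plane → ℝ) (x : Plane) :
    rieszTest j φ x = (𝓕⁻ (fun ξ => rieszSymbol j ξ * testHat φ ξ) x).re := rfl

theorem continuous_rieszTest (j : Fin 2) (hφ : ContDiff ℝ ∞ φ) (hc : HasCompactSupport φ) :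
    Continuous (rieszTest j φ) :=
  Complex.continuous_re.comp (continuous_fourierInv (integrable_rieszSymbol_mul j hφ hc))

theorem tendsto_rieszApprox (j : Fin 2) (hφ : ContDiff ℝ ∞ φ) (hc : HasCompactSupport φ)
    (x : Plane) :
    Tendsto (fun n : ℕ => rieszApprox (1 / (n + 1)) (n + 1) j φ x) atTop (𝓝 (rieszTest j φ x)) := by
  have hle : ∀ n : ℕ, (1 : ℝ) / (n + 1) ≤ n + 1 := fun n => by
    rw [div_le_iff₀ (by positivity)]
    have : (0 : ℝ) ≤ n := by positivity
    nlinarith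
  have h : Tendsto (fun n : ℕ => (rieszApprox (1 / (n + 1)) (n + 1) j φ x : ℂ)) atTop
      (𝓝 (𝓕⁻ (fun ξ => rieszSymbol j ξ * testHat φ ξ) x)) := by
    simp only [fun n : ℕ => rieszApprox_eq (y := 1 / ((n : ℝ) + 1)) (by positivity) (hle n) j hφ hc x,
      fourierInv_eq_integral]
    refine tendsto_integral_of_dominated_convergence
      (fun ξ => 2 * Real.pi * ‖testHat φ ξ‖) (fun n => ?_) ?_ (fun n => ?_) ?_
    · refine (Continuous.aestronglyMeasurable (by fun_prop)).mul
        (AEStronglyMeasurable.mul ?_ (integrable_testHat hφ hc).aestronglyMeasurable)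
      refine (StronglyMeasurable.integral_prod_right (f := fun (ξ : Plane) θ =>
        ((1 / 4 * dir θ j : ℝ) : ℂ) * lineSymbol (1 / (n + 1)) (n + 1) (inner ℝ ξ (dir θ)))
        ?_).aestronglyMeasurable
      refine Continuous.stronglyMeasurable ?_
      refine (Complex.continuous_ofReal.comp
        (continuous_const.mul ((continuous_dir_apply j).comp continuous_snd))).mul ?_
      exact (continuous_lineSymbol _ _).comp continuous_inner_dir
    · exact (integrable_testHat hφ hc).norm.const_mul _
    · refine Eventually.of_forall fun ξ => ?_
      rw [norm_mul, norm_ex, one_mul, norm_mul]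
      gcongr
      exact norm_rieszApproxSymbol_le n j ξ
    · filter_upwards [compl_mem_ae_iff.2 (measure_singleton (0 : Plane))] with ξ hξ
      exact ((tendsto_rieszApproxSymbol hξ j).mul_const _).const_mul _
  exact ((Complex.continuous_re.tendsto _).comp h).congr fun n => by simp

/-- The Riesz transforms are bounded on `L^p`, `1 < p ≤ 2`. -/
theorem exists_rieszTest_bound_of_le_two {p : ℝ} (hp : 1 < p) (hp2 : p ≤ 2) :
    ∃ C : ℝ≥0∞, C ≠ ⊤ ∧ ∀ (j : Fin 2) (φ : Plane → ℝ), ContDiff ℝ ∞ φ → HasCompactSupport φ →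
      ∫⁻ x, ‖rieszTest j φ x‖ₑ ^ p ≤ C * ∫⁻ x, ‖φ x‖ₑ ^ p := by
  obtain ⟨C, hC, h⟩ := exists_lintegral_rieszApprox_le hp hp2
  refine ⟨C, hC, fun j φ hφ hc => ?_⟩
  have hlim : ∀ x, Tendsto (fun n : ℕ => ‖rieszApprox (1 / (n + 1)) (n + 1) j φ x‖ₑ ^ p) atTop
      (𝓝 (‖rieszTest j φ x‖ₑ ^ p)) := fun x =>
    ((tendsto_rieszApprox j hφ hc x).enorm).ennrpow_const p
  have hm : ∀ n : ℕ, Measurable fun x => ‖rieszApprox (1 / (n + 1)) (n + 1) j φ x‖ₑ ^ p := by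
    intro n
    refine (StronglyMeasurable.measurable ?_).enorm.pow_const p
    refine StronglyMeasurable.integral_prod_right (f := fun (x : Plane) (z : ℝ × ℝ) =>
      (1 / 4 * dir z.1 j * lineKernel (1 / (n + 1)) (n + 1) z.2) * φ (x - z.2 • dir z.1)) ?_
    refine Continuous.stronglyMeasurable ?_
    have c1 : Continuous fun w : Plane × (ℝ × ℝ) => w.1 - w.2.2 • dir w.2.1 :=
      continuous_fst.sub ((continuous_snd.comp continuous_snd).smul
        (continuous_dir.comp (continuous_fst.comp continuous_snd)))
    refine Continuous.mul (Continuous.mul (continuous_const.mul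
      ((continuous_dir_apply j).comp (continuous_fst.comp continuous_snd))) ?_)
      (hφ.continuous.comp c1)
    exact (continuous_lineKernel (by positivity) (by positivity)).comp
      (continuous_snd.comp continuous_snd)
  -- The approximations converge pointwise with a uniform bound, which Fatou's lemma passes to the
  -- limit.
  calc ∫⁻ x, ‖rieszTest j φ x‖ₑ ^ p
      = ∫⁻ x, liminf (fun n : ℕ => ‖rieszApprox (1 / (n + 1)) (n + 1) j φ x‖ₑ ^ p) atTop :=
        lintegral_congr fun x => (hlim x).liminf_eq.symm
    _ ≤ liminf (fun n : ℕ => ∫⁻ x, ‖rieszApprox (1 / (n + 1)) (n + 1) j φ x‖ₑ ^ p) atTop :=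
        lintegral_liminf_le hm
    _ ≤ liminf (fun n : ℕ => C * ∫⁻ x, ‖φ x‖ₑ ^ p) atTop :=
        liminf_le_liminf (Eventually.of_forall fun n => h j φ hφ.continuous hc _ _
          (by positivity) (by positivity))
    _ = _ := by simp

/-- The Fourier transform is self-adjoint: `∫ (𝓕⁻ a) b = ∫ a (𝓕⁻ b)`. -/
theorem integral_fourierInv_mul {a b : Plane → ℂ} (ha : Integrable a) (hb : Integrable b) :
    ∫ x, 𝓕⁻ a x * b x = ∫ ξ, a ξ * 𝓕⁻ b ξ := by
  simp only [fourierInv_eq_integral, ← integral_mul_const, ← integral_const_mul]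
  rw [integral_integral_swap]
  · refine integral_congr_ae (Eventually.of_forall fun ξ => ?_)
    refine integral_congr_ae (Eventually.of_forall fun x => ?_)
    simp only
    rw [real_inner_comm]; ring
  · have h := hb.mul_prod ha
    have h2 : Continuous fun z : Plane × Plane => ex (inner ℝ z.2 z.1) := by fun_prop
    refine (h.bdd_mul (c := 1) h2.aestronglyMeasurable
      (Eventually.of_forall fun z => by simp)).congr (Eventually.of_forall fun z => ?_)
    simp only [Function.uncurry]
    ring

/-- On the frequency side, exchanging `φ` and `ψ` amounts to reflecting `ξ`. Adjoints of multipliers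
can then be read off from the parity of `m`; for the Riesz transforms `m` is odd. -/
theorem integral_fourierInv_mul_test {m : Plane → ℂ} (hm : Integrable fun ξ => m ξ * testHat φ ξ)
    {ψ : Plane → ℝ} (hψ : ContDiff ℝ ∞ ψ) (hψc : HasCompactSupport ψ) :
    ∫ x, (𝓕⁻ (fun ξ => m ξ * testHat φ ξ) x).re * ψ x =
      (∫ ξ, m ξ * testHat φ ξ * testHat ψ (-ξ)).re := by
  have hψi : Integrable fun x => (ψ x : ℂ) :=
    (hψ.continuous.integrable_of_hasCompactSupport hψc).ofReal
  have h := integral_fourierInv_mul hm hψi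
  have e : ∀ ξ, 𝓕⁻ (fun x => (ψ x : ℂ)) ξ = testHat ψ (-ξ) := fun ξ =>
    Real.fourierInv_eq_fourier_neg _ _
  simp only [e] at h
  rw [← h]
  have hint : Integrable fun x => 𝓕⁻ (fun ξ => m ξ * testHat φ ξ) x * (ψ x : ℂ) :=
    hψi.bdd_mul (continuous_fourierInv hm).aestronglyMeasurable
      (Eventually.of_forall fun x => norm_fourierInv_le x)
  have h2 := integral_re hint
  simp only [RCLike.re_to_complex, Complex.re_mul_ofReal] at h2
  exact h2

theorem integral_rieszTest_mul (j : Fin 2) {ψ : Plane → ℝ} (hφ : ContDiff ℝ ∞ φ)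
    (hc : HasCompactSupport φ) (hψ : ContDiff ℝ ∞ ψ) (hψc : HasCompactSupport ψ) :
    ∫ x, rieszTest j φ x * ψ x = -∫ x, φ x * rieszTest j ψ x := by
  have h1 := integral_fourierInv_mul_test (integrable_rieszSymbol_mul j hφ hc) hψ hψc
  have h2 := integral_fourierInv_mul_test (integrable_rieszSymbol_mul j hψ hψc) hφ hc
  have h3 : ∫ ξ, rieszSymbol j ξ * testHat ψ ξ * testHat φ (-ξ) =
      -∫ ξ, rieszSymbol j ξ * testHat φ ξ * testHat ψ (-ξ) := by
    rw [← integral_neg_eq_self, ← integral_neg]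
    refine integral_congr_ae (Eventually.of_forall fun ξ => ?_)
    have : rieszSymbol j (-ξ) = -rieszSymbol j ξ := by
      simp only [rieszSymbol, PiLp.neg_apply, norm_neg]
      push_cast; ring
    simp only [this, neg_neg]
    ring
  simp only [rieszTest_eq]
  rw [h1]
  simp only [mul_comm (φ _)]
  rw [h2, h3]
  simp

/-- Hölder's inequality for a product of real functions. -/
theorem enorm_integral_mul_le {X : Type*} [MeasurableSpace X] {μ : Measure X} {r r' : ℝ}
    (h : r.HolderConjugate r') {f g : X → ℝ} (hf : AEMeasurable f μ) (hg : AEMeasurable g μ) :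
    ‖∫ x, f x * g x ∂μ‖ₑ ≤ (∫⁻ x, ‖f x‖ₑ ^ r ∂μ) ^ (1 / r) * (∫⁻ x, ‖g x‖ₑ ^ r' ∂μ) ^ (1 / r') := by
  refine (enorm_integral_le_lintegral_enorm _).trans ?_
  simp only [enorm_mul]
  exact ENNReal.lintegral_mul_le_Lp_mul_Lq μ h hf.enorm hg.enorm

/-- The Riesz transforms are bounded on `L^p`, `1 < p < ∞`. -/
theorem exists_rieszTest_bound {p : ℝ} (hp : 1 < p) :
    ∃ C : ℝ≥0∞, C ≠ ⊤ ∧ ∀ (j : Fin 2) (φ : Plane → ℝ), ContDiff ℝ ∞ φ → HasCompactSupport φ →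
      ∫⁻ x, ‖rieszTest j φ x‖ₑ ^ p ≤ C * ∫⁻ x, ‖φ x‖ₑ ^ p := by
  rcases le_or_gt p 2 with hp2 | hp2
  · exact exists_rieszTest_bound_of_le_two hp hp2
  -- For `p > 2` the conjugate exponent is below `2`; skew-adjointness moves the transform to the
  -- other factor, where the case already treated applies.
  have hc := Real.HolderConjugate.conjExponent hp
  set p' := p.conjExponent
  have hp' : p' ≤ 2 := by
    have h1 := hc.inv_add_inv_eq_one
    have h2 : p⁻¹ < 2⁻¹ := inv_strictAnti₀ (by norm_num) hp2
    by_contra! h3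
    have h4 : p'⁻¹ < 2⁻¹ := inv_strictAnti₀ (by norm_num) h3
    norm_num at h2 h4
    linarith
  have hp'0 : 0 < p' := hc.symm.pos
  have hp0 : 0 < p := hc.pos
  obtain ⟨C, hC, h⟩ := exists_rieszTest_bound_of_le_two hc.symm.lt hp'
  refine ⟨(C ^ (1 / p')) ^ p, by finiteness, fun j φ hφ hφc => ?_⟩
  have key := lintegral_rpow_le_of_dual hc (N := (∫⁻ x, ‖φ x‖ₑ ^ p) ^ (1 / p) * C ^ (1 / p'))
    (continuous_rieszTest j hφ hφc).locallyIntegrable fun ψ hψ hψc => by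
      rw [integral_rieszTest_mul j hφ hφc hψ hψc, enorm_neg]
      refine (enorm_integral_mul_le hc hφ.continuous.measurable.aemeasurable
        (continuous_rieszTest j hψ hψc).measurable.aemeasurable).trans ?_
      rw [mul_assoc, ← ENNReal.mul_rpow_of_nonneg _ _ (by positivity)]
      gcongr
      exact h j ψ hψ hψc
  refine key.trans_eq ?_
  rw [ENNReal.mul_rpow_of_nonneg _ _ hp0.le, ← ENNReal.rpow_mul, one_div_mul_cancel hp0.ne',
    ENNReal.rpow_one, mul_comm]

/-- Test functions on the whole plane. -/
def mkTest (φ : Plane → ℝ) (hφ : ContDiff ℝ ∞ φ) (hc : HasCompactSupport φ) :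
    𝓓((⊤ : TopologicalSpace.Opens Plane), ℝ) := ⟨φ, hφ, hc, fun _ _ => trivial⟩

/-- A weak Riesz transform of a function in `L^r` is in `L^r`, with a norm bound. -/
theorem exists_isRiesz_bound {r : ℝ} (hr : 1 < r) :
    ∃ C : ℝ≥0∞, C ≠ ⊤ ∧ ∀ (j : Fin 2) (f g : Plane → ℝ), IsRiesz j f g → AEMeasurable f →
      ∫⁻ x, ‖g x‖ₑ ^ r ≤ C * ∫⁻ x, ‖f x‖ₑ ^ r := by
  have hc := Real.HolderConjugate.conjExponent hr
  set r' := r.conjExponent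
  have hr'0 : 0 < r' := hc.symm.pos
  have hr0 : 0 < r := hc.pos
  obtain ⟨C, hC, h⟩ := exists_rieszTest_bound hc.symm.lt
  refine ⟨(C ^ (1 / r')) ^ r, by finiteness, fun j f g hfg hf => ?_⟩
  have key := lintegral_rpow_le_of_dual hc (N := (∫⁻ x, ‖f x‖ₑ ^ r) ^ (1 / r) * C ^ (1 / r'))
    hfg.target fun ψ hψ hψc => by
      have hd := hfg.duality (mkTest ψ hψ hψc)
      change ∫ x, g x * ψ x = - ∫ x, f x * rieszTest j ψ x at hd
      rw [hd, enorm_neg]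
      refine (enorm_integral_mul_le hc hf
        (continuous_rieszTest j hψ hψc).measurable.aemeasurable).trans ?_
      rw [mul_assoc, ← ENNReal.mul_rpow_of_nonneg _ _ (by positivity)]
      gcongr
      exact h j ψ hψ hψc
  refine key.trans_eq ?_
  rw [ENNReal.mul_rpow_of_nonneg _ _ hr0.le, ← ENNReal.rpow_mul, one_div_mul_cancel hr0.ne',
    ENNReal.rpow_one, mul_comm]

end RieszBound

/-! ### Scaling and the `L¹` modulus of continuity. -/

section Calculus

/-- Scaling of integrals over the plane. -/
theorem lintegral_comp_smul_plane (f : Plane → ℝ≥0∞) {R : ℝ} (hR : 0 < R) :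
    ∫⁻ x, f (R • x) = ENNReal.ofReal (R ^ 2)⁻¹ * ∫⁻ x, f x := by
  have h := Measure.map_addHaar_smul (volume : Measure Plane) hR.ne'
  have h2 : ∫⁻ x, f x ∂(Measure.map (R • ·) (volume : Measure Plane)) = ∫⁻ x, f (R • x) :=
    lintegral_map_equiv f (Homeomorph.smulOfNeZero R hR.ne').toMeasurableEquiv
  rw [← h2, h, lintegral_smul_measure]
  simp [abs_of_pos (inv_pos.2 (pow_pos hR 2)), smul_eq_mul]

/-- The `L¹` modulus of continuity of a `C¹` function. -/
theorem lintegral_enorm_sub_translate_le {f : Plane → ℝ} (hf : ContDiff ℝ 1 f) (y : Plane) :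
    ∫⁻ x, ‖f x - f (x - y)‖ₑ ≤ ‖y‖ₑ * ∫⁻ x, ‖fderiv ℝ f x‖ₑ := by
  have hd : Continuous (fderiv ℝ f) := hf.continuous_fderiv (by norm_num)
  have hpt : ∀ x, ‖f x - f (x - y)‖ₑ ≤
      ∫⁻ s in Ioc (0 : ℝ) 1, ‖fderiv ℝ f (x - y + s • y)‖ₑ * ‖y‖ₑ := by
    intro x
    have h1 : ∀ s ∈ uIcc (0 : ℝ) 1,
        HasDerivAt (fun s : ℝ => f (x - y + s • y)) (fderiv ℝ f (x - y + s • y) y) s := by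
      intro s _
      have h2 : HasDerivAt (fun s : ℝ => x - y + s • y) y s := by
        have := ((hasDerivAt_id s).smul_const y).const_add (x - y)
        simpa using this
      exact ((hf.differentiable (by norm_num)) _).hasFDerivAt.comp_hasDerivAt s h2
    have h3 := intervalIntegral.integral_eq_sub_of_hasDerivAt h1
      (Continuous.intervalIntegrable (by fun_prop) _ _)
    simp only [one_smul, sub_add_cancel, zero_smul, add_zero] at h3
    rw [← h3, intervalIntegral.integral_of_le zero_le_one]
    refine (enorm_integral_le_lintegral_enorm _).trans (lintegral_mono fun s => ?_)
    exact ContinuousLinearMap.le_opENorm _ _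
  calc ∫⁻ x, ‖f x - f (x - y)‖ₑ
      ≤ ∫⁻ x, ∫⁻ s in Ioc (0 : ℝ) 1, ‖fderiv ℝ f (x - y + s • y)‖ₑ * ‖y‖ₑ := lintegral_mono hpt
    _ = ∫⁻ s in Ioc (0 : ℝ) 1, ∫⁻ x, ‖fderiv ℝ f (x - y + s • y)‖ₑ * ‖y‖ₑ := by
        refine lintegral_lintegral_swap ?_
        have hc : Continuous (fun z : Plane × ℝ => ‖fderiv ℝ f (z.1 - y + z.2 • y)‖ₑ) := by fun_prop
        exact (hc.measurable.mul_const _).aemeasurable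
    _ = ∫⁻ s in Ioc (0 : ℝ) 1, ‖y‖ₑ * ∫⁻ x, ‖fderiv ℝ f x‖ₑ := by
        refine lintegral_congr fun s => ?_
        rw [lintegral_mul_const _ (Continuous.measurable (by fun_prop)), mul_comm]
        congr 1
        simp only [sub_add]
        exact lintegral_sub_right_eq_self (fun x => ‖fderiv ℝ f x‖ₑ) (y - s • y)
    _ = _ := by simp

end Calculus

/-! ### The heat kernel. -/

section Heat

/-- The heat kernel of the plane. -/
def heat (t : ℝ) (x : Plane) : ℝ := (4 * Real.pi * t)⁻¹ * Real.exp (-(4 * t)⁻¹ * ‖x‖ ^ 2)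

theorem heat_nonneg {t : ℝ} (ht : 0 < t) (x : Plane) : 0 ≤ heat t x := by
  have := Real.pi_pos
  unfold heat; positivity

theorem heat_neg (t : ℝ) (x : Plane) : heat t (-x) = heat t x := by simp [heat]

theorem continuous_heat (t : ℝ) : Continuous (heat t) := by unfold heat; fun_prop

theorem measurable_heat : Measurable (Function.uncurry heat) := by
  unfold heat Function.uncurry; fun_prop

theorem integrable_heat {t : ℝ} (ht : 0 < t) : Integrable (heat t) := by
  have h := (GaussianFourier.integrable_cexp_neg_mul_sq_norm_add (V := Plane) (b := ((4 * t)⁻¹ : ℝ))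
    (by simpa using ht) 0 0).re
  refine (h.const_mul ((4 * Real.pi * t)⁻¹)).congr (Eventually.of_forall fun x => ?_)
  simp only [heat]
  congr 1
  have : (-(((4 * t)⁻¹ : ℝ) : ℂ) * (‖x‖ : ℂ) ^ 2 + 0 * (inner ℝ (0 : Plane) x : ℂ)) =
      ((-(4 * t)⁻¹ * ‖x‖ ^ 2 : ℝ) : ℂ) := by push_cast; ring
  rw [this, ← Complex.ofReal_exp]
  rfl

/-- The Fourier transform of the heat kernel. -/
theorem fourier_heat {t : ℝ} (ht : 0 < t) (ξ : Plane) :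
    ∫ y, (heat t y : ℂ) * ex (-inner ℝ ξ y) =
      (Real.exp (-((2 * Real.pi * ‖ξ‖) ^ 2 * t)) : ℝ) := by
  have h := fourier_gaussian_innerProductSpace (V := Plane) (b := ((4 * t)⁻¹ : ℝ))
    (by simpa using ht) ξ
  rw [fourier_eq_integral] at h
  have hpi : (Real.pi : ℂ) ≠ 0 := by exact_mod_cast Real.pi_ne_zero
  have ht' : (t : ℂ) ≠ 0 := by exact_mod_cast ht.ne'
  have e : ∀ y : Plane, (heat t y : ℂ) * ex (-inner ℝ ξ y) = (4 * Real.pi * t : ℂ)⁻¹ *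
      (ex (-inner ℝ y ξ) * Complex.exp (-(((4 * t)⁻¹ : ℝ) : ℂ) * (‖y‖ : ℂ) ^ 2)) := by
    intro y
    rw [heat, real_inner_comm]
    push_cast
    ring
  simp only [e]
  rw [integral_const_mul, h]
  have hd : (Module.finrank ℝ Plane : ℂ) / 2 = 1 := by simp
  rw [hd, Complex.cpow_one, Complex.ofReal_exp]
  push_cast
  have e2 : -(Real.pi : ℂ) ^ 2 * (‖ξ‖ : ℂ) ^ 2 / (4 * (t : ℂ))⁻¹ =
      -((2 * (Real.pi : ℂ) * (‖ξ‖ : ℂ)) ^ 2 * t) := by field_simp; ring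
  rw [e2]
  field_simp

theorem integral_heat {t : ℝ} (ht : 0 < t) : ∫ y, heat t y = 1 := by
  have h := fourier_heat ht 0
  simp only [inner_zero_left, neg_zero, ex_zero, mul_one, norm_zero, mul_zero] at h
  rw [integral_complex_ofReal] at h
  have h2 : ((∫ y, heat t y : ℝ) : ℂ) = ((1 : ℝ) : ℂ) := by rw [h]; simp
  exact_mod_cast h2

theorem lintegral_heat {t : ℝ} (ht : 0 < t) : ∫⁻ y, ‖heat t y‖ₑ = 1 := by
  rw [← ofReal_integral_norm_eq_lintegral_enorm (integrable_heat ht)]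
  simp only [Real.norm_of_nonneg (heat_nonneg ht _), integral_heat ht, ENNReal.ofReal_one]

theorem heat_scale {t : ℝ} (ht : 0 < t) (x : Plane) :
    heat t x = t⁻¹ * heat 1 ((Real.sqrt t)⁻¹ • x) := by
  have h : ‖(Real.sqrt t)⁻¹ • x‖ ^ 2 = t⁻¹ * ‖x‖ ^ 2 := by
    rw [norm_smul, mul_pow, norm_inv, inv_pow, Real.norm_of_nonneg (Real.sqrt_nonneg _),
      Real.sq_sqrt ht.le]
  simp only [heat, h]
  rw [← mul_assoc]
  congr 1
  · field_simp
  · congr 1; field_simp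

theorem contDiff_heat (t : ℝ) : ContDiff ℝ ∞ (heat t) := by
  unfold heat
  exact contDiff_const.mul (Real.contDiff_exp.comp (contDiff_const.mul (contDiff_norm_sq ℝ)))

/-- Half of the Gaussian exponent is spent on the factor `‖x‖`. The rest is an integrable majorant
both for the gradient and for the first moment. -/
theorem norm_mul_exp_le (x : Plane) :
    ‖x‖ * Real.exp (-4⁻¹ * ‖x‖ ^ 2) ≤ 2 * Real.exp (-8⁻¹ * ‖x‖ ^ 2) := by
  have h1 : ‖x‖ ≤ 2 * Real.exp (8⁻¹ * ‖x‖ ^ 2) := by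
    have := Real.add_one_le_exp (8⁻¹ * ‖x‖ ^ 2)
    nlinarith [sq_nonneg (‖x‖ - 4), norm_nonneg x]
  calc ‖x‖ * Real.exp (-4⁻¹ * ‖x‖ ^ 2) ≤ 2 * Real.exp (8⁻¹ * ‖x‖ ^ 2) *
        Real.exp (-4⁻¹ * ‖x‖ ^ 2) := by gcongr
    _ = _ := by rw [mul_assoc, ← Real.exp_add]; congr 2; ring

theorem norm_fderiv_heat_one_le (x : Plane) :
    ‖fderiv ℝ (heat 1) x‖ ≤ Real.exp (-8⁻¹ * ‖x‖ ^ 2) := by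
  have h1 : HasFDerivAt (fun x : Plane => ‖x‖ ^ 2) (2 • innerSL ℝ x) x :=
    (hasStrictFDerivAt_norm_sq x).hasFDerivAt
  have h2 := ((h1.const_mul (-(4 * 1)⁻¹)).exp).const_mul (4 * Real.pi * 1)⁻¹
  have h3 : HasFDerivAt (heat 1) _ x := h2
  have hpi := Real.pi_gt_three
  rw [h3.fderiv, norm_smul, norm_smul, norm_smul, ← Nat.cast_smul_eq_nsmul ℝ 2, norm_smul,
    innerSL_apply_norm]
  rw [Real.norm_of_nonneg (Real.exp_pos _).le]
  have h4 := norm_mul_exp_le x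
  have h5 : ‖(4 * Real.pi * 1)⁻¹‖ ≤ 1 := by
    rw [norm_inv, Real.norm_of_nonneg (by positivity)]
    exact inv_le_one_of_one_le₀ (by linarith)
  have h6 : ‖(-(4 * 1)⁻¹ : ℝ)‖ = 4⁻¹ := by norm_num
  have h7 : ‖((2 : ℕ) : ℝ)‖ = 2 := by norm_num
  rw [h6, h7]
  calc ‖(4 * Real.pi * 1)⁻¹‖ * (Real.exp (-(4 * 1)⁻¹ * ‖x‖ ^ 2) * (4⁻¹ * (2 * ‖x‖)))
      ≤ 1 * (Real.exp (-(4 * 1)⁻¹ * ‖x‖ ^ 2) * (4⁻¹ * (2 * ‖x‖))) := by gcongr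
    _ = 2⁻¹ * (‖x‖ * Real.exp (-4⁻¹ * ‖x‖ ^ 2)) := by rw [mul_one]; ring
    _ ≤ 2⁻¹ * (2 * Real.exp (-8⁻¹ * ‖x‖ ^ 2)) := by gcongr
    _ = _ := by ring

theorem integrable_exp_neg_eighth : Integrable fun x : Plane => Real.exp (-8⁻¹ * ‖x‖ ^ 2) := by
  have h := (integrable_heat (t := 2) (by norm_num)).const_mul (4 * Real.pi * 2)
  refine h.congr (Eventually.of_forall fun x => ?_)
  simp only [heat]
  have := Real.pi_pos
  rw [← mul_assoc, mul_inv_cancel₀ (by positivity), one_mul]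
  norm_num

/-- The `L¹` norm of the gradient of the heat kernel at time `1`. -/
def heatGrad : ℝ≥0∞ := ∫⁻ x, ‖fderiv ℝ (heat 1) x‖ₑ

theorem heatGrad_ne_top : heatGrad ≠ ⊤ := by
  refine ne_top_of_le_ne_top integrable_exp_neg_eighth.lintegral_lt_top.ne (lintegral_mono fun x => ?_)
  rw [← ofReal_norm]
  exact ENNReal.ofReal_le_ofReal (norm_fderiv_heat_one_le x)

/-- Rescaling to time `1` produces the gain `‖y‖ / √t`, which will become decay at times large
compared with the inverse square of the frequency. -/
theorem lintegral_heat_sub_translate_le {t : ℝ} (ht : 0 < t) (y : Plane) :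
    ∫⁻ x, ‖heat t x - heat t (x - y)‖ₑ ≤
      ENNReal.ofReal (Real.sqrt t)⁻¹ * (‖y‖ₑ * heatGrad) := by
  have hs : 0 < (Real.sqrt t)⁻¹ := inv_pos.2 (Real.sqrt_pos.2 ht)
  have h := lintegral_comp_smul_plane
    (fun x => ‖heat 1 x - heat 1 (x - (Real.sqrt t)⁻¹ • y)‖ₑ) hs
  have e : ∀ x, ‖heat t x - heat t (x - y)‖ₑ = ENNReal.ofReal t⁻¹ *
      ‖heat 1 ((Real.sqrt t)⁻¹ • x) - heat 1 ((Real.sqrt t)⁻¹ • x - (Real.sqrt t)⁻¹ • y)‖ₑ := by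
    intro x
    rw [heat_scale ht x, heat_scale ht (x - y), smul_sub, ← mul_sub, enorm_mul,
      Real.enorm_eq_ofReal (inv_pos.2 ht).le]
  simp only [e]
  have hm : Measurable fun x : Plane => ‖heat 1 ((Real.sqrt t)⁻¹ • x) -
      heat 1 ((Real.sqrt t)⁻¹ • x - (Real.sqrt t)⁻¹ • y)‖ₑ := by
    have := continuous_heat 1
    exact Continuous.measurable (by fun_prop)
  rw [lintegral_const_mul _ hm, h, ← mul_assoc, inv_pow, Real.sq_sqrt ht.le, inv_inv,
    ← ENNReal.ofReal_mul (inv_pos.2 ht).le, inv_mul_cancel₀ ht.ne', ENNReal.ofReal_one, one_mul]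
  refine (lintegral_enorm_sub_translate_le ((contDiff_heat 1).of_le (by simp)) _).trans_eq ?_
  rw [enorm_smul, Real.enorm_eq_ofReal hs.le, mul_assoc]
  rfl

theorem abs_heat_sub_translate_le {t : ℝ} (ht : 0 < t) (x y : Plane) :
    |heat t x - heat t (x - y)| ≤ t⁻¹ * ((Real.sqrt t)⁻¹ * ‖y‖) := by
  have hs : 0 < (Real.sqrt t)⁻¹ := inv_pos.2 (Real.sqrt_pos.2 ht)
  have h := Convex.norm_image_sub_le_of_norm_fderiv_le (f := heat 1) (𝕜 := ℝ) (C := 1) (s := univ)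
    (x := (Real.sqrt t)⁻¹ • (x - y)) (y := (Real.sqrt t)⁻¹ • x)
    (fun z _ => ((contDiff_heat 1).differentiable (by simp)) z)
    (fun z _ => (norm_fderiv_heat_one_le z).trans (Real.exp_le_one_iff.2 (by
      have := sq_nonneg ‖z‖; nlinarith))) convex_univ (mem_univ _) (mem_univ _)
  rw [heat_scale ht x, heat_scale ht (x - y), ← mul_sub, abs_mul, abs_of_pos (inv_pos.2 ht)]
  gcongr
  refine h.trans_eq ?_
  rw [one_mul, ← smul_sub, sub_sub_cancel, norm_smul, Real.norm_of_nonneg hs.le]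

theorem abs_heat_le {t : ℝ} (ht : 0 < t) (x : Plane) : |heat t x| ≤ t⁻¹ := by
  rw [abs_of_nonneg (heat_nonneg ht x), heat]
  have hpi := Real.pi_gt_three
  calc (4 * Real.pi * t)⁻¹ * Real.exp (-(4 * t)⁻¹ * ‖x‖ ^ 2) ≤ t⁻¹ * 1 := by
        gcongr
        · nlinarith
        · refine Real.exp_le_one_iff.2 ?_
          have : 0 ≤ (4 * t)⁻¹ * ‖x‖ ^ 2 := by positivity
          linarith
    _ = _ := mul_one _

/-- The first moment of the heat kernel at time `1`. -/
def heatMoment : ℝ≥0∞ := ∫⁻ x, ‖heat 1 x‖ₑ * ‖x‖ₑ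

theorem heatMoment_ne_top : heatMoment ≠ ⊤ := by
  refine ne_top_of_le_ne_top
    (integrable_exp_neg_eighth.const_mul 2).lintegral_lt_top.ne (lintegral_mono fun x => ?_)
  dsimp only
  rw [← enorm_norm x, ← enorm_mul, ← ofReal_norm, norm_mul, norm_norm]
  refine ENNReal.ofReal_le_ofReal ((le_trans ?_ (norm_mul_exp_le x)))
  rw [Real.norm_of_nonneg (heat_nonneg one_pos x), mul_comm]
  gcongr
  have hpi := Real.pi_gt_three
  rw [heat, mul_one, mul_one]
  refine mul_le_of_le_one_left (Real.exp_pos _).le (inv_le_one_of_one_le₀ (by linarith))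

theorem lintegral_heat_mul_norm {t : ℝ} (ht : 0 < t) :
    ∫⁻ x, ‖heat t x‖ₑ * ‖x‖ₑ = ENNReal.ofReal (Real.sqrt t) * heatMoment := by
  have hs0 := Real.sqrt_pos.2 ht
  have hs : 0 < (Real.sqrt t)⁻¹ := inv_pos.2 hs0
  have h := lintegral_comp_smul_plane (fun x => ‖heat 1 x‖ₑ * ‖x‖ₑ) hs
  have e : ∀ x : Plane, ‖heat t x‖ₑ * ‖x‖ₑ = ENNReal.ofReal (t⁻¹ * Real.sqrt t) *
      (‖heat 1 ((Real.sqrt t)⁻¹ • x)‖ₑ * ‖(Real.sqrt t)⁻¹ • x‖ₑ) := by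
    intro x
    have h1 : ‖x‖ₑ = ENNReal.ofReal (Real.sqrt t) * ‖(Real.sqrt t)⁻¹ • x‖ₑ := by
      rw [enorm_smul, Real.enorm_eq_ofReal hs.le, ← mul_assoc, ← ENNReal.ofReal_mul hs0.le,
        mul_inv_cancel₀ hs0.ne', ENNReal.ofReal_one, one_mul]
    rw [heat_scale ht x, enorm_mul, Real.enorm_eq_ofReal (inv_pos.2 ht).le,
      ENNReal.ofReal_mul (inv_pos.2 ht).le]
    conv_lhs => rw [h1]
    ring
  have hm : Measurable fun x : Plane =>
      ‖heat 1 ((Real.sqrt t)⁻¹ • x)‖ₑ * ‖(Real.sqrt t)⁻¹ • x‖ₑ := by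
    have := continuous_heat 1
    have h1 : Measurable fun x : Plane => ‖heat 1 ((Real.sqrt t)⁻¹ • x)‖ₑ :=
      Continuous.measurable (by fun_prop)
    have h2 : Measurable fun x : Plane => ‖(Real.sqrt t)⁻¹ • x‖ₑ :=
      Continuous.measurable (by fun_prop)
    exact h1.mul h2
  simp only [e]
  rw [lintegral_const_mul _ hm, h, ← mul_assoc, inv_pow, Real.sq_sqrt ht.le, inv_inv,
    ← ENNReal.ofReal_mul (by positivity)]
  congr 2
  field_simp

end Heat

/-! ### The kernel of the low-frequency projection. -/

section LowKernel

variable (χ : Cutoff) (J : ℝ)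

/-- The symbol of `Δ_{≤ J}`. -/
def lowSymbol (ξ : Plane) : ℝ := χ.toFun (((2 : ℝ) ^ (-(J + 1)) * (2 * Real.pi)) • ξ)

/-- The frequency scale `2 ^ (J + 1)`. -/
def freq : ℝ := (2 : ℝ) ^ (J + 1)

theorem freq_pos : 0 < freq J := Real.rpow_pos_of_pos two_pos _

theorem freq_inv : (2 : ℝ) ^ (-(J + 1)) = (freq J)⁻¹ := Real.rpow_neg two_pos.le _

theorem exists_schwartz_lowSymbol :
    ∃ f : SchwartzMap Plane ℂ, (f : Plane → ℂ) = fun ξ => (lowSymbol χ J ξ : ℂ) := by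
  have hc : HasCompactSupport χ.toFun :=
    (isCompact_closedBall (0 : Plane) 1).of_isClosed_subset (isClosed_tsupport _)
      (χ.support_subset.trans Metric.ball_subset_closedBall)
  refine exists_schwartz (χ.smooth.comp (contDiff_const_smul _)) ?_
  refine hc.comp_homeomorph (Homeomorph.smulOfNeZero (α := Plane)
    ((2 : ℝ) ^ (-(J + 1)) * (2 * Real.pi)) ?_)
  have := Real.pi_pos
  positivity

theorem lowSymbol_neg (ξ : Plane) : lowSymbol χ J (-ξ) = lowSymbol χ J ξ :=
  χ.radial _ _ (by simp [norm_smul])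

theorem lowSymbol_zero : lowSymbol χ J 0 = 1 := χ.eq_one _ (by simp)

theorem integrable_lowSymbol : Integrable fun ξ => (lowSymbol χ J ξ : ℂ) := by
  obtain ⟨f, hf⟩ := exists_schwartz_lowSymbol χ J
  rw [← hf]; exact f.integrable

/-- The symbol is real and even because the cut-off is radial, so its inverse transform is real and
taking the real part in the definition loses nothing. -/
theorem ofReal_lowKernel (x : Plane) :
    (lowKernel χ J x : ℂ) = 𝓕⁻ (fun ξ => (lowSymbol χ J ξ : ℂ)) x := by
  refine Complex.conj_eq_iff_re.1 ?_
  rw [fourierInv_eq_integral, ← integral_conj, ← integral_neg_eq_self]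
  refine integral_congr_ae (Eventually.of_forall fun ξ => ?_)
  simp only [map_mul, Complex.conj_ofReal, inner_neg_left]
  refine congrArg₂ _ ?_ (congrArg _ (lowSymbol_neg χ J ξ))
  simp only [ex, ← Complex.exp_conj, map_mul, Complex.conj_ofReal, Complex.conj_I]
  congr 1
  push_cast
  ring

theorem exists_schwartz_lowKernel :
    ∃ f : SchwartzMap Plane ℂ, (f : Plane → ℂ) = fun x => (lowKernel χ J x : ℂ) := by
  obtain ⟨f, hf⟩ := exists_schwartz_lowSymbol χ J
  refine ⟨𝓕⁻ f, funext fun x => ?_⟩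
  rw [ofReal_lowKernel, SchwartzMap.fourierInv_coe, hf]

theorem continuous_lowKernel : Continuous (lowKernel χ J) := by
  obtain ⟨f, hf⟩ := exists_schwartz_lowKernel χ J
  have h : Continuous fun x => (lowKernel χ J x : ℂ) := by rw [← hf]; exact f.continuous
  have h2 : lowKernel χ J = fun x => ((lowKernel χ J x : ℂ)).re := rfl
  rw [h2]
  exact Complex.continuous_re.comp h

theorem integrable_lowKernel : Integrable (lowKernel χ J) := by
  obtain ⟨f, hf⟩ := exists_schwartz_lowKernel χ J
  have h : Integrable fun x => (lowKernel χ J x : ℂ) := by rw [← hf]; exact f.integrable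
  have h2 : lowKernel χ J = fun x => ((lowKernel χ J x : ℂ)).re := rfl
  rw [h2]
  exact h.re

theorem lowKernel_neg (x : Plane) : lowKernel χ J (-x) = lowKernel χ J x := by
  have h : (lowKernel χ J (-x) : ℂ) = lowKernel χ J x := by
    rw [ofReal_lowKernel, ofReal_lowKernel, fourierInv_eq_integral, fourierInv_eq_integral,
      ← integral_neg_eq_self]
    simp only [lowSymbol_neg, inner_neg_neg]
  exact_mod_cast h

theorem fourier_lowKernel (ξ : Plane) :
    ∫ y, (lowKernel χ J y : ℂ) * ex (-inner ℝ ξ y) = lowSymbol χ J ξ := by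
  obtain ⟨f, hf⟩ := exists_schwartz_lowSymbol χ J
  have h : 𝓕 (𝓕⁻ f) = f := FourierTransform.fourier_fourierInv_eq f
  have h2 := congrFun (congrArg (fun g : SchwartzMap Plane ℂ => (g : Plane → ℂ)) h) ξ
  simp only [SchwartzMap.fourier_coe, SchwartzMap.fourierInv_coe, hf] at h2
  rw [← h2, fourier_eq_integral]
  refine integral_congr_ae (Eventually.of_forall fun y => ?_)
  simp only [ofReal_lowKernel, real_inner_comm, mul_comm]

theorem integral_lowKernel : ∫ y, lowKernel χ J y = 1 := by
  have h := fourier_lowKernel χ J 0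
  simp only [inner_zero_left, neg_zero, ex_zero, mul_one, lowSymbol_zero] at h
  rw [integral_complex_ofReal] at h
  exact_mod_cast h

/-- The reference index is `J = -1` because `freq (-1) = 1`. All constants in the bounds for the low
kernel are thereby independent of `J`. -/
theorem lowKernel_scale (x : Plane) :
    lowKernel χ J x = freq J ^ 2 * lowKernel χ (-1) (freq J • x) := by
  have hf := freq_pos J
  have h : (lowKernel χ J x : ℂ) = ((freq J ^ 2 * lowKernel χ (-1) (freq J • x) : ℝ) : ℂ) := by
    push_cast
    rw [ofReal_lowKernel, ofReal_lowKernel, fourierInv_eq_integral, fourierInv_eq_integral]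
    have h1 := Measure.integral_comp_smul (volume : Measure Plane)
      (fun ξ => ex (inner ℝ ξ (freq J • x)) * (lowSymbol χ (-1) ξ : ℂ)) (freq J)⁻¹
    have e : ∀ ξ : Plane, ex (inner ℝ ((freq J)⁻¹ • ξ) (freq J • x)) *
        (lowSymbol χ (-1) ((freq J)⁻¹ • ξ) : ℂ) = ex (inner ℝ ξ x) * (lowSymbol χ J ξ : ℂ) := by
      intro ξ
      rw [real_inner_smul_left, real_inner_smul_right, inv_mul_cancel_left₀ hf.ne']
      simp only [lowSymbol, freq_inv, smul_smul]
      simp [freq, mul_comm]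
    simp only [e] at h1
    rw [h1]
    simp [abs_of_pos hf]
  exact_mod_cast h

/-- The `L¹` norm of the kernel of `Δ_{≤ J}`, which does not depend on `J`. -/
def lowMass : ℝ≥0∞ := ∫⁻ x, ‖lowKernel χ (-1) x‖ₑ

/-- The first moment of the kernel of `Δ_{≤ -1}`. -/
def lowMoment : ℝ≥0∞ := ∫⁻ x, ‖lowKernel χ (-1) x‖ₑ * ‖x‖ₑ

/-- A bound for the kernel of `Δ_{≤ -1}`. -/
def lowSup : ℝ := ∫ ξ, ‖(lowSymbol χ (-1) ξ : ℂ)‖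

theorem lowMass_ne_top : lowMass χ ≠ ⊤ :=
  (integrable_lowKernel χ (-1)).hasFiniteIntegral.ne

theorem lowMoment_ne_top : lowMoment χ ≠ ⊤ := by
  obtain ⟨f, hf⟩ := exists_schwartz_lowKernel χ (-1)
  have h := (f.integrable_pow_mul (μ := volume) 1).lintegral_lt_top.ne
  refine ne_top_of_le_ne_top h (lintegral_mono fun x => ?_)
  rw [hf, pow_one, Complex.norm_real, mul_comm, ENNReal.ofReal_mul (norm_nonneg _), ofReal_norm,
    ofReal_norm]

theorem lintegral_lowKernel : ∫⁻ x, ‖lowKernel χ J x‖ₑ = lowMass χ := by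
  have hf := freq_pos J
  have hm : Measurable fun x : Plane => ‖lowKernel χ (-1) (freq J • x)‖ₑ :=
    ((continuous_lowKernel χ (-1)).comp (continuous_const_smul _)).enorm.measurable
  simp only [lowKernel_scale χ J, enorm_mul]
  rw [lintegral_const_mul _ hm,
    lintegral_comp_smul_plane (fun x => ‖lowKernel χ (-1) x‖ₑ) hf, ← mul_assoc,
    Real.enorm_eq_ofReal (by positivity), ← ENNReal.ofReal_mul (by positivity),
    mul_inv_cancel₀ (by positivity), ENNReal.ofReal_one, one_mul, lowMass]

theorem lintegral_lowKernel_mul_norm :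
    ∫⁻ x, ‖lowKernel χ J x‖ₑ * ‖x‖ₑ = ENNReal.ofReal (freq J)⁻¹ * lowMoment χ := by
  have hf := freq_pos J
  have hm : Measurable fun x : Plane => ‖lowKernel χ (-1) (freq J • x)‖ₑ * ‖freq J • x‖ₑ :=
    ((continuous_lowKernel χ (-1)).comp (continuous_const_smul _)).enorm.measurable.mul
      (continuous_const_smul _).enorm.measurable
  have e : ∀ x : Plane, ‖lowKernel χ J x‖ₑ * ‖x‖ₑ = ENNReal.ofReal (freq J) *
      (‖lowKernel χ (-1) (freq J • x)‖ₑ * ‖freq J • x‖ₑ) := by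
    intro x
    rw [lowKernel_scale, enorm_mul, enorm_smul, Real.enorm_eq_ofReal (by positivity),
      Real.enorm_eq_ofReal hf.le, pow_two, ENNReal.ofReal_mul hf.le]
    ring
  simp only [e]
  rw [lintegral_const_mul _ hm,
    lintegral_comp_smul_plane (fun x => ‖lowKernel χ (-1) x‖ₑ * ‖x‖ₑ) hf, ← mul_assoc,
    ← ENNReal.ofReal_mul hf.le, lowMoment]
  congr 2
  field_simp

theorem enorm_lowKernel_le (x : Plane) :
    ‖lowKernel χ J x‖ₑ ≤ ENNReal.ofReal (freq J ^ 2) * ENNReal.ofReal (lowSup χ) := by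
  rw [lowKernel_scale, enorm_mul, Real.enorm_eq_ofReal (by positivity)]
  gcongr
  rw [← ofReal_norm]
  refine ENNReal.ofReal_le_ofReal ?_
  rw [← Complex.norm_real, ofReal_lowKernel]
  exact norm_fourierInv_le _

end LowKernel

/-! ### Power integrals against the decay factor. -/

section ScaleMass

/-- The decay factor in the bounds for the heat kernel. -/
def decay (t : ℝ) : ℝ := min 1 (Real.sqrt t)⁻¹

theorem decay_nonneg (t : ℝ) : 0 ≤ decay t := le_min zero_le_one (by positivity)

theorem decay_pos {t : ℝ} (ht : 0 < t) : 0 < decay t := lt_min one_pos (by positivity)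

theorem measurable_decay : Measurable decay := by unfold decay; fun_prop

/-- Convergence at `0` needs `s > 0`. At infinity the factor gains only `t ^ (-1/2)`, which needs `s
< 1/2`; this is the origin of the condition `β < 1` on the order of the fractional Laplacian. -/
theorem integrableOn_rpow_mul_decay {s : ℝ} (h0 : 0 < s) (h1 : s < 1 / 2) :
    IntegrableOn (fun t => t ^ (s - 1) * decay t) (Ioi 0) := by
  rw [← Ioc_union_Ioi_eq_Ioi zero_le_one]
  have hm : ∀ S : Set ℝ, AEStronglyMeasurable (fun t => t ^ (s - 1) * decay t) (volume.restrict S) :=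
    fun S => ((measurable_id.pow_const _).mul measurable_decay).aestronglyMeasurable
  refine IntegrableOn.union ?_ ?_
  · have h := (intervalIntegral.intervalIntegrable_rpow' (a := 0) (b := 1) (r := s - 1)
      (by linarith)).1
    refine Integrable.mono' h (hm _) ((ae_restrict_iff' measurableSet_Ioc).2
      (Eventually.of_forall fun t ht => ?_))
    rw [Real.norm_of_nonneg (mul_nonneg (Real.rpow_nonneg ht.1.le _) (decay_nonneg t))]
    exact mul_le_of_le_one_right (Real.rpow_nonneg ht.1.le _) (min_le_left _ _)
  · have h := integrableOn_Ioi_rpow_of_lt (a := s - 1 - 1 / 2) (by linarith) one_pos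
    refine Integrable.mono' h (hm _) ((ae_restrict_iff' measurableSet_Ioi).2
      (Eventually.of_forall fun t ht => ?_))
    have ht0 : 0 < t := one_pos.trans ht
    rw [Real.norm_of_nonneg (mul_nonneg (Real.rpow_nonneg ht0.le _) (decay_nonneg t)),
      Real.rpow_sub ht0 (s - 1), ← Real.sqrt_eq_rpow, div_eq_mul_inv]
    gcongr
    exact min_le_right _ _

/-- The mass of a power of `t` against the decay factor. -/
def scaleMass (s : ℝ) : ℝ≥0∞ := ∫⁻ t in Ioi (0 : ℝ), ENNReal.ofReal (t ^ (s - 1) * decay t)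

theorem scaleMass_ne_top {s : ℝ} (h0 : 0 < s) (h1 : s < 1 / 2) : scaleMass s ≠ ⊤ :=
  (integrableOn_rpow_mul_decay h0 h1).lintegral_lt_top.ne

theorem lintegral_rpow_mul_decay_mul {s l : ℝ} (h0 : 0 < s) (h1 : s < 1 / 2) (hl : 0 < l) :
    ∫⁻ t in Ioi (0 : ℝ), ENNReal.ofReal (t ^ (s - 1) * decay (l ^ 2 * t)) =
      ENNReal.ofReal (l ^ (-(2 * s))) * scaleMass s := by
  have hi := integrableOn_rpow_mul_decay h0 h1
  have hl2 : 0 < l ^ 2 := by positivity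
  have hn : ∀ t ∈ Ioi (0 : ℝ), 0 ≤ t ^ (s - 1) * decay t := fun t ht =>
    mul_nonneg (Real.rpow_nonneg (le_of_lt ht) _) (decay_nonneg t)
  have hi2 : IntegrableOn (fun t => (l ^ 2 * t) ^ (s - 1) * decay (l ^ 2 * t)) (Ioi 0) := by
    have := (integrableOn_Ioi_comp_mul_left_iff (fun t => t ^ (s - 1) * decay t) 0 hl2).2
    rw [mul_zero] at this
    exact this hi
  have e := integral_comp_mul_left_Ioi (fun t => t ^ (s - 1) * decay t) 0 hl2
  rw [mul_zero] at e
  have e2 : ∀ t ∈ Ioi (0 : ℝ), ENNReal.ofReal (t ^ (s - 1) * decay (l ^ 2 * t)) =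
      ENNReal.ofReal ((l ^ 2) ^ (1 - s)) *
        ENNReal.ofReal ((l ^ 2 * t) ^ (s - 1) * decay (l ^ 2 * t)) := by
    intro t ht
    rw [← ENNReal.ofReal_mul (by positivity), Real.mul_rpow hl2.le (le_of_lt ht), ← mul_assoc,
      ← mul_assoc, ← Real.rpow_add hl2]
    simp
  rw [setLIntegral_congr_fun measurableSet_Ioi e2, lintegral_const_mul' _ _ ENNReal.ofReal_ne_top,
    ← ofReal_integral_eq_lintegral_ofReal hi2
      ((ae_restrict_iff' measurableSet_Ioi).2 (Eventually.of_forall fun t ht =>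
        hn (l ^ 2 * t) (mul_pos hl2 ht))), e, scaleMass,
    ← ofReal_integral_eq_lintegral_ofReal hi
      ((ae_restrict_iff' measurableSet_Ioi).2 (Eventually.of_forall hn)), smul_eq_mul,
    ENNReal.ofReal_mul (by positivity), ← mul_assoc, ← ENNReal.ofReal_mul (by positivity)]
  congr 2
  rw [← Real.rpow_neg_one, ← Real.rpow_add hl2, ← Real.rpow_natCast, ← Real.rpow_mul hl.le]
  congr 1
  push_cast
  ring

end ScaleMass

/-! ### The heat kernel without its low frequencies. -/

section HighKernel

variable (χ : Cutoff) (J : ℝ)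

/-- The heat kernel minus its low frequencies. -/
def heatHigh (t : ℝ) (x : Plane) : ℝ := ∫ y, lowKernel χ J y * (heat t x - heat t (x - y))

theorem measurable_heatHigh_integrand : Measurable fun z : (ℝ × Plane) × Plane =>
    lowKernel χ J z.2 * (heat z.1.1 z.1.2 - heat z.1.1 (z.1.2 - z.2)) := by
  have hk := (continuous_lowKernel χ J).measurable
  have hh := measurable_heat
  refine (hk.comp measurable_snd).mul (Measurable.sub (hh.comp measurable_fst) ?_)
  exact hh.comp ((measurable_fst.comp measurable_fst).prodMk
    ((measurable_snd.comp measurable_fst).sub measurable_snd))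

theorem measurable_heatHigh : Measurable (Function.uncurry (heatHigh χ J)) :=
  (measurable_heatHigh_integrand χ J).stronglyMeasurable.integral_prod_right'.measurable

theorem heatHigh_neg (t : ℝ) (x : Plane) : heatHigh χ J t (-x) = heatHigh χ J t x := by
  rw [heatHigh, ← integral_neg_eq_self, heatHigh]
  refine integral_congr_ae (Eventually.of_forall fun y => ?_)
  simp only [lowKernel_neg, heat_neg]
  rw [← heat_neg t (-x - -y)]
  congr 3
  abel

/-- The low kernel has integral `1`, so removing low frequencies averages the differences `heat t x
- heat t (x - y)`. These cost at most two heat masses, and also at most `‖y‖ / √t`, where the first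
moment of the low kernel contributes `1 / freq J`. The smaller of the two bounds is the decay factor
at `freq J ^ 2 * t`. -/
theorem lintegral_heatHigh_integrand {t : ℝ} (ht : 0 < t) :
    (∫⁻ x, ∫⁻ y, ‖lowKernel χ J y * (heat t x - heat t (x - y))‖ₑ) ≤
      (2 * lowMass χ + lowMoment χ * heatGrad) * ENNReal.ofReal (decay (freq J ^ 2 * t)) := by
  have hf := freq_pos J
  have hkc := continuous_lowKernel χ J
  have hhc := continuous_heat t
  have hk := hkc.measurable
  have hkm : Measurable fun y => ‖lowKernel χ J y‖ₑ * ‖y‖ₑ := hk.enorm.mul measurable_enorm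
  have hm : Measurable fun z : Plane × Plane =>
      ‖lowKernel χ J z.2 * (heat t z.1 - heat t (z.1 - z.2))‖ₑ :=
    Continuous.measurable (by fun_prop)
  have hh : ∀ y : Plane, Measurable fun x => ‖heat t x - heat t (x - y)‖ₑ := fun y => by
    have := continuous_heat t
    exact Continuous.measurable (by fun_prop)
  rw [lintegral_lintegral_swap hm.aemeasurable]
  simp only [enorm_mul]
  simp only [lintegral_const_mul _ (hh _)]
  have h1 : ∫⁻ y, ‖lowKernel χ J y‖ₑ * ∫⁻ x, ‖heat t x - heat t (x - y)‖ₑ ≤ 2 * lowMass χ := by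
    have : ∀ y : Plane, ∫⁻ x, ‖heat t x - heat t (x - y)‖ₑ ≤ 2 := fun y => by
      calc ∫⁻ x, ‖heat t x - heat t (x - y)‖ₑ ≤ ∫⁻ x, (‖heat t x‖ₑ + ‖heat t (x - y)‖ₑ) :=
            lintegral_mono fun x => enorm_sub_le
        _ = 2 := by
            rw [lintegral_add_left (continuous_heat t).enorm.measurable,
              lintegral_sub_right_eq_self (fun x => ‖heat t x‖ₑ), lintegral_heat ht]
            norm_num
    calc _ ≤ ∫⁻ y, ‖lowKernel χ J y‖ₑ * 2 := lintegral_mono fun y => by gcongr; exact this y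
      _ = _ := by rw [lintegral_mul_const _ hk.enorm, lintegral_lowKernel, mul_comm]
  have h2 : ∫⁻ y, ‖lowKernel χ J y‖ₑ * ∫⁻ x, ‖heat t x - heat t (x - y)‖ₑ ≤
      lowMoment χ * heatGrad * ENNReal.ofReal (Real.sqrt (freq J ^ 2 * t))⁻¹ := by
    calc _ ≤ ∫⁻ y, ENNReal.ofReal (Real.sqrt t)⁻¹ * heatGrad * (‖lowKernel χ J y‖ₑ * ‖y‖ₑ) :=
          lintegral_mono fun y => by
            refine (mul_le_mul' le_rfl (lintegral_heat_sub_translate_le ht y)).trans_eq ?_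
            ring
      _ = _ := by
          rw [lintegral_const_mul _ hkm, lintegral_lowKernel_mul_norm,
            Real.sqrt_mul (by positivity), Real.sqrt_sq hf.le, mul_inv,
            ENNReal.ofReal_mul (by positivity)]
          ring
  rw [decay, ENNReal.ofReal_min, mul_min, ENNReal.ofReal_one, mul_one]
  exact le_min (h1.trans le_self_add) (h2.trans (by gcongr; exact le_add_self))

theorem lintegral_heatHigh_le {t : ℝ} (ht : 0 < t) :
    ∫⁻ x, ‖heatHigh χ J t x‖ₑ ≤
      (2 * lowMass χ + lowMoment χ * heatGrad) * ENNReal.ofReal (decay (freq J ^ 2 * t)) :=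
  (lintegral_mono fun _ => enorm_integral_le_lintegral_enorm _).trans
    (lintegral_heatHigh_integrand χ J ht)

/-- The same two estimates in the supremum norm, where the heat kernel and its differences carry an
additional `t⁻¹`. Interpolation with the `L¹` bound will give the `Lᵖ`-`Lʳ` estimates. -/
theorem enorm_heatHigh_le {t : ℝ} (ht : 0 < t) (x : Plane) :
    ‖heatHigh χ J t x‖ₑ ≤
      (2 * lowMass χ + lowMoment χ) * ENNReal.ofReal (t⁻¹ * decay (freq J ^ 2 * t)) := by
  have hf := freq_pos J
  have hk := (continuous_lowKernel χ J).measurable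
  have hkm : Measurable fun y => ‖lowKernel χ J y‖ₑ * ‖y‖ₑ := hk.enorm.mul measurable_enorm
  refine (enorm_integral_le_lintegral_enorm _).trans ?_
  simp only [enorm_mul]
  have h1 : ∫⁻ y, ‖lowKernel χ J y‖ₑ * ‖heat t x - heat t (x - y)‖ₑ ≤
      2 * lowMass χ * ENNReal.ofReal t⁻¹ := by
    have : ∀ y : Plane, ‖heat t x - heat t (x - y)‖ₑ ≤ 2 * ENNReal.ofReal t⁻¹ := fun y => by
      have h : ∀ z, ‖heat t z‖ₑ ≤ ENNReal.ofReal t⁻¹ := fun z => by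
        rw [← ofReal_norm]; exact ENNReal.ofReal_le_ofReal (abs_heat_le ht z)
      rw [two_mul]
      exact enorm_sub_le.trans (add_le_add (h _) (h _))
    calc _ ≤ ∫⁻ y, ‖lowKernel χ J y‖ₑ * (2 * ENNReal.ofReal t⁻¹) :=
          lintegral_mono fun y => by gcongr; exact this y
      _ = _ := by rw [lintegral_mul_const _ hk.enorm, lintegral_lowKernel]; ring
  have h2 : ∫⁻ y, ‖lowKernel χ J y‖ₑ * ‖heat t x - heat t (x - y)‖ₑ ≤
      lowMoment χ * (ENNReal.ofReal t⁻¹ *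
        ENNReal.ofReal (Real.sqrt (freq J ^ 2 * t))⁻¹) := by
    calc _ ≤ ∫⁻ y, ENNReal.ofReal (t⁻¹ * (Real.sqrt t)⁻¹) * (‖lowKernel χ J y‖ₑ * ‖y‖ₑ) :=
          lintegral_mono fun y => by
            have h := ENNReal.ofReal_le_ofReal (abs_heat_sub_translate_le ht x y)
            rw [← Real.norm_eq_abs, ofReal_norm, ← mul_assoc, ENNReal.ofReal_mul (by positivity),
              ofReal_norm] at h
            refine (mul_le_mul' le_rfl h).trans_eq ?_
            ring
      _ = _ := by
          rw [lintegral_const_mul _ hkm, lintegral_lowKernel_mul_norm,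
            Real.sqrt_mul (by positivity), Real.sqrt_sq hf.le, mul_inv,
            ENNReal.ofReal_mul (by positivity), ENNReal.ofReal_mul (by positivity)]
          ring
  rw [decay, mul_min_of_nonneg _ _ (by positivity), ENNReal.ofReal_min, mul_min, mul_one,
    ENNReal.ofReal_mul (by positivity)]
  exact le_min (h1.trans (by gcongr; exact le_self_add)) (h2.trans (by gcongr; exact le_add_self))

theorem integrable_heatHigh_integrand {t : ℝ} (ht : 0 < t) :
    Integrable (fun z : Plane × Plane =>
      lowKernel χ J z.2 * (heat t z.1 - heat t (z.1 - z.2))) (volume.prod volume) := by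
  have hk := continuous_lowKernel χ J
  have hh := continuous_heat t
  have hm : Measurable fun z : Plane × Plane =>
      lowKernel χ J z.2 * (heat t z.1 - heat t (z.1 - z.2)) := Continuous.measurable (by fun_prop)
  refine ⟨hm.aestronglyMeasurable, ?_⟩
  have e := lintegral_prod (μ := (volume : Measure Plane)) (ν := (volume : Measure Plane)) _
    hm.enorm.aemeasurable
  rw [hasFiniteIntegral_iff_enorm, e]
  refine lt_of_le_of_lt (lintegral_heatHigh_integrand χ J ht)
    (ENNReal.mul_lt_top ?_ ENNReal.ofReal_lt_top)
  exact ENNReal.add_lt_top.2 ⟨ENNReal.mul_lt_top (by simp) (lowMass_ne_top χ).lt_top,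
    ENNReal.mul_lt_top (lowMoment_ne_top χ).lt_top heatGrad_ne_top.lt_top⟩

theorem fourier_heat_sub_translate {t : ℝ} (ht : 0 < t) (ξ y : Plane) (c : ℝ) :
    ∫ x, ((c * (heat t x - heat t (x - y)) : ℝ) : ℂ) * ex (-inner ℝ ξ x) =
      (Real.exp (-((2 * Real.pi * ‖ξ‖) ^ 2 * t)) : ℝ) * ((c : ℂ) - (c : ℂ) * ex (-inner ℝ ξ y)) := by
  set F : Plane → ℂ := fun x => (heat t x : ℂ) * ex (-inner ℝ ξ x) with hFdef
  have hF : Integrable F := by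
    refine (integrable_heat ht).ofReal.mul_bdd (c := 1) ?_ (Eventually.of_forall fun x => by simp)
    exact Continuous.aestronglyMeasurable (by fun_prop)
  have e3 : ∀ x, ((c * (heat t x - heat t (x - y)) : ℝ) : ℂ) * ex (-inner ℝ ξ x) =
      (c : ℂ) * (F x - ex (-inner ℝ ξ y) * F (x - y)) := by
    intro x
    simp only [F]
    have : ex (-inner ℝ ξ x) = ex (-inner ℝ ξ y) * ex (-inner ℝ ξ (x - y)) := by
      rw [← ex_add, inner_sub_right]; congr 1; ring
    push_cast
    rw [mul_left_comm (ex (-inner ℝ ξ y)), ← this]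
    ring
  simp only [e3]
  rw [integral_const_mul, integral_sub hF ((hF.comp_sub_right y).const_mul _),
    integral_const_mul, integral_sub_right_eq_self F y, hFdef, fourier_heat ht]
  ring

/-- The Fourier transform of `heatHigh`. -/
theorem fourier_heatHigh {t : ℝ} (ht : 0 < t) (ξ : Plane) :
    ∫ x, (heatHigh χ J t x : ℂ) * ex (-inner ℝ ξ x) =
      ((1 - lowSymbol χ J ξ) * Real.exp (-((2 * Real.pi * ‖ξ‖) ^ 2 * t)) : ℝ) := by
  have hi2 : Integrable (Function.uncurry fun x y : Plane =>
      ((lowKernel χ J y * (heat t x - heat t (x - y)) : ℝ) : ℂ) * ex (-inner ℝ ξ x))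
      (volume.prod volume) := by
    refine (integrable_heatHigh_integrand χ J ht).ofReal.mul_bdd (c := 1)
      (g := fun z : Plane × Plane => ex (-inner ℝ ξ z.1)) ?_
      (Eventually.of_forall fun z => by simp)
    exact Continuous.aestronglyMeasurable (by fun_prop)
  have e1 : ∀ x, (heatHigh χ J t x : ℂ) * ex (-inner ℝ ξ x) =
      ∫ y, ((lowKernel χ J y * (heat t x - heat t (x - y)) : ℝ) : ℂ) * ex (-inner ℝ ξ x) := by
    intro x
    rw [integral_mul_const, heatHigh, integral_complex_ofReal]
  have hk : Integrable fun y => (lowKernel χ J y : ℂ) := (integrable_lowKernel χ J).ofReal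
  have hk2 : Integrable fun y => (lowKernel χ J y : ℂ) * ex (-inner ℝ ξ y) := by
    refine hk.mul_bdd (c := 1) ?_ (Eventually.of_forall fun x => by simp)
    exact Continuous.aestronglyMeasurable (by fun_prop)
  simp only [e1]
  rw [integral_integral_swap hi2]
  simp only [fourier_heat_sub_translate ht]
  rw [integral_const_mul, integral_sub hk hk2, fourier_lowKernel, integral_complex_ofReal,
    integral_lowKernel]
  push_cast
  ring

end HighKernel

/-! ### The kernel of the inverse fractional Laplacian on high frequencies. -/

section HighKernelPower

variable (χ : Cutoff) (J : ℝ) {β : ℝ}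

/-- A common constant in the bounds for `heatHigh`. -/
def heatHighConst : ℝ≥0∞ := 2 * lowMass χ + lowMoment χ * heatGrad + lowMoment χ + 1

theorem heatHighConst_ne_top : heatHighConst χ ≠ ⊤ := by
  have h1 := lowMass_ne_top χ
  have h2 := lowMoment_ne_top χ
  have h3 := heatGrad_ne_top
  unfold heatHighConst
  finiteness

/-- The summand `1` in the constant ensures this; nonvanishing is needed to divide by the weight in
Minkowski's inequality and to add exponents. -/
theorem heatHighConst_ne_zero : heatHighConst χ ≠ 0 := by simp [heatHighConst]

theorem lintegral_heatHigh_le' {t : ℝ} (ht : 0 < t) :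
    ∫⁻ x, ‖heatHigh χ J t x‖ₑ ≤ heatHighConst χ * ENNReal.ofReal (decay (freq J ^ 2 * t)) := by
  refine (lintegral_heatHigh_le χ J ht).trans (mul_le_mul' ?_ le_rfl)
  exact le_self_add.trans le_self_add

theorem enorm_heatHigh_le' {t : ℝ} (ht : 0 < t) (x : Plane) :
    ‖heatHigh χ J t x‖ₑ ≤
      heatHighConst χ * ENNReal.ofReal (decay (freq J ^ 2 * t)) * ENNReal.ofReal t⁻¹ := by
  refine (enorm_heatHigh_le χ J ht x).trans ?_
  rw [ENNReal.ofReal_mul (inv_nonneg.2 ht.le), mul_assoc, mul_comm (ENNReal.ofReal t⁻¹)]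
  refine mul_le_mul' ?_ le_rfl
  refine (add_le_add le_self_add le_rfl).trans le_self_add

/-- The kernel of the multiplier `(1 - χ(2^{-(J+1)} ξ)) |ξ|^{-β}`. -/
def highKernel (β : ℝ) (x : Plane) : ℝ :=
  (Real.Gamma (β / 2))⁻¹ * ∫ t in Ioi (0 : ℝ), t ^ (β / 2 - 1) * heatHigh χ J t x

theorem highKernel_neg (x : Plane) : highKernel χ J β (-x) = highKernel χ J β x := by
  simp only [highKernel, heatHigh_neg]

theorem measurable_rpow_mul_heatHigh (β : ℝ) :
    Measurable fun z : ℝ × Plane => z.1 ^ (β / 2 - 1) * heatHigh χ J z.1 z.2 :=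
  (measurable_fst.pow_const _).mul (measurable_heatHigh χ J)

theorem measurable_highKernel (β : ℝ) : Measurable (highKernel χ J β) := by
  have h : Measurable fun z : Plane × ℝ => z.2 ^ (β / 2 - 1) * heatHigh χ J z.2 z.1 :=
    (measurable_rpow_mul_heatHigh χ J β).comp measurable_swap
  exact h.stronglyMeasurable.integral_prod_right'.measurable.const_mul _

theorem integrable_rpow_mul_heatHigh (h0 : 0 < β) (h1 : β < 1) :
    Integrable (fun z : ℝ × Plane => z.1 ^ (β / 2 - 1) * heatHigh χ J z.1 z.2)
      ((volume.restrict (Ioi 0)).prod volume) := by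
  have hm := measurable_rpow_mul_heatHigh χ J β
  have hN : ∀ t, Measurable fun x => ‖heatHigh χ J t x‖ₑ := fun t =>
    ((measurable_heatHigh χ J).comp (measurable_const.prodMk measurable_id)).enorm
  refine ⟨hm.aestronglyMeasurable, ?_⟩
  have e := lintegral_prod (μ := (volume : Measure ℝ).restrict (Ioi 0))
    (ν := (volume : Measure Plane)) _ hm.enorm.aemeasurable
  rw [hasFiniteIntegral_iff_enorm, e]
  have hb : ∀ t ∈ Ioi (0 : ℝ), (∫⁻ x, ‖t ^ (β / 2 - 1) * heatHigh χ J t x‖ₑ) ≤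
      heatHighConst χ * ENNReal.ofReal (t ^ (β / 2 - 1) * decay (freq J ^ 2 * t)) := by
    intro t ht
    have ht0 : 0 ≤ t ^ (β / 2 - 1) := Real.rpow_nonneg (le_of_lt ht) _
    simp only [enorm_mul]
    rw [lintegral_const_mul _ (hN t), Real.enorm_eq_ofReal ht0, ENNReal.ofReal_mul ht0]
    calc _ ≤ ENNReal.ofReal (t ^ (β / 2 - 1)) *
          (heatHighConst χ * ENNReal.ofReal (decay (freq J ^ 2 * t))) := by
          gcongr; exact lintegral_heatHigh_le' χ J ht
      _ = _ := by ring
  refine (setLIntegral_mono' measurableSet_Ioi hb).trans_lt ?_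
  rw [lintegral_const_mul' _ _ (heatHighConst_ne_top χ),
    lintegral_rpow_mul_decay_mul (by linarith) (by linarith) (freq_pos J)]
  have h2 := scaleMass_ne_top (s := β / 2) (by linarith) (by linarith)
  have h3 := heatHighConst_ne_top χ
  finiteness

theorem integrable_highKernel (h0 : 0 < β) (h1 : β < 1) : Integrable (highKernel χ J β) :=
  ((integrable_rpow_mul_heatHigh χ J h0 h1).integral_prod_right).const_mul _

/-- The Fourier transform of `highKernel`. -/
theorem fourier_highKernel (h0 : 0 < β) (h1 : β < 1) (ξ : Plane) :
    (∫ x, (highKernel χ J β x : ℂ) * ex (-inner ℝ ξ x)) *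
      (((2 * Real.pi * ‖ξ‖) ^ β : ℝ) : ℂ) = ((1 - lowSymbol χ J ξ : ℝ) : ℂ) := by
  -- Writing `‖ξ‖ ^ β` as a factor on the left, rather than dividing by it, keeps the identity true
  -- at the origin, where both sides vanish.
  rcases eq_or_ne ξ 0 with rfl | hξ
  · simp [lowSymbol_zero, Real.zero_rpow h0.ne']
  have hpi := Real.pi_pos
  have hξ0 : 0 < 2 * Real.pi * ‖ξ‖ := by have := norm_pos_iff.2 hξ; positivity
  have hG := Real.Gamma_pos_of_pos (show 0 < β / 2 by linarith)
  have e1 : ∀ x, (highKernel χ J β x : ℂ) * ex (-inner ℝ ξ x) =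
      ((Real.Gamma (β / 2))⁻¹ : ℝ) * ∫ t in Ioi (0 : ℝ),
        ((t ^ (β / 2 - 1) * heatHigh χ J t x : ℝ) : ℂ) * ex (-inner ℝ ξ x) := by
    intro x
    rw [integral_mul_const, highKernel, integral_complex_ofReal]
    push_cast
    ring
  have hi : Integrable (Function.uncurry fun (t : ℝ) (x : Plane) =>
      ((t ^ (β / 2 - 1) * heatHigh χ J t x : ℝ) : ℂ) * ex (-inner ℝ ξ x))
      ((volume.restrict (Ioi 0)).prod volume) := by
    refine (integrable_rpow_mul_heatHigh χ J h0 h1).ofReal.mul_bdd (c := 1)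
      (g := fun z : ℝ × Plane => ex (-inner ℝ ξ z.2)) ?_ (Eventually.of_forall fun z => by simp)
    exact Continuous.aestronglyMeasurable (by fun_prop)
  have e2 : ∀ t ∈ Ioi (0 : ℝ),
      ∫ x, ((t ^ (β / 2 - 1) * heatHigh χ J t x : ℝ) : ℂ) * ex (-inner ℝ ξ x) =
      (((1 - lowSymbol χ J ξ) *
        (t ^ (β / 2 - 1) * Real.exp (-((2 * Real.pi * ‖ξ‖) ^ 2 * t))) : ℝ) : ℂ) := by
    intro t ht
    have := fourier_heatHigh χ J ht ξ
    simp only [Complex.ofReal_mul, mul_assoc] at this ⊢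
    rw [integral_const_mul, this]
    ring
  simp only [e1]
  -- After Fubini's theorem, the remaining time integral is the Gamma integral `∫ t^(β/2-1) e^(-a²
  -- t) dt = Γ(β/2) a^(-β)` with `a = 2π‖ξ‖`.
  rw [integral_const_mul, ← integral_integral_swap hi,
    setIntegral_congr_fun measurableSet_Ioi e2, integral_complex_ofReal, integral_const_mul,
    Real.integral_rpow_mul_exp_neg_mul_Ioi (by linarith) (by positivity)]
  rw [← Complex.ofReal_mul, ← Complex.ofReal_mul]
  congr 1
  have h3 : (1 / (2 * Real.pi * ‖ξ‖) ^ 2) ^ (β / 2) * (2 * Real.pi * ‖ξ‖) ^ β = 1 := by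
    rw [one_div, ← Real.rpow_natCast, ← Real.rpow_neg hξ0.le, ← Real.rpow_mul hξ0.le,
      ← Real.rpow_add hξ0]
    convert Real.rpow_zero _ using 2
    push_cast
    ring
  calc _ = (1 - lowSymbol χ J ξ) * ((Real.Gamma (β / 2))⁻¹ * Real.Gamma (β / 2)) *
        ((1 / (2 * Real.pi * ‖ξ‖) ^ 2) ^ (β / 2) * (2 * Real.pi * ‖ξ‖) ^ β) := by ring
    _ = _ := by rw [h3, inv_mul_cancel₀ hG.ne']; ring

theorem enorm_highKernel_le (x : Plane) : ‖highKernel χ J β x‖ₑ ≤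
    ‖(Real.Gamma (β / 2))⁻¹‖ₑ *
      ∫⁻ t in Ioi (0 : ℝ), ENNReal.ofReal (t ^ (β / 2 - 1)) * ‖heatHigh χ J t x‖ₑ := by
  rw [highKernel, enorm_mul]
  gcongr
  refine (enorm_integral_le_lintegral_enorm _).trans_eq
    (setLIntegral_congr_fun measurableSet_Ioi fun t ht => ?_)
  simp only [enorm_mul]
  rw [Real.enorm_eq_ofReal (Real.rpow_nonneg (le_of_lt ht) _)]

/-- Bernstein's inequality for `Δ_{≤ J}`. -/
theorem exists_lowKernel_bound {p r : ℝ} (hp : 1 < p) (hpr : p ≤ r) :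
    ∃ C : ℝ≥0∞, C ≠ ⊤ ∧ ∀ (J : ℝ) (f : Plane → ℝ≥0∞), Measurable f →
      ∫⁻ x, (∫⁻ y, ‖lowKernel χ J y‖ₑ * f (x - y)) ^ r ≤
        (C * ENNReal.ofReal (freq J ^ (2 * (1 / p - 1 / r)))) ^ r * (∫⁻ x, f x ^ p) ^ (r / p) := by
  have hd : 0 ≤ 1 / p - 1 / r := sub_nonneg.2 (one_div_le_one_div_of_le (by linarith) hpr)
  have hd1 : 1 / p - 1 / r ≤ 1 := by
    have h1 : 1 / p ≤ 1 := by rw [div_le_one (by linarith)]; exact hp.le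
    have h2 : 0 < 1 / r := by have : 0 < r := by linarith
                              positivity
    linarith
  set d := 1 / p - 1 / r
  refine ⟨ENNReal.ofReal (lowSup χ) ^ d * lowMass χ ^ (1 - d), ?_, fun J f hf => ?_⟩
  · exact ENNReal.mul_ne_top (ENNReal.rpow_ne_top_of_nonneg hd ENNReal.ofReal_ne_top)
      (ENNReal.rpow_ne_top_of_nonneg (by linarith) (lowMass_ne_top χ))
  · have h := lintegral_rpow_conv_le_interpolate hp hpr
      (continuous_lowKernel χ J).enorm.measurable hf (lintegral_lowKernel χ J).le
      (enorm_lowKernel_le χ J)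
    refine h.trans_eq ?_
    have hf := freq_pos J
    change (_ ^ d * _) ^ r * _ = _
    rw [ENNReal.mul_rpow_of_nonneg _ _ hd, ENNReal.ofReal_rpow_of_nonneg (by positivity) hd,
      ← Real.rpow_natCast, ← Real.rpow_mul hf.le]
    push_cast
    congr 2
    ring

/-- The operator with kernel `highKernel` gains `β` derivatives, and maps `Lᵖ` to `Lʳ`. -/
theorem exists_highKernel_bound {p r : ℝ} (hp : 1 < p) (hpr : p ≤ r) (h1 : β < 1)
    (hd2 : 1 / p - 1 / r < β / 2) :
    ∃ C : ℝ≥0∞, C ≠ ⊤ ∧ ∀ (J : ℝ) (f : Plane → ℝ≥0∞), Measurable f →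
      ∫⁻ x, (∫⁻ y, ‖highKernel χ J β y‖ₑ * f (x - y)) ^ r ≤
        (C * ENNReal.ofReal (freq J ^ (2 * (1 / p - 1 / r) - β))) ^ r *
          (∫⁻ x, f x ^ p) ^ (r / p) := by
  have hr0 : 0 < r := by linarith
  have hd : 0 ≤ 1 / p - 1 / r := sub_nonneg.2 (one_div_le_one_div_of_le (by linarith) hpr)
  set d := 1 / p - 1 / r with hdef
  set c := ‖(Real.Gamma (β / 2))⁻¹‖ₑ
  refine ⟨c * (heatHighConst χ * scaleMass (β / 2 - d)), ?_, fun J f hf => ?_⟩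
  · have h2 := scaleMass_ne_top (s := β / 2 - d) (by linarith) (by linarith)
    have h3 := heatHighConst_ne_top χ
    have h4 : c ≠ ⊤ := enorm_ne_top
    finiteness
  have hN := measurable_heatHigh χ J
  have hNt : ∀ t, Measurable fun y => ‖heatHigh χ J t y‖ₑ := fun t =>
    (hN.comp (measurable_const.prodMk measurable_id)).enorm
  set F : ℝ → Plane → ℝ≥0∞ := fun t x =>
    ENNReal.ofReal (t ^ (β / 2 - 1)) * ∫⁻ y, ‖heatHigh χ J t y‖ₑ * f (x - y)
  have hF3 : Measurable fun z : (ℝ × Plane) × Plane => ‖heatHigh χ J z.1.1 z.2‖ₑ * f (z.1.2 - z.2) :=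
    (hN.comp ((measurable_fst.comp measurable_fst).prodMk measurable_snd)).enorm.mul
      (hf.comp ((measurable_snd.comp measurable_fst).sub measurable_snd))
  have hF : Measurable (Function.uncurry F) :=
    (measurable_fst.pow_const _).ennreal_ofReal.mul hF3.lintegral_prod_right'
  -- At time `t`, interpolating the `L¹` and supremum bounds gives an `Lᵖ`-`Lʳ` norm of order
  -- `t^(-d)` times the decay factor. With the weight `t^(β/2-1)` this is `b t`, whose integral is
  -- finite since `0 < β/2 - d < 1/2`.
  set b : ℝ → ℝ≥0∞ := fun t =>
    heatHighConst χ * ENNReal.ofReal (t ^ (β / 2 - d - 1) * decay (freq J ^ 2 * t))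
  have hb : Measurable b := by
    have := measurable_decay
    exact ((measurable_id.pow_const _).mul
      (this.comp (measurable_id.const_mul _))).ennreal_ofReal.const_mul _
  have hpos : ∀ t ∈ Ioi (0 : ℝ), 0 < t ^ (β / 2 - d - 1) * decay (freq J ^ 2 * t) := fun t ht =>
    mul_pos (Real.rpow_pos_of_pos ht _) (decay_pos (mul_pos (pow_pos (freq_pos J) 2) ht))
  have key : ∫⁻ x, (∫⁻ t in Ioi 0, F t x) ^ r ≤
      (∫⁻ t in Ioi 0, b t) ^ r * (∫⁻ x, f x ^ p) ^ (r / p) := by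
    refine lintegral_rpow_lintegral_le_of_le (by linarith) hF hb
      ((ae_restrict_iff' measurableSet_Ioi).2 (Eventually.of_forall fun t ht => ?_))
      (Eventually.of_forall fun t => ENNReal.mul_ne_top (heatHighConst_ne_top χ)
        ENNReal.ofReal_ne_top)
      ((ae_restrict_iff' measurableSet_Ioi).2 (Eventually.of_forall fun t ht => ?_))
    · exact mul_ne_zero (heatHighConst_ne_zero χ) (by simpa using hpos t ht)
    · have ht0 : 0 < t := ht
      have hdec := decay_pos (mul_pos (pow_pos (freq_pos J) 2) ht0)
      have h := lintegral_rpow_conv_le_interpolate hp hpr (hNt t) hf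
        (lintegral_heatHigh_le' χ J ht) (enorm_heatHigh_le' χ J ht)
      simp only [F, ENNReal.mul_rpow_of_nonneg _ _ hr0.le]
      have hm2 : Measurable fun x => (∫⁻ y, ‖heatHigh χ J t y‖ₑ * f (x - y)) ^ r :=
        (hF3.lintegral_prod_right'.comp (measurable_const.prodMk measurable_id)).pow_const r
      rw [lintegral_const_mul _ hm2]
      refine (mul_le_mul' le_rfl h).trans_eq ?_
      rw [← mul_assoc, ← ENNReal.mul_rpow_of_nonneg _ _ hr0.le,
        ← hdef]
      congr 2
      set D := ENNReal.ofReal (decay (freq J ^ 2 * t)) with hD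
      have hD0 : heatHighConst χ * D ≠ 0 :=
        mul_ne_zero (heatHighConst_ne_zero χ) (by simpa [hD] using hdec)
      have hDt : heatHighConst χ * D ≠ ⊤ :=
        ENNReal.mul_ne_top (heatHighConst_ne_top χ) ENNReal.ofReal_ne_top
      rw [ENNReal.mul_rpow_of_nonneg _ _ hd, mul_right_comm ((heatHighConst χ * D) ^ d),
        ← ENNReal.rpow_add _ _ hD0 hDt, add_sub_cancel, ENNReal.rpow_one,
        ENNReal.ofReal_rpow_of_nonneg (inv_nonneg.2 ht0.le) hd, Real.inv_rpow ht0.le,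
        ← Real.rpow_neg ht0.le, mul_comm, mul_assoc, ← ENNReal.ofReal_mul (by positivity),
        ← Real.rpow_add ht0, mul_assoc, hD, ← ENNReal.ofReal_mul hdec.le,
        mul_comm (decay _)]
      congr 4
      ring
  have hle : ∀ x, ∫⁻ y, ‖highKernel χ J β y‖ₑ * f (x - y) ≤ c * ∫⁻ t in Ioi 0, F t x := by
    intro x
    have hm3 : Measurable fun z : Plane × ℝ =>
        ENNReal.ofReal (z.2 ^ (β / 2 - 1)) * ‖heatHigh χ J z.2 z.1‖ₑ * f (x - z.1) :=
      ((measurable_snd.pow_const _).ennreal_ofReal.mul (hN.comp measurable_swap).enorm).mul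
        (hf.comp (measurable_const.sub measurable_fst))
    have hm4 : ∀ y, Measurable fun t =>
        ENNReal.ofReal (t ^ (β / 2 - 1)) * ‖heatHigh χ J t y‖ₑ := fun y =>
      (measurable_id.pow_const _).ennreal_ofReal.mul
        (hN.comp (measurable_id.prodMk measurable_const)).enorm
    calc ∫⁻ y, ‖highKernel χ J β y‖ₑ * f (x - y)
        ≤ ∫⁻ y, c * ∫⁻ t in Ioi (0 : ℝ),
            ENNReal.ofReal (t ^ (β / 2 - 1)) * ‖heatHigh χ J t y‖ₑ * f (x - y) := by
          refine lintegral_mono fun y => ?_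
          rw [lintegral_mul_const _ (hm4 y), ← mul_assoc]
          gcongr
          exact enorm_highKernel_le χ J y
      _ = c * ∫⁻ y, ∫⁻ t in Ioi (0 : ℝ),
            ENNReal.ofReal (t ^ (β / 2 - 1)) * ‖heatHigh χ J t y‖ₑ * f (x - y) :=
          lintegral_const_mul _ hm3.lintegral_prod_right'
      _ = c * ∫⁻ t in Ioi (0 : ℝ), F t x := by
          rw [lintegral_lintegral_swap hm3.aemeasurable]
          congr 1
          refine lintegral_congr fun t => ?_
          simp only [mul_assoc]
          exact lintegral_const_mul _
            ((hNt t).mul (hf.comp (measurable_const.sub measurable_id)))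
  have hmF : Measurable fun x => (∫⁻ t in Ioi 0, F t x) ^ r :=
    (Measurable.lintegral_prod_right' (f := fun z : Plane × ℝ => F z.2 z.1)
      (hF.comp measurable_swap)).pow_const r
  calc _ ≤ ∫⁻ x, (c * ∫⁻ t in Ioi 0, F t x) ^ r :=
        lintegral_mono fun x => ENNReal.rpow_le_rpow (hle x) hr0.le
    _ = c ^ r * ∫⁻ x, (∫⁻ t in Ioi 0, F t x) ^ r := by
        simp only [ENNReal.mul_rpow_of_nonneg _ _ hr0.le]
        exact lintegral_const_mul _ hmF
    _ ≤ c ^ r * ((∫⁻ t in Ioi 0, b t) ^ r * (∫⁻ x, f x ^ p) ^ (r / p)) := by gcongr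
    _ = _ := by
        rw [← mul_assoc, ← ENNReal.mul_rpow_of_nonneg _ _ hr0.le]
        congr 2
        rw [lintegral_const_mul' _ _ (heatHighConst_ne_top χ),
          lintegral_rpow_mul_decay_mul (by linarith) (by linarith) (freq_pos J),
          show -(2 * (β / 2 - d)) = 2 * d - β by ring]
        ring

end HighKernelPower

/-! ### Subordination and integrability of `Λ^β φ` for test functions. -/

section FracLap

variable {β : ℝ}

/-- The right-hand side is `min (√s) 1`. Writing it with `decay` lets the same power integrals serve
for the fractional Laplacian. -/
theorem one_sub_exp_neg_le {s : ℝ} (hs : 0 < s) : 1 - Real.exp (-s) ≤ Real.sqrt s * decay s := by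
  have h1 : 1 - Real.exp (-s) ≤ s := by have := Real.add_one_le_exp (-s); linarith
  have h2 : 1 - Real.exp (-s) ≤ 1 := by have := Real.exp_pos (-s); linarith
  have h3 := Real.sqrt_pos.2 hs
  rw [decay, mul_min_of_nonneg _ _ h3.le, mul_one, mul_inv_cancel₀ h3.ne']
  refine le_min ?_ h2
  rcases le_total s 1 with h | h
  · exact h1.trans (Real.le_sqrt_of_sq_le (by nlinarith))
  · exact h2.trans (Real.one_le_sqrt.2 h)

/-- The integrand in the subordination formula for `a ^ β`. -/
def fracIntegrand (β : ℝ) (t : ℝ) : ℝ := t ^ (-1 - β / 2) * (1 - Real.exp (-t))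

/-- The exponent is brought to the form `s - 1` with `s = (1 - β)/2`, which lies in `(0, 1/2)` when
`0 < β < 1`. -/
theorem rpow_mul_sqrt {t : ℝ} (ht : 0 < t) :
    t ^ (-1 - β / 2) * Real.sqrt t = t ^ ((1 - β) / 2 - 1) := by
  rw [Real.sqrt_eq_rpow, ← Real.rpow_add ht]
  congr 1
  ring

theorem fracIntegrand_pos {t : ℝ} (ht : 0 < t) : 0 < fracIntegrand β t :=
  mul_pos (Real.rpow_pos_of_pos ht _) (by have := Real.exp_lt_one_iff.2 (neg_neg_of_pos ht); linarith)

theorem integrableOn_fracIntegrand (h0 : 0 < β) (h1 : β < 1) :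
    IntegrableOn (fracIntegrand β) (Ioi 0) := by
  refine Integrable.mono' (integrableOn_rpow_mul_decay (s := (1 - β) / 2) (by linarith)
    (by linarith)) ?_ ((ae_restrict_iff' measurableSet_Ioi).2 (Eventually.of_forall fun t ht => ?_))
  · have : Measurable (fracIntegrand β) := by unfold fracIntegrand; fun_prop
    exact this.aestronglyMeasurable
  · rw [Real.norm_of_nonneg (fracIntegrand_pos ht).le, ← rpow_mul_sqrt ht, mul_assoc]
    exact mul_le_mul_of_nonneg_left (one_sub_exp_neg_le ht) (Real.rpow_nonneg (le_of_lt ht) _)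

/-- The constant in the subordination formula. -/
def fracConst (β : ℝ) : ℝ := ∫ t in Ioi (0 : ℝ), fracIntegrand β t

theorem fracConst_pos (h0 : 0 < β) (h1 : β < 1) : 0 < fracConst β := by
  rw [fracConst, setIntegral_pos_iff_support_of_nonneg_ae _ (integrableOn_fracIntegrand h0 h1)]
  · have : Function.support (fracIntegrand β) ∩ Ioi 0 = Ioi 0 :=
      inter_eq_right.2 fun t ht => (fracIntegrand_pos ht).ne'
    rw [this]; simp
  · exact (ae_restrict_iff' measurableSet_Ioi).2
      (Eventually.of_forall fun t ht => (fracIntegrand_pos ht).le)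

theorem fracIntegrand_scale {a t : ℝ} (ha : 0 < a) (ht : 0 < t) :
    t ^ (-1 - β / 2) * (1 - Real.exp (-(a ^ 2 * t))) =
      a ^ β * a ^ 2 * fracIntegrand β (a ^ 2 * t) := by
  have h : a ^ β * a ^ 2 * (a ^ 2) ^ (-1 - β / 2) = 1 := by
    rw [← Real.rpow_natCast, ← Real.rpow_mul ha.le, ← Real.rpow_add ha, ← Real.rpow_add ha]
    convert Real.rpow_zero a using 2
    push_cast
    ring
  rw [fracIntegrand, Real.mul_rpow (by positivity) ht.le, ← mul_assoc, ← mul_assoc, h, one_mul]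

theorem integrableOn_subordination (h0 : 0 < β) (h1 : β < 1) {a : ℝ} (ha : 0 ≤ a) :
    IntegrableOn (fun t => t ^ (-1 - β / 2) * (1 - Real.exp (-(a ^ 2 * t)))) (Ioi 0) := by
  rcases ha.eq_or_lt with rfl | ha
  · simp
  have h := (integrableOn_Ioi_comp_mul_left_iff (fracIntegrand β) 0 (show 0 < a ^ 2 by positivity)).2
  rw [mul_zero] at h
  exact ((h (integrableOn_fracIntegrand h0 h1)).const_mul (a ^ β * a ^ 2)).congr
    ((ae_restrict_iff' measurableSet_Ioi).2 (Eventually.of_forall fun t ht =>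
      (fracIntegrand_scale ha ht).symm))

/-- The subordination formula for `a ^ β`. -/
theorem integral_subordination (h0 : 0 < β) {a : ℝ} (ha : 0 ≤ a) :
    ∫ t in Ioi (0 : ℝ), t ^ (-1 - β / 2) * (1 - Real.exp (-(a ^ 2 * t))) = a ^ β * fracConst β := by
  rcases ha.eq_or_lt with rfl | ha
  · simp [Real.zero_rpow h0.ne']
  have h := integral_comp_mul_left_Ioi (fracIntegrand β) 0 (show 0 < a ^ 2 by positivity)
  rw [mul_zero] at h
  rw [setIntegral_congr_fun measurableSet_Ioi fun t ht => fracIntegrand_scale ha ht,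
    integral_const_mul, h, smul_eq_mul, fracConst]
  field_simp

variable {φ : Plane → ℝ}

theorem integrable_fracSymbol_mul (h0 : 0 < β) (h1 : β < 1) (hφ : ContDiff ℝ ∞ φ)
    (hc : HasCompactSupport φ) :
    Integrable fun ξ : Plane => (((2 * Real.pi * ‖ξ‖) ^ β : ℝ) : ℂ) * testHat φ ξ := by
  have i1 := (integrable_norm_pow_mul_testHat hφ hc 1).const_mul (2 * Real.pi)
  have i0 := (integrable_testHat hφ hc).norm
  refine Integrable.mono' (i0.add i1) ?_ (Eventually.of_forall fun ξ => ?_)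
  · have hm : Measurable fun ξ : Plane => (((2 * Real.pi * ‖ξ‖) ^ β : ℝ) : ℂ) := by fun_prop
    exact hm.aestronglyMeasurable.mul (continuous_testHat hφ hc).aestronglyMeasurable
  · have hpi := Real.pi_pos
    have ha : 0 ≤ 2 * Real.pi * ‖ξ‖ := by positivity
    have hb : (2 * Real.pi * ‖ξ‖) ^ β ≤ 1 + 2 * Real.pi * ‖ξ‖ := by
      calc (2 * Real.pi * ‖ξ‖) ^ β ≤ (1 + 2 * Real.pi * ‖ξ‖) ^ β :=
            Real.rpow_le_rpow ha (by linarith) h0.le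
        _ ≤ (1 + 2 * Real.pi * ‖ξ‖) ^ (1 : ℝ) :=
            Real.rpow_le_rpow_of_exponent_le (by linarith) h1.le
        _ = _ := Real.rpow_one _
    rw [norm_mul, Complex.norm_real, Real.norm_of_nonneg (Real.rpow_nonneg ha _)]
    calc _ ≤ (1 + 2 * Real.pi * ‖ξ‖) * ‖testHat φ ξ‖ := by gcongr
      _ = _ := by simp only [Pi.add_apply]; ring

theorem fracLapTest_eq (x : Plane) : fracLapTest β φ x =
    (𝓕⁻ (fun ξ : Plane => (((2 * Real.pi * ‖ξ‖) ^ β : ℝ) : ℂ) * testHat φ ξ) x).re := rfl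

theorem continuous_fracLapTest (h0 : 0 < β) (h1 : β < 1) (hφ : ContDiff ℝ ∞ φ)
    (hc : HasCompactSupport φ) : Continuous (fracLapTest β φ) :=
  Complex.continuous_re.comp (continuous_fourierInv (integrable_fracSymbol_mul h0 h1 hφ hc))

theorem exists_fracLapTest_le : ∃ S : ℝ, ∀ x, ‖fracLapTest β φ x‖ ≤ S :=
  ⟨_, fun x => (Complex.abs_re_le_norm _).trans (norm_fourierInv_le x)⟩

/-- The difference between a function and its evolution by the heat equation. -/
def heatDiff (φ : Plane → ℝ) (t : ℝ) (x : Plane) : ℝ := ∫ y, heat t y * (φ x - φ (x - y))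

theorem ofReal_heatDiff (hφ : ContDiff ℝ ∞ φ) (hc : HasCompactSupport φ) {t : ℝ} (ht : 0 < t)
    (x : Plane) : (heatDiff φ t x : ℂ) = 𝓕⁻ (fun ξ : Plane =>
      ((1 - Real.exp (-((2 * Real.pi * ‖ξ‖) ^ 2 * t)) : ℝ) : ℂ) * testHat φ ξ) x := by
  have hg : Integrable fun y => (heat t y : ℂ) := (integrable_heat ht).ofReal
  have hψ := integrable_testHat hφ hc
  have h := integral_mul_fourierInv_sub hg measurable_id hψ x
  simp only [id, fourierInv_testHat hφ hc, fourier_heat ht] at h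
  obtain ⟨S, hS⟩ := hφ.continuous.bounded_above_of_compact_support hc
  have hi : Integrable fun y => (heat t y : ℂ) * (φ (x - y) : ℂ) := by
    have := hφ.continuous
    refine hg.mul_bdd (c := S) ?_ (Eventually.of_forall fun y => ?_)
    · exact Continuous.aestronglyMeasurable (by fun_prop)
    · simpa using hS (x - y)
  have e : (heatDiff φ t x : ℂ) = (φ x : ℂ) - ∫ y, (heat t y : ℂ) * (φ (x - y) : ℂ) := by
    rw [heatDiff, ← integral_complex_ofReal]
    have : ∀ y, ((heat t y * (φ x - φ (x - y)) : ℝ) : ℂ) =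
        (heat t y : ℂ) * (φ x : ℂ) - (heat t y : ℂ) * (φ (x - y) : ℂ) := fun y => by push_cast; ring
    simp only [this]
    rw [integral_sub (hg.mul_const _) hi, integral_mul_const, integral_complex_ofReal,
      integral_heat ht]
    simp
  rw [e, h, ← fourierInv_testHat hφ hc x, fourierInv_eq_integral, fourierInv_eq_integral,
    fourierInv_eq_integral, ← integral_sub]
  · refine integral_congr_ae (Eventually.of_forall fun ξ => ?_)
    simp only
    push_cast
    ring
  · refine hψ.bdd_mul (c := 1) ?_ (Eventually.of_forall fun ξ => by simp)
    exact Continuous.aestronglyMeasurable (by fun_prop)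
  · refine Integrable.bdd_mul (c := 1) (hψ.bdd_mul (c := 1) ?_ (Eventually.of_forall fun ξ => ?_))
      ?_ (Eventually.of_forall fun ξ => by simp)
    · exact Continuous.aestronglyMeasurable (by fun_prop)
    · rw [Complex.norm_real, Real.norm_of_nonneg (Real.exp_pos _).le]
      exact Real.exp_le_one_iff.2 (neg_nonpos.2 (by positivity))
    · exact Continuous.aestronglyMeasurable (by fun_prop)

theorem measurable_heatDiff_integrand (hφ : Continuous φ) : Measurable fun z : (ℝ × Plane) × Plane =>
    heat z.1.1 z.2 * (φ z.1.2 - φ (z.1.2 - z.2)) := by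
  have h1 : Measurable fun z : (ℝ × Plane) × Plane => heat z.1.1 z.2 :=
    measurable_heat.comp ((measurable_fst.comp measurable_fst).prodMk measurable_snd)
  exact h1.mul (Continuous.measurable (by fun_prop))

theorem measurable_heatDiff (hφ : Continuous φ) : Measurable (Function.uncurry (heatDiff φ)) :=
  (measurable_heatDiff_integrand hφ).stronglyMeasurable.integral_prod_right'.measurable

/-- The difference costs at most `2 ‖φ‖₁`, and also at most the gradient of `φ` times the first
moment of the heat kernel, which is of order `√t`. The minimum of these rates is integrable against
`t ^ (-1 - β/2)`. -/
theorem lintegral_heatDiff_le (hφ : ContDiff ℝ 1 φ) {t : ℝ} (ht : 0 < t) :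
    ∫⁻ x, ‖heatDiff φ t x‖ₑ ≤ (2 * (∫⁻ x, ‖φ x‖ₑ) + heatMoment * ∫⁻ x, ‖fderiv ℝ φ x‖ₑ) *
      ENNReal.ofReal (Real.sqrt t * decay t) := by
  have hst := Real.sqrt_pos.2 ht
  have hcont := hφ.continuous
  have hh := continuous_heat t
  have hm : Measurable fun z : Plane × Plane => ‖heat t z.2 * (φ z.1 - φ (z.1 - z.2))‖ₑ :=
    Continuous.measurable (by fun_prop)
  have hφm : ∀ y : Plane, Measurable fun x => ‖φ x - φ (x - y)‖ₑ := fun y =>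
    Continuous.measurable (by fun_prop)
  have e : ∫⁻ x, ‖heatDiff φ t x‖ₑ ≤ ∫⁻ y, ‖heat t y‖ₑ * ∫⁻ x, ‖φ x - φ (x - y)‖ₑ := by
    calc _ ≤ ∫⁻ x, ∫⁻ y, ‖heat t y * (φ x - φ (x - y))‖ₑ :=
          lintegral_mono fun x => enorm_integral_le_lintegral_enorm _
      _ = ∫⁻ y, ∫⁻ x, ‖heat t y * (φ x - φ (x - y))‖ₑ := lintegral_lintegral_swap hm.aemeasurable
      _ = _ := by
          refine lintegral_congr fun y => ?_
          simp only [enorm_mul]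
          rw [lintegral_const_mul _ (hφm y)]
  have h1 : ∫⁻ y, ‖heat t y‖ₑ * ∫⁻ x, ‖φ x - φ (x - y)‖ₑ ≤ 2 * ∫⁻ x, ‖φ x‖ₑ := by
    have : ∀ y : Plane, ∫⁻ x, ‖φ x - φ (x - y)‖ₑ ≤ 2 * ∫⁻ x, ‖φ x‖ₑ := fun y => by
      calc _ ≤ ∫⁻ x, (‖φ x‖ₑ + ‖φ (x - y)‖ₑ) := lintegral_mono fun x => enorm_sub_le
        _ = _ := by
          rw [lintegral_add_left hcont.enorm.measurable,
            lintegral_sub_right_eq_self (fun x => ‖φ x‖ₑ), two_mul]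
    calc _ ≤ ∫⁻ y, ‖heat t y‖ₑ * (2 * ∫⁻ x, ‖φ x‖ₑ) :=
          lintegral_mono fun y => mul_le_mul' le_rfl (this y)
      _ = _ := by rw [lintegral_mul_const _ hh.enorm.measurable, lintegral_heat ht, one_mul]
  have h2 : ∫⁻ y, ‖heat t y‖ₑ * ∫⁻ x, ‖φ x - φ (x - y)‖ₑ ≤
      heatMoment * (∫⁻ x, ‖fderiv ℝ φ x‖ₑ) * ENNReal.ofReal (Real.sqrt t) := by
    have hm2 : Measurable fun y : Plane => ‖heat t y‖ₑ * ‖y‖ₑ :=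
      hh.enorm.measurable.mul measurable_enorm
    calc _ ≤ ∫⁻ y, ‖heat t y‖ₑ * ‖y‖ₑ * ∫⁻ x, ‖fderiv ℝ φ x‖ₑ := lintegral_mono fun y => by
          rw [mul_assoc]
          exact mul_le_mul' le_rfl (lintegral_enorm_sub_translate_le hφ y)
      _ = _ := by rw [lintegral_mul_const _ hm2, lintegral_heat_mul_norm ht]; ring
  refine e.trans ?_
  rw [decay, mul_min_of_nonneg _ _ hst.le, mul_one, mul_inv_cancel₀ hst.ne', ENNReal.ofReal_min,
    mul_min, ENNReal.ofReal_one, mul_one]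
  exact le_min (h2.trans (by gcongr; exact le_add_self)) (h1.trans le_self_add)

/-- The subordination formula for the fractional Laplacian of a test function. -/
theorem fracConst_mul_fracLapTest (h0 : 0 < β) (h1 : β < 1) (hφ : ContDiff ℝ ∞ φ)
    (hc : HasCompactSupport φ) (x : Plane) :
    fracConst β * fracLapTest β φ x = ∫ t in Ioi (0 : ℝ), t ^ (-1 - β / 2) * heatDiff φ t x := by
  have hcont := continuous_testHat hφ hc
  set b : ℝ → Plane → ℂ := fun t ξ =>
    ((t ^ (-1 - β / 2) * (1 - Real.exp (-((2 * Real.pi * ‖ξ‖) ^ 2 * t))) : ℝ) : ℂ) * testHat φ ξ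
    with hbdef
  have hn : ∀ ξ : Plane, 0 ≤ 2 * Real.pi * ‖ξ‖ := fun ξ => by have := Real.pi_pos; positivity
  have hpos : ∀ ξ : Plane, ∀ t ∈ Ioi (0 : ℝ),
      0 ≤ t ^ (-1 - β / 2) * (1 - Real.exp (-((2 * Real.pi * ‖ξ‖) ^ 2 * t))) := fun ξ t ht => by
    have ht0 : 0 < t := ht
    have : Real.exp (-((2 * Real.pi * ‖ξ‖) ^ 2 * t)) ≤ 1 :=
      Real.exp_le_one_iff.2 (neg_nonpos.2 (by positivity))
    have := Real.rpow_nonneg ht0.le (-1 - β / 2)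
    exact mul_nonneg this (by linarith)
  have hbm : AEStronglyMeasurable (Function.uncurry b)
      ((volume.restrict (Ioi (0 : ℝ))).prod volume) := by
    have h2 : Measurable fun z : ℝ × Plane =>
        ((z.1 ^ (-1 - β / 2) * (1 - Real.exp (-((2 * Real.pi * ‖z.2‖) ^ 2 * z.1))) : ℝ) : ℂ) := by
      fun_prop
    have h3 : Measurable fun z : ℝ × Plane => testHat φ z.2 := hcont.measurable.comp measurable_snd
    exact (h2.mul h3).aestronglyMeasurable
  -- The time weight is non-negative, so the subordination formula computes the integral of the norm
  -- exactly and Fubini's hypothesis reduces to the integrability of `‖ξ‖^β φ̂`.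
  have hb : Integrable (Function.uncurry b) ((volume.restrict (Ioi (0 : ℝ))).prod volume) := by
    rw [integrable_prod_iff' hbm]
    refine ⟨Eventually.of_forall fun ξ =>
      (integrableOn_subordination h0 h1 (hn ξ)).ofReal.mul_const (testHat φ ξ), ?_⟩
    have e : ∀ ξ : Plane, ∫ t in Ioi (0 : ℝ), ‖Function.uncurry b (t, ξ)‖ =
        fracConst β * ‖(((2 * Real.pi * ‖ξ‖) ^ β : ℝ) : ℂ) * testHat φ ξ‖ := by
      intro ξ
      have e2 : ∀ t ∈ Ioi (0 : ℝ), ‖Function.uncurry b (t, ξ)‖ =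
          t ^ (-1 - β / 2) * (1 - Real.exp (-((2 * Real.pi * ‖ξ‖) ^ 2 * t))) * ‖testHat φ ξ‖ := by
        intro t ht
        rw [Function.uncurry, hbdef, norm_mul, Complex.norm_real,
          Real.norm_of_nonneg (hpos ξ t ht)]
      rw [setIntegral_congr_fun measurableSet_Ioi e2, integral_mul_const,
        integral_subordination h0 (hn ξ), norm_mul, Complex.norm_real,
        Real.norm_of_nonneg (Real.rpow_nonneg (hn ξ) _)]
      ring
    simp only [e]
    exact (integrable_fracSymbol_mul h0 h1 hφ hc).norm.const_mul _
  have key := integral_fourierInv hb x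
  have e3 : ∀ t ∈ Ioi (0 : ℝ), 𝓕⁻ (b t) x = ((t ^ (-1 - β / 2) * heatDiff φ t x : ℝ) : ℂ) := by
    intro t ht
    rw [Complex.ofReal_mul, ofReal_heatDiff hφ hc ht, fourierInv_eq_integral,
      fourierInv_eq_integral, ← integral_const_mul]
    refine integral_congr_ae (Eventually.of_forall fun ξ => ?_)
    simp only [hbdef]
    push_cast
    ring
  have e4 : (fun ξ => ∫ t in Ioi (0 : ℝ), b t ξ) = fun ξ =>
      (fracConst β : ℂ) * ((((2 * Real.pi * ‖ξ‖) ^ β : ℝ) : ℂ) * testHat φ ξ) := by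
    funext ξ
    simp only [hbdef]
    rw [integral_mul_const, integral_complex_ofReal, integral_subordination h0 (hn ξ)]
    push_cast
    ring
  rw [setIntegral_congr_fun measurableSet_Ioi e3, integral_complex_ofReal, e4] at key
  have e5 : 𝓕⁻ (fun ξ => (fracConst β : ℂ) *
      ((((2 * Real.pi * ‖ξ‖) ^ β : ℝ) : ℂ) * testHat φ ξ)) x = (fracConst β : ℂ) *
      𝓕⁻ (fun ξ : Plane => (((2 * Real.pi * ‖ξ‖) ^ β : ℝ) : ℂ) * testHat φ ξ) x := by
    rw [fourierInv_eq_integral, fourierInv_eq_integral, ← integral_const_mul]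
    exact integral_congr_ae (Eventually.of_forall fun ξ => mul_left_comm _ _ _)
  rw [e5] at key
  rw [fracLapTest_eq, ← Complex.re_ofReal_mul, ← key, Complex.ofReal_re]

/-- The `L¹` bound for the heat differences is integrated in the subordination formula. Together
with boundedness this puts `Λ^β φ` in `L^{p'}`, where it can be paired with `w ∈ Lᵖ` under
convolutions. -/
theorem integrable_fracLapTest (h0 : 0 < β) (h1 : β < 1) (hφ : ContDiff ℝ ∞ φ)
    (hc : HasCompactSupport φ) : Integrable (fracLapTest β φ) := by
  have hI := fracConst_pos h0 h1
  refine ⟨(continuous_fracLapTest h0 h1 hφ hc).aestronglyMeasurable, ?_⟩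
  have hm := measurable_heatDiff hφ.continuous
  have hm2 : Measurable fun z : Plane × ℝ => ‖z.2 ^ (-1 - β / 2) * heatDiff φ z.2 z.1‖ₑ :=
    ((measurable_snd.pow_const _).mul (hm.comp measurable_swap)).enorm
  have hm3 : ∀ t, Measurable fun x => ‖heatDiff φ t x‖ₑ := fun t =>
    (hm.comp (measurable_const.prodMk measurable_id)).enorm
  have e : ∀ x, ‖fracLapTest β φ x‖ₑ ≤ ‖(fracConst β)⁻¹‖ₑ *
      ∫⁻ t in Ioi (0 : ℝ), ‖t ^ (-1 - β / 2) * heatDiff φ t x‖ₑ := by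
    intro x
    rw [← inv_mul_cancel_left₀ hI.ne' (fracLapTest β φ x), fracConst_mul_fracLapTest h0 h1 hφ hc,
      enorm_mul]
    gcongr
    exact enorm_integral_le_lintegral_enorm _
  set N := 2 * (∫⁻ x, ‖φ x‖ₑ) + heatMoment * ∫⁻ x, ‖fderiv ℝ φ x‖ₑ with hN
  have hNt : N ≠ ⊤ := by
    have i1 : ∫⁻ x, ‖φ x‖ₑ ≠ ⊤ := (hφ.continuous.integrable_of_hasCompactSupport hc).2.ne
    have i2 : ∫⁻ x, ‖fderiv ℝ φ x‖ₑ ≠ ⊤ := ((hφ.continuous_fderiv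
      (by simp)).integrable_of_hasCompactSupport (hc.fderiv ℝ)).2.ne
    have i3 := heatMoment_ne_top
    rw [hN]
    finiteness
  have hb : ∀ t ∈ Ioi (0 : ℝ), ∫⁻ x, ‖t ^ (-1 - β / 2) * heatDiff φ t x‖ₑ ≤
      N * ENNReal.ofReal (t ^ ((1 - β) / 2 - 1) * decay t) := by
    intro t ht
    have ht0 : 0 ≤ t ^ (-1 - β / 2) := Real.rpow_nonneg (le_of_lt ht) _
    simp only [enorm_mul]
    rw [lintegral_const_mul _ (hm3 t), Real.enorm_eq_ofReal ht0, ← rpow_mul_sqrt ht, mul_assoc,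
      ENNReal.ofReal_mul ht0, mul_left_comm]
    exact mul_le_mul' le_rfl (lintegral_heatDiff_le (hφ.of_le (by simp)) ht)
  calc ∫⁻ x, ‖fracLapTest β φ x‖ₑ
      ≤ ∫⁻ x, ‖(fracConst β)⁻¹‖ₑ * ∫⁻ t in Ioi (0 : ℝ), ‖t ^ (-1 - β / 2) * heatDiff φ t x‖ₑ :=
        lintegral_mono e
    _ = ‖(fracConst β)⁻¹‖ₑ * ∫⁻ x, ∫⁻ t in Ioi (0 : ℝ), ‖t ^ (-1 - β / 2) * heatDiff φ t x‖ₑ :=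
        lintegral_const_mul' _ _ enorm_ne_top
    _ = ‖(fracConst β)⁻¹‖ₑ * ∫⁻ t in Ioi (0 : ℝ), ∫⁻ x, ‖t ^ (-1 - β / 2) * heatDiff φ t x‖ₑ := by
        rw [lintegral_lintegral_swap hm2.aemeasurable]
    _ ≤ ‖(fracConst β)⁻¹‖ₑ * (N * scaleMass ((1 - β) / 2)) := by
        gcongr
        rw [scaleMass, ← lintegral_const_mul' _ _ hNt]
        exact setLIntegral_mono' measurableSet_Ioi hb
    _ < ⊤ := ENNReal.mul_lt_top enorm_lt_top (ENNReal.mul_lt_top hNt.lt_top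
        (scaleMass_ne_top (by linarith) (by linarith)).lt_top)

end FracLap

/-! ### Elementary facts on `Lᵖ` norms. -/

section LpNorm

variable {p : ℝ} {f g : Plane → ℝ}

theorem lpNorm_eq_lintegral (hp : 0 < p) (f : Plane → ℝ) :
    lpNorm p f = (∫⁻ x, ‖f x‖ₑ ^ p) ^ (1 / p) := by
  rw [lpNorm, eLpNorm_eq_lintegral_rpow_enorm_toReal (by simpa using hp) ENNReal.ofReal_ne_top,
    ENNReal.toReal_ofReal hp.le]

theorem integrable_mul_of_holder {p' : ℝ} (h : p.HolderConjugate p')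
    (hf : MemLp f (ENNReal.ofReal p)) (hg : MemLp g (ENNReal.ofReal p')) :
    Integrable fun x => f x * g x := by
  have := h.ennrealOfReal
  exact hf.integrable_mul hg

theorem memLp_of_integrable_of_bounded (hp : 1 ≤ p) (hf : Integrable f) {S : ℝ}
    (hS : ∀ x, ‖f x‖ ≤ S) : MemLp f (ENNReal.ofReal p) := by
  have hp0 : 0 < p := by linarith
  refine ⟨hf.1, ?_⟩
  change lpNorm p f < ⊤
  rw [lpNorm_eq_lintegral hp0]
  refine ENNReal.rpow_lt_top_of_nonneg (by positivity) (ne_of_lt ?_)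
  calc ∫⁻ x, ‖f x‖ₑ ^ p ≤ ∫⁻ x, ENNReal.ofReal S ^ (p - 1) * ‖f x‖ₑ := lintegral_mono fun x => by
        have h1 : ‖f x‖ₑ ≤ ENNReal.ofReal S := by
          rw [← ofReal_norm]; exact ENNReal.ofReal_le_ofReal (hS x)
        calc ‖f x‖ₑ ^ p = ‖f x‖ₑ ^ (p - 1) * ‖f x‖ₑ := by
              conv_rhs => rw [← ENNReal.rpow_one ‖f x‖ₑ, ← ENNReal.rpow_mul, one_mul]
              rw [← ENNReal.rpow_add_of_nonneg _ _ (by linarith) zero_le_one, sub_add_cancel]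
          _ ≤ _ := by gcongr
    _ = ENNReal.ofReal S ^ (p - 1) * ∫⁻ x, ‖f x‖ₑ := lintegral_const_mul' _ _
        (ENNReal.rpow_ne_top_of_nonneg (by linarith) ENNReal.ofReal_ne_top)
    _ < ⊤ := ENNReal.mul_lt_top
        (ENNReal.rpow_lt_top_of_nonneg (by linarith) ENNReal.ofReal_ne_top) hf.2

end LpNorm

/-! ### Convolution operators on `Lᵖ` and their adjoints. -/

section Conv

variable {k f g : Plane → ℝ} {p p' r : ℝ}

/-- The convolution of two functions on the plane. -/
def conv (k f : Plane → ℝ) (x : Plane) : ℝ := ∫ y, k y * f (x - y)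

theorem ae_eq_comp_sub_left {f' : Plane → ℝ} (h : f =ᵐ[volume] f') (x : Plane) :
    (fun y => f (x - y)) =ᵐ[volume] fun y => f' (x - y) :=
  (quasiMeasurePreserving_sub_left_of_right_invariant volume x).ae_eq_comp h

theorem conv_congr {f' : Plane → ℝ} (h : f =ᵐ[volume] f') : conv k f = conv k f' := by
  funext x
  refine integral_congr_ae ?_
  filter_upwards [ae_eq_comp_sub_left h x] with y hy
  rw [hy]

theorem measurable_conv (hk : Measurable k) (hf : Measurable f) : Measurable (conv k f) := by
  have h : Measurable fun z : Plane × Plane => k z.2 * f (z.1 - z.2) :=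
    (hk.comp measurable_snd).mul (hf.comp (measurable_fst.sub measurable_snd))
  exact h.stronglyMeasurable.integral_prod_right'.measurable

/-- Transfers the kernel estimates, which concern non-negative measurable functions, to real
functions that are only almost everywhere measurable. `conv` depends only on the class of `f`, so a
measurable representative may be used. -/
theorem lpNorm_conv_le (hp : 0 < p) (hr : 0 < r) {N : ℝ≥0∞}
    (h : ∀ F : Plane → ℝ≥0∞, Measurable F →
      ∫⁻ x, (∫⁻ y, ‖k y‖ₑ * F (x - y)) ^ r ≤ N ^ r * (∫⁻ x, F x ^ p) ^ (r / p))
    (hf : AEStronglyMeasurable f volume) :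
    lpNorm r (conv k f) ≤ N * lpNorm p f := by
  have hf' : f =ᵐ[volume] hf.mk f := hf.ae_eq_mk
  have e : lpNorm p f = lpNorm p (hf.mk f) := eLpNorm_congr_ae hf'
  rw [conv_congr hf', e, lpNorm_eq_lintegral hr, lpNorm_eq_lintegral hp]
  have h1 := h (fun x => ‖hf.mk f x‖ₑ) hf.stronglyMeasurable_mk.measurable.enorm
  have h2 : ∫⁻ x, ‖conv k (hf.mk f) x‖ₑ ^ r ≤
      ∫⁻ x, (∫⁻ y, ‖k y‖ₑ * ‖hf.mk f (x - y)‖ₑ) ^ r := lintegral_mono fun x => by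
    refine ENNReal.rpow_le_rpow ((enorm_integral_le_lintegral_enorm _).trans_eq ?_) hr.le
    simp only [enorm_mul]
  calc _ ≤ (N ^ r * (∫⁻ x, ‖hf.mk f x‖ₑ ^ p) ^ (r / p)) ^ (1 / r) :=
        ENNReal.rpow_le_rpow (h2.trans h1) (by positivity)
    _ = _ := by
        rw [ENNReal.mul_rpow_of_nonneg _ _ (by positivity), ← ENNReal.rpow_mul, ← ENNReal.rpow_mul,
          mul_one_div_cancel hr.ne', ENNReal.rpow_one]
        congr 2
        field_simp

theorem aestronglyMeasurable_conv (hk : Measurable k) (hf : AEStronglyMeasurable f volume) :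
    AEStronglyMeasurable (conv k f) volume := by
  rw [conv_congr hf.ae_eq_mk]
  exact (measurable_conv hk hf.stronglyMeasurable_mk.measurable).aestronglyMeasurable

theorem memLp_conv (hk : Measurable k) (hki : Integrable k) (hp : 1 ≤ p)
    (hf : MemLp f (ENNReal.ofReal p)) : MemLp (conv k f) (ENNReal.ofReal p) := by
  have hp0 : 0 < p := by linarith
  refine ⟨aestronglyMeasurable_conv hk hf.1, ?_⟩
  refine (lpNorm_conv_le (p := p) hp0 hp0 (N := ∫⁻ y, ‖k y‖ₑ) (fun F hF => ?_) hf.1).trans_lt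
    (ENNReal.mul_lt_top hki.2 hf.2)
  rw [div_self hp0.ne', ENNReal.rpow_one]
  exact lintegral_rpow_conv_le hp hk.enorm hF

/-- Fubini's theorem, arranged so that for each `y` there remains a pairing with a translate. Weak
identities can be applied to these inner pairings. -/
theorem integral_conv_mul (h : p.HolderConjugate p') (hk : Measurable k) (hki : Integrable k)
    (hf : MemLp f (ENNReal.ofReal p)) (hg : MemLp g (ENNReal.ofReal p')) :
    ∫ x, conv k f x * g x = ∫ y, k y * ∫ x, f (x - y) * g x := by
  wlog hmeas : Measurable f ∧ Measurable g generalizing f g with H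
  · have hf' := hf.1.ae_eq_mk
    have hg' := hg.1.ae_eq_mk
    have key := H (hf.ae_eq hf') (hg.ae_eq hg') ⟨hf.1.stronglyMeasurable_mk.measurable,
      hg.1.stronglyMeasurable_mk.measurable⟩
    have e : ∫ x, conv k (hf.1.mk f) x * g x = ∫ x, conv k (hf.1.mk f) x * hg.1.mk g x :=
      integral_congr_ae (hg'.mono fun x hx => by simp only [hx])
    rw [conv_congr hf', e, key]
    refine integral_congr_ae (Eventually.of_forall fun y => ?_)
    simp only
    congr 1
    refine integral_congr_ae ?_
    have h2 : (fun x => f (x - y)) =ᵐ[volume] fun x => hf.1.mk f (x - y) :=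
      (measurePreserving_sub_right volume y).quasiMeasurePreserving.ae_eq_comp hf'
    filter_upwards [h2, hg'] with x h3 h4
    rw [h3, h4]
  obtain ⟨hfm, hgm⟩ := hmeas
  have hm : Measurable fun z : Plane × Plane => k z.2 * f (z.1 - z.2) * g z.1 :=
    ((hk.comp measurable_snd).mul (hfm.comp (measurable_fst.sub measurable_snd))).mul
      (hgm.comp measurable_fst)
  have hi : Integrable (Function.uncurry fun x y => k y * f (x - y) * g x)
      ((volume : Measure Plane).prod (volume : Measure Plane)) := by
    refine ⟨hm.aestronglyMeasurable, ?_⟩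
    have e := lintegral_prod_symm (μ := (volume : Measure Plane)) (ν := (volume : Measure Plane)) _
      hm.enorm.aemeasurable
    rw [hasFiniteIntegral_iff_enorm]
    refine e.trans_lt ?_
    have hb : ∀ y, ∫⁻ x, ‖k y * f (x - y) * g x‖ₑ ≤ ‖k y‖ₑ * (lpNorm p f * lpNorm p' g) := by
      intro y
      have hfy : Measurable fun x => ‖f (x - y)‖ₑ :=
        (hfm.comp (measurable_id.sub measurable_const)).enorm
      have hfg : Measurable fun x => ‖f (x - y)‖ₑ * ‖g x‖ₑ := hfy.mul hgm.enorm
      simp only [enorm_mul, mul_assoc]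
      rw [lintegral_const_mul _ hfg]
      refine mul_le_mul' le_rfl
        ((ENNReal.lintegral_mul_le_Lp_mul_Lq volume h hfy.aemeasurable
          hgm.enorm.aemeasurable).trans_eq ?_)
      rw [lintegral_sub_right_eq_self (fun x => ‖f x‖ₑ ^ p), lpNorm_eq_lintegral h.pos,
        lpNorm_eq_lintegral h.symm.pos]
    refine (lintegral_mono hb).trans_lt ?_
    rw [lintegral_mul_const _ hk.enorm]
    exact ENNReal.mul_lt_top hki.2 (ENNReal.mul_lt_top hf.2 hg.2)
  calc ∫ x, conv k f x * g x = ∫ x, ∫ y, k y * f (x - y) * g x := by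
        simp only [conv, integral_mul_const]
    _ = ∫ y, ∫ x, k y * f (x - y) * g x := integral_integral_swap hi
    _ = _ := by simp only [mul_assoc, integral_const_mul]

/-- Convolution with an even kernel is symmetric. -/
theorem integral_conv_mul_comm (h : p.HolderConjugate p') (hk : Measurable k) (hki : Integrable k)
    (hke : ∀ y, k (-y) = k y) (hf : MemLp f (ENNReal.ofReal p))
    (hg : MemLp g (ENNReal.ofReal p')) :
    ∫ x, conv k f x * g x = ∫ x, f x * conv k g x := by
  rw [integral_conv_mul h hk hki hf hg, ← integral_neg_eq_self]
  simp only [mul_comm (f _) (conv k g _)]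
  rw [integral_conv_mul h.symm hk hki hg hf]
  refine integral_congr_ae (Eventually.of_forall fun y => ?_)
  simp only [hke]
  congr 1
  rw [← integral_sub_right_eq_self (fun x => f (x - -y) * g x) y]
  simp only [sub_neg_eq_add, sub_add_cancel, mul_comm]

theorem integral_sub_mul_eq (y : Plane) :
    ∫ x, f (x - y) * g x = ∫ x, f x * g (x + y) := by
  rw [← integral_sub_right_eq_self (fun x => f x * g (x + y)) y]
  simp only [sub_add_cancel]

end Conv

/-! ### Recovering the high frequencies of `w` from `Λ^β w`. -/

section FracLapDuality

variable {β : ℝ} {φ : Plane → ℝ} (χ : Cutoff) (J : ℝ)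

theorem contDiff_translate (hφ : ContDiff ℝ ∞ φ) (y : Plane) :
    ContDiff ℝ ∞ fun x => φ (x + y) := hφ.comp (contDiff_id.add contDiff_const)

theorem hasCompactSupport_translate (hc : HasCompactSupport φ) (y : Plane) :
    HasCompactSupport fun x => φ (x + y) :=
  hc.comp_homeomorph (Homeomorph.addRight y)

/-- The fractional Laplacian commutes with translations. -/
theorem fracLapTest_translate (y x : Plane) :
    fracLapTest β (fun z => φ (z + y)) x = fracLapTest β φ (x + y) := by
  have h : ∀ ξ, testHat (fun z => φ (z + y)) ξ = ex (inner ℝ ξ y) * testHat φ ξ := by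
    intro ξ
    simp only [testHat, fourier_eq_integral]
    rw [← integral_sub_right_eq_self _ y, ← integral_const_mul]
    refine integral_congr_ae (Eventually.of_forall fun z => ?_)
    simp only [sub_add_cancel]
    rw [← mul_assoc, ← ex_add, inner_sub_left, real_inner_comm ξ y]
    congr 2
    ring
  simp only [fracLapTest_eq, fourierInv_eq_integral]
  congr 1
  refine integral_congr_ae (Eventually.of_forall fun ξ => ?_)
  simp only [h]
  rw [inner_add_right, ex_add]
  ring

/-- `highKernel` inverts the fractional Laplacian on high frequencies. -/
theorem conv_highKernel_fracLapTest (h0 : 0 < β) (h1 : β < 1) (hφ : ContDiff ℝ ∞ φ)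
    (hc : HasCompactSupport φ) (x : Plane) :
    conv (highKernel χ J β) (fracLapTest β φ) x = φ x - conv (lowKernel χ J) φ x := by
  have hψ := integrable_testHat hφ hc
  have hK : Integrable fun y => (highKernel χ J β y : ℂ) := (integrable_highKernel χ J h0 h1).ofReal
  have hk : Integrable fun y => (lowKernel χ J y : ℂ) := (integrable_lowKernel χ J).ofReal
  have a1 := integral_mul_fourierInv_sub hK measurable_id (integrable_fracSymbol_mul h0 h1 hφ hc) x
  have a2 := integral_mul_fourierInv_sub hk measurable_id hψ x
  simp only [id, ← mul_assoc, fourier_highKernel χ J h0 h1] at a1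
  simp only [id, fourierInv_testHat hφ hc, fourier_lowKernel] at a2
  have hl : Integrable fun ξ => (lowSymbol χ J ξ : ℂ) * testHat φ ξ := by
    obtain ⟨S, hS⟩ : ∃ S, ∀ ξ, ‖testHat φ ξ‖ ≤ S :=
      ⟨∫ y, ‖(φ y : ℂ)‖, fun ξ => by
        rw [testHat, fourier_eq_integral]
        exact (norm_integral_le_integral_norm _).trans_eq (by simp)⟩
    exact (integrable_lowSymbol χ J).mul_bdd (continuous_testHat hφ hc).aestronglyMeasurable
      (Eventually.of_forall hS)
  have e : 𝓕⁻ (fun ξ => ((1 - lowSymbol χ J ξ : ℝ) : ℂ) * testHat φ ξ) x =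
      φ x - 𝓕⁻ (fun ξ => (lowSymbol χ J ξ : ℂ) * testHat φ ξ) x := by
    rw [← fourierInv_testHat hφ hc x]
    simp only [fourierInv_eq_integral]
    rw [← integral_sub]
    · refine integral_congr_ae (Eventually.of_forall fun ξ => ?_)
      simp only
      push_cast
      ring
    · exact hψ.bdd_mul (c := 1) (Continuous.aestronglyMeasurable (by fun_prop))
        (Eventually.of_forall fun ξ => by simp)
    · exact hl.bdd_mul (c := 1) (Continuous.aestronglyMeasurable (by fun_prop))
        (Eventually.of_forall fun ξ => by simp)
  rw [e, ← a2] at a1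
  have e1 : ∀ y, ((highKernel χ J β y : ℂ) * 𝓕⁻ (fun ξ : Plane =>
      (((2 * Real.pi * ‖ξ‖) ^ β : ℝ) : ℂ) * testHat φ ξ) (x - y)).re =
      highKernel χ J β y * fracLapTest β φ (x - y) := fun y => by
    rw [Complex.re_ofReal_mul, fracLapTest_eq]
  have b1 := congrArg Complex.re a1
  have hint : Integrable fun y => (highKernel χ J β y : ℂ) * 𝓕⁻ (fun ξ : Plane =>
      (((2 * Real.pi * ‖ξ‖) ^ β : ℝ) : ℂ) * testHat φ ξ) (x - y) := by
    refine hK.mul_bdd ?_ (Eventually.of_forall fun y => norm_fourierInv_le _)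
    exact ((continuous_fourierInv (integrable_fracSymbol_mul h0 h1 hφ hc)).comp
      (continuous_const.sub continuous_id)).aestronglyMeasurable
  have b2 := integral_re hint
  simp only [RCLike.re_to_complex, e1] at b2
  rw [conv, b2, b1, Complex.sub_re, Complex.ofReal_re]
  congr 1
  have e2 : ∀ y, (lowKernel χ J y : ℂ) * (φ (x - y) : ℂ) =
      ((lowKernel χ J y * φ (x - y) : ℝ) : ℂ) := fun y => by push_cast; rfl
  simp only [e2]
  rw [integral_complex_ofReal, Complex.ofReal_re, conv]

theorem lowFreq_eq_conv (f : Plane → ℝ) : lowFreq χ J f = conv (lowKernel χ J) f := by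
  funext x
  rw [lowFreq, conv, ← integral_sub_left_eq_self _ volume x]
  simp only [sub_sub_cancel]

/-- The high frequencies of `w` are recovered from `Λ^β w`. -/
theorem highFreq_ae_eq {p : ℝ} (hp : 1 < p) (h0 : 0 < β) (h1 : β < 1) {w V : Plane → ℝ}
    (hwV : IsFracLap β w V) (hw : MemLp w (ENNReal.ofReal p)) (hV : MemLp V (ENNReal.ofReal p)) :
    highFreq χ J w =ᵐ[volume] conv (highKernel χ J β) V := by
  have hc := Real.HolderConjugate.conjExponent hp
  set p' := p.conjExponent
  have hp1 : (1 : ℝ≥0∞) ≤ ENNReal.ofReal p := by simpa using ENNReal.ofReal_le_ofReal hp.le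
  have hkm := (continuous_lowKernel χ J).measurable
  have hki := integrable_lowKernel χ J
  have hKm := measurable_highKernel χ J β
  have hKi := integrable_highKernel χ J h0 h1
  have hlow : MemLp (conv (lowKernel χ J) w) (ENNReal.ofReal p) := memLp_conv hkm hki hp.le hw
  have hhigh : MemLp (conv (highKernel χ J β) V) (ENNReal.ofReal p) := memLp_conv hKm hKi hp.le hV
  have hf : highFreq χ J w = w - conv (lowKernel χ J) w := by
    funext x; rw [highFreq, lowFreq_eq_conv]; rfl
  rw [hf]
  refine ae_eq_of_integral_contDiff_smul_eq ((hw.sub hlow).locallyIntegrable hp1)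
    (hhigh.locallyIntegrable hp1) fun φ hφ hφc => ?_
  have hφL : MemLp φ (ENNReal.ofReal p') := hφ.continuous.memLp_of_hasCompactSupport hφc
  obtain ⟨S, hS⟩ := exists_fracLapTest_le (β := β) (φ := φ)
  have hΛ : MemLp (fracLapTest β φ) (ENNReal.ofReal p') :=
    memLp_of_integrable_of_bounded hc.symm.lt.le (integrable_fracLapTest h0 h1 hφ hφc) hS
  have hlowφ : MemLp (conv (lowKernel χ J) φ) (ENNReal.ofReal p') :=
    memLp_conv hkm hki hc.symm.lt.le hφL
  -- The convolution of `φ` with the high kernel need not have compact support. The weak identity is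
  -- therefore applied to each translate of `φ`, and the result is integrated against the kernel.
  have key : ∫ x, conv (highKernel χ J β) V x * φ x =
      ∫ x, conv (highKernel χ J β) w x * fracLapTest β φ x := by
    rw [integral_conv_mul hc hKm hKi hV hφL, integral_conv_mul hc hKm hKi hw hΛ]
    refine integral_congr_ae (Eventually.of_forall fun y => ?_)
    simp only
    rw [integral_sub_mul_eq, integral_sub_mul_eq]
    congr 1
    have hd := hwV.duality (mkTest _ (contDiff_translate hφ y) (hasCompactSupport_translate hφc y))
    change ∫ x, V x * φ (x + y) = ∫ x, w x * fracLapTest β (fun z => φ (z + y)) x at hd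
    simp only [hd, fracLapTest_translate]
  calc ∫ x, φ x • (w - conv (lowKernel χ J) w) x
      = ∫ x, (w x * φ x - conv (lowKernel χ J) w x * φ x) := by
        refine integral_congr_ae (Eventually.of_forall fun x => ?_)
        simp only [smul_eq_mul, Pi.sub_apply]; ring
    _ = (∫ x, w x * φ x) - ∫ x, w x * conv (lowKernel χ J) φ x := by
        rw [integral_sub (integrable_mul_of_holder hc hw hφL)
          (integrable_mul_of_holder hc hlow hφL),
          integral_conv_mul_comm hc hkm hki (lowKernel_neg χ J) hw hφL]
    _ = ∫ x, w x * conv (highKernel χ J β) (fracLapTest β φ) x := by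
        rw [← integral_sub (integrable_mul_of_holder hc hw hφL)
          (integrable_mul_of_holder hc hw hlowφ)]
        simp only [conv_highKernel_fracLapTest χ J h0 h1 hφ hφc, mul_sub]
    _ = ∫ x, conv (highKernel χ J β) w x * fracLapTest β φ x :=
        (integral_conv_mul_comm hc hKm hKi (highKernel_neg χ J) hw hΛ).symm
    _ = ∫ x, φ x • conv (highKernel χ J β) V x := by
        rw [← key]; simp only [smul_eq_mul, mul_comm]

end FracLapDuality

/-! ### Gronwall's inequality. -/

section Gronwall

/-- Gronwall's inequality for absolutely continuous functions. -/
theorem gronwall_of_absolutelyContinuous {y : ℝ → ℝ} {a b E : ℝ} (hab : a < b)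
    (hy : AbsolutelyContinuousOnInterval y a b)
    (h : ∀ᵐ t, t ∈ Ioo a b → deriv y t ≤ E * y t) :
    y b ≤ Real.exp (E * (b - a)) * y a := by
  set g : ℝ → ℝ := fun t => Real.exp (-(E * t)) with hg
  have hgd : ∀ t, HasDerivAt g (-E * g t) t := fun t => by
    have := ((hasDerivAt_id t).const_mul E).neg.exp
    simpa [hg, mul_comm] using this
  have hgc : ContDiff ℝ 1 g := by rw [hg]; fun_prop
  have hga : AbsolutelyContinuousOnInterval g a b := hgc.contDiffOn.absolutelyContinuousOnInterval
  have key := (hy.mul hga).integral_deriv_eq_sub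
  have hle : ∫ t in a..b, deriv (y * g) t ≤ 0 := by
    rw [intervalIntegral.integral_of_le hab.le, integral_Ioc_eq_integral_Ioo]
    refine setIntegral_nonpos_of_ae_restrict ?_
    refine (ae_restrict_iff' measurableSet_Ioo).2 ?_
    filter_upwards [h, hy.ae_differentiableAt] with t ht hd hmem
    have hdt := hd (Ioo_subset_Icc_self.trans Icc_subset_uIcc hmem)
    rw [(hdt.hasDerivAt.mul (hgd t)).deriv]
    have := ht hmem
    have hgt : 0 < g t := Real.exp_pos _
    have : (deriv y t - E * y t) * g t ≤ 0 := mul_nonpos_of_nonpos_of_nonneg (by linarith) hgt.le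
    simp only [Pi.zero_apply]
    linarith
  rw [key] at hle
  simp only [Pi.mul_apply, hg] at hle
  have h3 : y b = Real.exp (E * b) * (y b * Real.exp (-(E * b))) := by
    rw [mul_left_comm, ← Real.exp_add]; simp
  rw [h3]
  calc Real.exp (E * b) * (y b * Real.exp (-(E * b)))
      ≤ Real.exp (E * b) * (y a * Real.exp (-(E * a))) :=
        mul_le_mul_of_nonneg_left (by linarith) (Real.exp_pos _).le
    _ = _ := by rw [mul_left_comm, ← Real.exp_add, mul_comm]; congr 2; ring

end Gronwall

/-! ### Hölder's inequality for the transport term. -/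

section Transport

variable {p r : ℝ} {f g : Plane → ℝ}

theorem lpNorm_add_le (hp : 1 ≤ p) (hf : AEStronglyMeasurable f volume)
    (hg : AEStronglyMeasurable g volume) : lpNorm p (f + g) ≤ lpNorm p f + lpNorm p g :=
  eLpNorm_add_le hf hg (by simpa using ENNReal.ofReal_le_ofReal hp)

/-- The components of `R^⊥ w` are bounded in `Lʳ`. -/
theorem exists_perpRiesz_bound (hr : 1 < r) :
    ∃ C : ℝ≥0∞, C ≠ ⊤ ∧ ∀ (w : Plane → ℝ) (v : Plane → Plane), IsPerpRiesz w v →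
      AEMeasurable w volume → lpNorm r (fun x => |v x 0| + |v x 1|) ≤ C * lpNorm r w := by
  have hr0 : 0 < r := by linarith
  obtain ⟨C, hC, h⟩ := exists_isRiesz_bound hr
  refine ⟨2 * C ^ (1 / r), by finiteness, fun w v hv hw => ?_⟩
  have hb : ∀ j u, IsRiesz j w u → lpNorm r (fun x => |u x|) ≤ C ^ (1 / r) * lpNorm r w := by
    intro j u hu
    rw [lpNorm_eq_lintegral hr0, lpNorm_eq_lintegral hr0,
      ← ENNReal.mul_rpow_of_nonneg _ _ (by positivity)]
    refine ENNReal.rpow_le_rpow ?_ (by positivity)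
    simpa [← Real.norm_eq_abs] using h j w u hu hw
  have h0 := hb 1 _ hv.1
  have h1 := hb 0 _ hv.2
  simp only [abs_neg] at h0
  have m0 : AEStronglyMeasurable (fun x => |v x 0|) volume := by
    simpa using hv.1.target.aestronglyMeasurable.norm
  have m1 : AEStronglyMeasurable (fun x => |v x 1|) volume :=
    hv.2.target.aestronglyMeasurable.norm
  refine (lpNorm_add_le hr.le m0 m1).trans ((add_le_add h0 h1).trans_eq ?_)
  ring

theorem abs_inner_le (u G : Plane) : |inner ℝ u G| ≤ (|u 0| + |u 1|) * ‖G‖ := by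
  have h : ∀ i, |G i| ≤ ‖G‖ := fun i => PiLp.norm_apply_le G i
  rw [PiLp.inner_apply, Fin.sum_univ_two]
  simp only [RCLike.inner_apply, conj_trivial]
  refine (abs_add_le _ _).trans ?_
  rw [abs_mul, abs_mul, add_mul, mul_comm |G 0|, mul_comm |G 1|]
  gcongr
  · exact h 0
  · exact h 1

/-- Hölder's inequality with exponents `p`, `p / (p - 1)`. -/
theorem eLpNorm_mul_rpow_le {s : ℝ} (hp : 1 < p) (hs : 0 < s) (hf : AEMeasurable f volume)
    (hg : AEMeasurable g volume) :
    lpNorm s (fun x => f x * |g x| ^ (p - 1)) ≤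
      lpNorm (p * s) f * lpNorm (p * s) g ^ (p - 1) := by
  have hp0 : 0 < p := by linarith
  have hc := Real.HolderConjugate.conjExponent hp
  have hp' : p.conjExponent = p / (p - 1) := rfl
  have hp1 : 0 < p - 1 := by linarith
  have hps : 0 < p * s := by positivity
  rw [lpNorm_eq_lintegral hs, lpNorm_eq_lintegral hps, lpNorm_eq_lintegral hps]
  have h := ENNReal.lintegral_mul_le_Lp_mul_Lq volume hc (hf.enorm.pow_const s)
    (hg.enorm.pow_const ((p - 1) * s))
  have e1 : ∀ x, ‖f x * |g x| ^ (p - 1)‖ₑ ^ s =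
      ((fun x => ‖f x‖ₑ ^ s) * fun x => ‖g x‖ₑ ^ ((p - 1) * s)) x := by
    intro x
    rw [enorm_mul, ENNReal.mul_rpow_of_nonneg _ _ hs.le, Pi.mul_apply,
      Real.enorm_rpow_of_nonneg (abs_nonneg _) hp1.le, ← ENNReal.rpow_mul,
      ← Real.norm_eq_abs (g x), enorm_norm]
  have e2 : ∀ x, (‖f x‖ₑ ^ s) ^ p = ‖f x‖ₑ ^ (p * s) := fun x => by
    rw [← ENNReal.rpow_mul, mul_comm]
  have e3 : ∀ x, (‖g x‖ₑ ^ ((p - 1) * s)) ^ p.conjExponent = ‖g x‖ₑ ^ (p * s) := fun x => by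
    rw [← ENNReal.rpow_mul, hp']; congr 1; field_simp
  simp only [e2, e3] at h
  simp only [e1]
  refine (ENNReal.rpow_le_rpow h (by positivity)).trans_eq ?_
  rw [ENNReal.mul_rpow_of_nonneg _ _ (by positivity), ← ENNReal.rpow_mul, ← ENNReal.rpow_mul,
    ← ENNReal.rpow_mul, hp']
  congr 2 <;> field_simp

/-- The transport term in the energy inequality is controlled by `‖G‖_q ‖w‖_rᵖ`. -/
theorem exists_transport_bound {q : ℝ≥0∞} {s : ℝ} (hp : 1 < p) (hs : 1 ≤ s)
    (hqs : q.HolderConjugate (ENNReal.ofReal s)) :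
    ∃ C : ℝ≥0∞, C ≠ ⊤ ∧ ∀ (w : Plane → ℝ) (v G : Plane → Plane), IsPerpRiesz w v →
      AEMeasurable w volume → AEStronglyMeasurable G volume →
      ‖∫ x, inner ℝ (v x) (G x) * (|w x| ^ (p - 2) * w x)‖ₑ ≤
        C * eLpNorm G q volume * lpNorm (p * s) w ^ p := by
  have hps : 1 < p * s := by nlinarith
  obtain ⟨C, hC, h⟩ := exists_perpRiesz_bound hps
  refine ⟨C, hC, fun w v G hv hw hG => ?_⟩
  set u : Plane → ℝ := fun x => |v x 0| + |v x 1| with hu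
  have m0 : AEStronglyMeasurable (fun x => |v x 0|) volume := by
    simpa using hv.1.target.aestronglyMeasurable.norm
  have m1 : AEStronglyMeasurable (fun x => |v x 1|) volume :=
    hv.2.target.aestronglyMeasurable.norm
  have hum : AEStronglyMeasurable u volume := m0.add m1
  have hFm : AEStronglyMeasurable (fun x => u x * |w x| ^ (p - 1)) volume :=
    hum.mul ((hw.abs.pow_const (p - 1)).aestronglyMeasurable)
  have hpt : ∀ x, ‖inner ℝ (v x) (G x) * (|w x| ^ (p - 2) * w x)‖ₑ ≤
      ‖(u x * |w x| ^ (p - 1)) • G x‖ₑ := by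
    intro x
    have hu0 : 0 ≤ u x := by positivity
    have hw1 : |(|w x| ^ (p - 2) * w x)| = |w x| ^ (p - 1) := by
      rw [abs_mul, abs_of_nonneg (Real.rpow_nonneg (abs_nonneg _) _)]
      -- At a zero of `w` the factor `w x` makes the left side `0` whatever value `0 ^ (p - 2)` has,
      -- and `p ≠ 1` makes the right side `0`.
      rcases eq_or_ne (w x) 0 with h0 | h0
      · simp [h0, Real.zero_rpow (show p - 1 ≠ 0 by linarith)]
      · have := abs_pos.2 h0
        nth_rewrite 2 [← Real.rpow_one |w x|]
        rw [← Real.rpow_add this]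
        congr 1; ring
    rw [← ofReal_norm, ← ofReal_norm, norm_mul, norm_smul, Real.norm_eq_abs, Real.norm_eq_abs, hw1,
      Real.norm_of_nonneg (mul_nonneg hu0 (Real.rpow_nonneg (abs_nonneg _) _))]
    refine ENNReal.ofReal_le_ofReal ?_
    calc _ ≤ (u x * ‖G x‖) * |w x| ^ (p - 1) := by gcongr; exact abs_inner_le _ _
      _ = _ := by ring
  have := hqs.symm
  calc _ ≤ ∫⁻ x, ‖inner ℝ (v x) (G x) * (|w x| ^ (p - 2) * w x)‖ₑ :=
        enorm_integral_le_lintegral_enorm _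
    _ ≤ ∫⁻ x, ‖(u x * |w x| ^ (p - 1)) • G x‖ₑ := lintegral_mono hpt
    _ = eLpNorm ((fun x => u x * |w x| ^ (p - 1)) • G) 1 volume := by
        rw [eLpNorm_one_eq_lintegral_enorm]; rfl
    _ ≤ lpNorm s (fun x => u x * |w x| ^ (p - 1)) * eLpNorm G q volume :=
        eLpNorm_smul_le_mul_eLpNorm hG hFm
    _ ≤ (lpNorm (p * s) u * lpNorm (p * s) w ^ (p - 1)) * eLpNorm G q volume := by
        gcongr
        exact eLpNorm_mul_rpow_le hp (by linarith) hum.aemeasurable hw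
    _ ≤ (C * lpNorm (p * s) w * lpNorm (p * s) w ^ (p - 1)) * eLpNorm G q volume := by
        gcongr
        exact h w v hv hw
    _ = _ := by
        have e : lpNorm (p * s) w * lpNorm (p * s) w ^ (p - 1) = lpNorm (p * s) w ^ p := by
          nth_rewrite 1 [← ENNReal.rpow_one (lpNorm (p * s) w)]
          rw [← ENNReal.rpow_add_of_nonneg _ _ zero_le_one (by linarith)]
          congr 1; ring
        rw [mul_assoc C, e]
        ring

end Transport

/-! ### Bernstein's inequalities and the transport term. -/

section Frequency

variable {p r β : ℝ} (χ : Cutoff)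

/-- Bernstein-type inequalities for the two parts of `w`. -/
theorem exists_freq_bounds (hp : 1 < p) (hpr : p ≤ r) (h0 : 0 < β) (h1 : β < 1)
    (hd : 1 / p - 1 / r < β / 2) :
    ∃ C : ℝ≥0∞, C ≠ ⊤ ∧ ∀ (J : ℝ) (w V : Plane → ℝ), IsFracLap β w V →
      MemLp w (ENNReal.ofReal p) → MemLp V (ENNReal.ofReal p) →
      lpNorm r (lowFreq χ J w) ≤
        C * (ENNReal.ofReal (freq J ^ (2 * (1 / p - 1 / r))) * lpNorm p w) ∧
      lpNorm r (highFreq χ J w) ≤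
        C * (ENNReal.ofReal (freq J ^ (2 * (1 / p - 1 / r) - β)) * lpNorm p V) ∧
      lpNorm p (highFreq χ J w) ≤ C * (ENNReal.ofReal (freq J ^ (-β)) * lpNorm p V) := by
  have hp0 : 0 < p := by linarith
  have hr0 : 0 < r := by linarith
  obtain ⟨C₁, hC₁, b₁⟩ := exists_lowKernel_bound χ hp hpr
  obtain ⟨C₂, hC₂, b₂⟩ := exists_highKernel_bound χ hp hpr h1 hd
  -- The last bound is the case `r = p`, where the condition on the exponents reduces to `0 < β /
  -- 2`.
  obtain ⟨C₃, hC₃, b₃⟩ := exists_highKernel_bound χ hp le_rfl h1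
    (show 1 / p - 1 / p < β / 2 by rw [sub_self]; linarith)
  refine ⟨C₁ + C₂ + C₃, by finiteness, fun J w V hwV hw hV => ?_⟩
  have e := highFreq_ae_eq χ J hp h0 h1 hwV hw hV
  have e1 : ∀ s, lpNorm s (highFreq χ J w) = lpNorm s (conv (highKernel χ J β) V) :=
    fun s => eLpNorm_congr_ae e
  simp only [← mul_assoc]
  refine ⟨?_, ?_, ?_⟩
  · rw [lowFreq_eq_conv]
    refine (lpNorm_conv_le hp0 hr0 (b₁ J) hw.1).trans ?_
    gcongr
    exact le_self_add.trans le_self_add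
  · rw [e1]
    refine (lpNorm_conv_le hp0 hr0 (b₂ J) hV.1).trans ?_
    gcongr
    exact le_add_self.trans le_self_add
  · rw [e1]
    have h := lpNorm_conv_le hp0 hp0 (b₃ J) hV.1
    rw [sub_self, mul_zero, zero_sub] at h
    refine h.trans ?_
    gcongr
    exact le_add_self

theorem lpNorm_le_low_add_high (hr : 1 ≤ r) (J : ℝ) {w : Plane → ℝ}
    (hw : AEStronglyMeasurable w volume) :
    lpNorm r w ≤ lpNorm r (lowFreq χ J w) + lpNorm r (highFreq χ J w) := by
  have hl : AEStronglyMeasurable (lowFreq χ J w) volume := by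
    rw [lowFreq_eq_conv]
    exact aestronglyMeasurable_conv (continuous_lowKernel χ J).measurable hw
  have e : w = lowFreq χ J w + highFreq χ J w := by
    funext x; simp [highFreq]
  conv_lhs => rw [e]
  exact lpNorm_add_le hr hl (hw.sub hl)

theorem lpPow_eq (f : Plane → ℝ) : lpPow p f = (lpNorm p f ^ p).toReal := by
  rw [lpPow, ENNReal.toReal_rpow]

/-- Bounds for the transport term in terms of the two quantities in the energy balance. -/
theorem exists_transport_freq_bound {q : ℝ≥0∞} {s : ℝ} (hp : 1 < p) (hs : 1 ≤ s)
    (hqs : q.HolderConjugate (ENNReal.ofReal s)) (h0 : 0 < β) (h1 : β < 1)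
    (hd : 1 / p - 1 / (p * s) < β / 2) (M : ℝ) :
    ∃ P : ℝ, 0 ≤ P ∧ ∀ (J : ℝ) (w V : Plane → ℝ) (v G : Plane → Plane), IsFracLap β w V →
      MemLp w (ENNReal.ofReal p) → MemLp V (ENNReal.ofReal p) → IsPerpRiesz w v → MemLp G q →
      |∫ x, inner ℝ (v x) (G x) * (|w x| ^ (p - 2) * w x)| ≤
        P * (eLpNorm G q).toReal * (freq J ^ (2 * (1 / p - 1 / (p * s)) * p) * lpPow p w +
          freq J ^ ((2 * (1 / p - 1 / (p * s)) - β) * p) * lpPow p V) ∧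
      (lpNorm p (lowFreq χ J w) ≤ ENNReal.ofReal M * lpNorm p (highFreq χ J w) →
        |∫ x, inner ℝ (v x) (G x) * (|w x| ^ (p - 2) * w x)| ≤
          P * (eLpNorm G q).toReal *
            (freq J ^ ((2 * (1 / p - 1 / (p * s)) - β) * p) * lpPow p V)) := by
  have hp0 : 0 < p := by linarith
  have hpr : p ≤ p * s := le_mul_of_one_le_right hp0.le hs
  obtain ⟨K, hK, bK⟩ := exists_transport_bound hp hs hqs
  obtain ⟨C, hC, bC⟩ := exists_freq_bounds χ hp hpr h0 h1 hd
  set r := p * s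
  set d := 1 / p - 1 / r
  -- `Q₁` is the constant for the unconditional bound, with `2 ^ (p - 1)` from convexity of the
  -- power; `Q₂` is the one when low frequencies are controlled by high ones. Their sum serves both
  -- conclusions.
  obtain ⟨Q₁, hQ₁⟩ : ∃ Q, Q = K * (C ^ p * 2 ^ (p - 1)) := ⟨_, rfl⟩
  obtain ⟨Q₂, hQ₂⟩ : ∃ Q, Q = K * (C * (C * (ENNReal.ofReal M + 1)) + C) ^ p := ⟨_, rfl⟩
  have hQ : Q₁ + Q₂ ≠ ⊤ := by
    have h2 : (2 : ℝ≥0∞) ^ (p - 1) ≠ ⊤ := ENNReal.rpow_ne_top_of_nonneg (by linarith) (by simp)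
    have h3 : C ^ p ≠ ⊤ := ENNReal.rpow_ne_top_of_nonneg hp0.le hC
    have h4 : (C * (C * (ENNReal.ofReal M + 1)) + C) ^ p ≠ ⊤ :=
      ENNReal.rpow_ne_top_of_nonneg hp0.le (by finiteness)
    rw [hQ₁, hQ₂]
    finiteness
  refine ⟨(Q₁ + Q₂).toReal, ENNReal.toReal_nonneg, fun J w V v G hwV hw hV hv hG => ?_⟩
  obtain ⟨c₁, c₂, c₃⟩ := bC J w V hwV hw hV
  have key := bK w v G hv hw.1.aemeasurable hG.1
  have hf := freq_pos J
  have hA : lpNorm p w ^ p ≠ ⊤ := ENNReal.rpow_ne_top_of_nonneg hp0.le hw.2.ne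
  have hB : lpNorm p V ^ p ≠ ⊤ := ENNReal.rpow_ne_top_of_nonneg hp0.le hV.2.ne
  have hg : eLpNorm G q volume ≠ ⊤ := hG.2.ne
  have hsum := lpNorm_le_low_add_high χ (hp.le.trans hpr) J hw.1
  have hpow : ∀ (a : ℝ) (f : Plane → ℝ), (ENNReal.ofReal (freq J ^ a) * lpNorm p f) ^ p =
      ENNReal.ofReal (freq J ^ (a * p)) * lpNorm p f ^ p := fun a f => by
    rw [ENNReal.mul_rpow_of_nonneg _ _ hp0.le, ENNReal.ofReal_rpow_of_nonneg (by positivity) hp0.le,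
      ← Real.rpow_mul hf.le]
  have toR : ∀ {X : ℝ≥0∞}, X ≠ ⊤ →
      ‖∫ x, inner ℝ (v x) (G x) * (|w x| ^ (p - 2) * w x)‖ₑ ≤ X →
      |∫ x, inner ℝ (v x) (G x) * (|w x| ^ (p - 2) * w x)| ≤ X.toReal := fun hX h => by
    have := ENNReal.toReal_mono hX h
    rwa [toReal_enorm, Real.norm_eq_abs] at this
  constructor
  · have hW : lpNorm r w ^ p ≤ C ^ p * 2 ^ (p - 1) *
        (ENNReal.ofReal (freq J ^ (2 * d * p)) * lpNorm p w ^ p +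
          ENNReal.ofReal (freq J ^ ((2 * d - β) * p)) * lpNorm p V ^ p) := by
      have h := hsum.trans (add_le_add c₁ c₂)
      rw [← mul_add] at h
      refine (ENNReal.rpow_le_rpow h hp0.le).trans ?_
      rw [ENNReal.mul_rpow_of_nonneg _ _ hp0.le, mul_assoc, ← hpow, ← hpow]
      gcongr
      exact ENNReal.rpow_add_le_mul_rpow_add_rpow _ _ hp.le
    have hX : ‖∫ x, inner ℝ (v x) (G x) * (|w x| ^ (p - 2) * w x)‖ₑ ≤
        (Q₁ + Q₂) * eLpNorm G q volume *
          (ENNReal.ofReal (freq J ^ (2 * d * p)) * lpNorm p w ^ p +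
          ENNReal.ofReal (freq J ^ ((2 * d - β) * p)) * lpNorm p V ^ p) := by
      refine (key.trans (mul_le_mul' le_rfl hW)).trans ?_
      rw [← mul_assoc]
      refine mul_le_mul' ?_ le_rfl
      calc _ = Q₁ * eLpNorm G q volume := by rw [hQ₁]; ring
        _ ≤ _ := by gcongr; exact le_self_add
    refine (toR (by finiteness) hX).trans_eq ?_
    rw [ENNReal.toReal_mul, ENNReal.toReal_mul]
    congr 1
    rw [ENNReal.toReal_add (by finiteness) (by finiteness), ENNReal.toReal_mul,
      ENNReal.toReal_mul, ENNReal.toReal_ofReal (by positivity),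
      ENNReal.toReal_ofReal (by positivity), lpPow_eq, lpPow_eq]
  · intro hM
    -- When the low part is dominated by the high part, the full `Lᵖ` norm gains `freq J ^ (-β)`
    -- over `Λ^β w`. Bernstein's loss `freq J ^ (2 * d)` then leads to the same power as in the
    -- high-frequency estimate, so no term in `‖w‖_p` survives.
    have hwp : lpNorm p w ≤ C * (ENNReal.ofReal M + 1) *
        (ENNReal.ofReal (freq J ^ (-β)) * lpNorm p V) := by
      refine (lpNorm_le_low_add_high χ hp.le J hw.1).trans ?_
      calc _ ≤ ENNReal.ofReal M * lpNorm p (highFreq χ J w) + lpNorm p (highFreq χ J w) :=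
            add_le_add hM le_rfl
        _ = (ENNReal.ofReal M + 1) * lpNorm p (highFreq χ J w) := by ring
        _ ≤ (ENNReal.ofReal M + 1) * (C * (ENNReal.ofReal (freq J ^ (-β)) * lpNorm p V)) := by
            gcongr
        _ = _ := by ring
    have hmul : ENNReal.ofReal (freq J ^ (2 * d)) * ENNReal.ofReal (freq J ^ (-β)) =
        ENNReal.ofReal (freq J ^ (2 * d - β)) := by
      rw [← ENNReal.ofReal_mul (by positivity), ← Real.rpow_add hf, sub_eq_add_neg]
    have hW : lpNorm r w ≤ (C * (C * (ENNReal.ofReal M + 1)) + C) *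
        (ENNReal.ofReal (freq J ^ (2 * d - β)) * lpNorm p V) := by
      refine (hsum.trans (add_le_add c₁ c₂)).trans ?_
      calc _ ≤ C * (ENNReal.ofReal (freq J ^ (2 * d)) * (C * (ENNReal.ofReal M + 1) *
            (ENNReal.ofReal (freq J ^ (-β)) * lpNorm p V))) +
            C * (ENNReal.ofReal (freq J ^ (2 * d - β)) * lpNorm p V) := by gcongr
        _ = C * (C * (ENNReal.ofReal M + 1)) *
            (ENNReal.ofReal (freq J ^ (2 * d)) * ENNReal.ofReal (freq J ^ (-β)) * lpNorm p V) +
            C * (ENNReal.ofReal (freq J ^ (2 * d - β)) * lpNorm p V) := by ring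
        _ = _ := by rw [hmul]; ring
    have hX : ‖∫ x, inner ℝ (v x) (G x) * (|w x| ^ (p - 2) * w x)‖ₑ ≤
        (Q₁ + Q₂) * eLpNorm G q volume *
          (ENNReal.ofReal (freq J ^ ((2 * d - β) * p)) * lpNorm p V ^ p) := by
      refine key.trans ?_
      calc _ ≤ K * eLpNorm G q volume * ((C * (C * (ENNReal.ofReal M + 1)) + C) *
            (ENNReal.ofReal (freq J ^ (2 * d - β)) * lpNorm p V)) ^ p := by gcongr
        _ = Q₂ * eLpNorm G q volume *
            (ENNReal.ofReal (freq J ^ ((2 * d - β) * p)) * lpNorm p V ^ p) := by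
            rw [ENNReal.mul_rpow_of_nonneg _ _ hp0.le, hpow, hQ₂]; ring
        _ ≤ _ := by gcongr; exact le_add_self
    refine (toR (by finiteness) hX).trans_eq ?_
    rw [ENNReal.toReal_mul, ENNReal.toReal_mul, ENNReal.toReal_mul,
      ENNReal.toReal_ofReal (by positivity), lpPow_eq]

end Frequency

/-! ### Exponents and the choice of frequency. -/

section Exponents

variable {α : ℝ} {q : ℝ≥0∞}

theorem toReal_inv_lt (hα : 0 < α) (hq : ENNReal.ofReal (1 / α) < q) : (q⁻¹).toReal < α := by
  have h : q⁻¹ < ENNReal.ofReal α := by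
    rw [ENNReal.inv_lt_iff_inv_lt, ← ENNReal.ofReal_inv_of_pos hα, ← one_div]
    exact hq
  exact (ENNReal.lt_ofReal_iff_toReal_lt h.ne_top).1 h

/-- Expressed through `κ = 1/q`, with `κ = 0` at `q = ∞`, the two cases of the exponent become one:
`γ = 1/η` with `η = 1 - κ/α`. -/
theorem gradExponent_eq (hα : 0 < α) (hq : ENNReal.ofReal (1 / α) < q) :
    gradExponent α q = (1 - (q⁻¹).toReal / α)⁻¹ := by
  rw [gradExponent]
  split_ifs with h
  · simp [h]
  · have h1 : 1 / α < q.toReal := (ENNReal.ofReal_lt_iff_lt_toReal (by positivity) h).1 hq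
    have h2 : 1 < q.toReal * α := by rwa [div_lt_iff₀ hα] at h1
    have h3 : 0 < q.toReal := (by positivity : 0 < 1 / α).trans h1
    rw [ENNReal.toReal_inv, ← one_div (1 - _), div_eq_div_iff (by linarith)]
    · field_simp
    · have : (q.toReal)⁻¹ / α = 1 / (q.toReal * α) := by field_simp
      rw [this]
      have : 1 / (q.toReal * α) < 1 := by rw [div_lt_one (by positivity)]; exact h2
      linarith

theorem holderConjugate_ofReal (h : (q⁻¹).toReal < 1) (hq : q ≠ 0) :
    q.HolderConjugate (ENNReal.ofReal (1 / (1 - (q⁻¹).toReal))) := by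
  rw [ENNReal.holderConjugate_iff, one_div, ENNReal.ofReal_inv_of_pos (by linarith), inv_inv]
  nth_rewrite 1 [← ENNReal.ofReal_toReal (ENNReal.inv_ne_top.2 hq)]
  rw [← ENNReal.ofReal_add ENNReal.toReal_nonneg (by linarith)]
  simp

/-- At the frequency determined by the gradient, the transport term is absorbed. -/
theorem mul_freq_rpow_le {η P p g J : ℝ} (hα : 0 < α) (hη : 0 < η) (hP : 0 ≤ P) (hp : 0 < p)
    (hg : 0 < g) (hJ : (2 : ℝ) ^ (2 * J * α) = (P / p + 1) ^ η⁻¹ * g ^ η⁻¹) :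
    P * g * freq J ^ (-(2 * α * η)) ≤ p := by
  have hP1 : 0 < P / p + 1 := by positivity
  have h1 : freq J ^ (-(2 * α * η)) ≤ ((P / p + 1) * g)⁻¹ := by
    calc freq J ^ (-(2 * α * η)) = (2 : ℝ) ^ ((J + 1) * (-(2 * α * η))) := by
          rw [freq, ← Real.rpow_mul two_pos.le]
      -- The frequency is `2 ^ (J + 1)` while `J(t)` is defined with `2 ^ J`; the extra factor helps
      -- because the exponent is negative.
      _ ≤ (2 : ℝ) ^ (2 * J * α * (-η)) := by
          refine Real.rpow_le_rpow_of_exponent_le one_le_two ?_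
          have : 0 < 2 * α * η := by positivity
          linarith
      _ = ((P / p + 1) * g)⁻¹ := by
          rw [Real.rpow_mul two_pos.le, hJ, ← Real.mul_rpow hP1.le hg.le,
            ← Real.rpow_mul (by positivity), mul_neg, inv_mul_cancel₀ hη.ne', Real.rpow_neg_one]
  calc P * g * freq J ^ (-(2 * α * η)) ≤ P * g * ((P / p + 1) * g)⁻¹ := by gcongr
    _ = P / (P / p + 1) := by field_simp
    _ ≤ p := by
        rw [div_le_iff₀ hP1]
        have : p * (P / p + 1) = P + p := by field_simp
        linarith

/-- The transport term is absorbed at high frequency. -/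
theorem exists_mul_freq_rpow_le {a P p : ℝ} (ha : 0 < a) (hp : 0 < p) :
    ∃ J, P * freq J ^ (-a) ≤ p := by
  have ht : Tendsto (fun J => P * freq J ^ (-a)) atTop (𝓝 (P * 0)) := by
    refine Tendsto.const_mul P ((tendsto_rpow_neg_atTop ha).comp ?_)
    exact (tendsto_rpow_atTop_of_base_gt_one 2 one_lt_two).comp
      (tendsto_atTop_add_const_right _ 1 tendsto_id)
  rw [mul_zero] at ht
  exact ((ht.eventually_lt_const hp).exists).imp fun J hJ => hJ.le

end Exponents

end SQG

end

/-! ### Absorption for small times and propagation of `w = 0`. -/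

theorem theorem1p5 (χ : SQG.Cutoff) (α : ℝ) (hα : 0 < α) (hα' : α < 1 / 2)
    (p : ℝ) (hp : 1 < p) (q : ℝ≥0∞) (hq : ENNReal.ofReal (1 / α) < q) (C M : ℝ) :
    ∃ cstar : ℝ, 0 < cstar ∧
      ∀ (T : ℝ) (θ₀ : 𝓓'((⊤ : TopologicalSpace.Opens SQG.Plane), ℝ))
        (θ₁ θ₂ w : ℝ → SQG.Plane → ℝ) (G : ℝ → SQG.Plane → SQG.Plane),
        0 < T →
        SQG.IsSolution α T θ₀ θ₁ →
        SQG.IsSolution α T θ₀ θ₂ →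
        (∀ t x, w t x = θ₁ t x - θ₂ t x) →
        -- `w ∈ L^∞([0,T); L^p)`, with `‖w(t)‖_p → 0` as `t → 0⁺`
        (∀ t ∈ Ioo 0 T, MemLp (w t) (ENNReal.ofReal p) volume) →
        (∃ B : ℝ, ∀ t ∈ Ioo 0 T, SQG.lpNorm p (w t) ≤ ENNReal.ofReal B) →
        Tendsto (fun t => SQG.lpNorm p (w t)) (𝓝[>] 0) (𝓝 0) →
        -- `G = ∇θ₁`, with `‖∇θ₁‖_q` locally bounded on `(0,T)`
        (∀ t ∈ Ioo 0 T, SQG.IsWeakGradient (θ₁ t) (G t) ∧ MemLp (G t) q volume) →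
        (∀ a b : ℝ, 0 < a → b < T →
          ∃ B : ℝ, ∀ t ∈ Icc a b, eLpNorm (G t) q volume ≤ ENNReal.ofReal B) →
        SQG.EnergyInequality p α C T w G →
        -- the condition on `w_{≤ J(t)}`, `w_{> J(t)}` for small `t`; at a time with `∇θ₁(t) = 0`
        -- no real `J` solves the equation (`J(t) = -∞`, `w_{≤ J(t)} = 0`) and nothing is required
        (∃ δ ∈ Ioc 0 T, ∀ t ∈ Ioo 0 δ, ∀ J : ℝ,
          (2 : ℝ) ^ (2 * J * α)
              = cstar * (eLpNorm (G t) q volume).toReal ^ SQG.gradExponent α q →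
          SQG.lpNorm p (SQG.lowFreq χ J (w t)) / SQG.lpNorm p (SQG.highFreq χ J (w t))
            ≤ ENNReal.ofReal M) →
        ∀ t ∈ Ioo 0 T, w t =ᵐ[volume] 0 := by
  have hp0 : 0 < p := by linarith
  set κ := (q⁻¹).toReal
  have hκ : κ < α := SQG.toReal_inv_lt hα hq
  have hκ0 : 0 ≤ κ := ENNReal.toReal_nonneg
  have hq0 : q ≠ 0 := (bot_lt_of_lt hq).ne'
  set η := 1 - κ / α with hηdef
  have hη : 0 < η := by rw [hηdef, sub_pos, div_lt_one hα]; exact hκ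
  have hγ : SQG.gradExponent α q = η⁻¹ := SQG.gradExponent_eq hα hq
  have hs : 1 ≤ 1 / (1 - κ) := by rw [le_div_iff₀ (by linarith)]; linarith
  have hd : 1 / p - 1 / (p * (1 / (1 - κ))) = κ / p := by
    have : 1 - κ ≠ 0 := by linarith
    field_simp
    ring
  have hβ1 : 2 * α / p < 1 := by rw [div_lt_one hp0]; linarith
  obtain ⟨P₀, hP₀, bP⟩ := SQG.exists_transport_freq_bound χ hp hs
    (SQG.holderConjugate_ofReal (by linarith : κ < 1) hq0) (by positivity : 0 < 2 * α / p) hβ1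
    (by rw [hd, div_div, mul_comm p, ← div_div, mul_div_cancel_left₀ _ two_ne_zero]; gcongr) M
  -- The power of the frequency in front of `‖Λ^β w‖_p^p`. Raised to `-2αη`, a frequency with
  -- `2^(2αJ)` proportional to `‖∇θ₁‖_q^(1/η)` gives a constant times `1 / ‖∇θ₁‖_q`.
  have hexp : (2 * (κ / p) - 2 * α / p) * p = -(2 * α * η) := by
    rw [hηdef]; field_simp; ring
  rw [hd, hexp] at bP
  set P := |C| * P₀
  have hP : 0 ≤ P := by positivity
  -- Chosen so that `P * g * freq J ^ (-(2 * α * η)) ≤ p` at the prescribed frequency; the summand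
  -- `1` keeps it positive when `P = 0`.
  refine ⟨(P / p + 1) ^ η⁻¹, by positivity, ?_⟩
  intro T θ₀ θ₁ θ₂ w G hT _ _ _ hw _ hlim hG hGb ⟨v, V, hv, hV, hac, _, hen⟩ ⟨δ, hδ, hratio⟩
  have hCI : ∀ I : ℝ, -C * I ≤ |C| * |I| := fun I =>
    (le_abs_self _).trans_eq (by rw [abs_mul, abs_neg])
  have hnn : ∀ f, 0 ≤ SQG.lpPow p f := fun f => Real.rpow_nonneg ENNReal.toReal_nonneg _
  -- the norm is nonincreasing for small times
  have hmono : ∀ a b, 0 < a → a < b → b < δ → SQG.lpPow p (w b) ≤ SQG.lpPow p (w a) := by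
    intro a b ha hab hb
    have h := SQG.gronwall_of_absolutelyContinuous (E := 0) hab
      (hac a b ha hab (hb.trans_le hδ.2)) ?_
    · simpa using h
    filter_upwards [hv, hV, hen] with t h1 h2 h3 ht
    have htδ : t ∈ Ioo 0 δ := ⟨ha.trans ht.1, ht.2.trans hb⟩
    have htT : t ∈ Ioo 0 T := ⟨htδ.1, htδ.2.trans_le hδ.2⟩
    obtain ⟨h2a, h2b⟩ := h2 htT
    have h3' := (h3 htT).2
    have hint : |C| * |∫ x, inner ℝ (v t x) (G t x) * (|w t x| ^ (p - 2) * w t x)| ≤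
        p * SQG.lpPow p (V t) := by
      rcases (ENNReal.toReal_nonneg (a := eLpNorm (G t) q volume)).eq_or_lt with h0 | h0
      -- Where the gradient vanishes there is no admissible `J` and no ratio condition. The
      -- unconditional bound, at the arbitrary index `0`, shows that the transport term is zero.
      · have := (bP 0 (w t) (V t) (v t) (G t) h2a (hw t htT) h2b (h1 htT) (hG t htT).2).1
        rw [← h0, mul_zero, zero_mul] at this
        rw [le_antisymm this (abs_nonneg _), mul_zero]
        exact mul_nonneg hp0.le (hnn _)
      · obtain ⟨J, hJ⟩ : ∃ J : ℝ, (2 : ℝ) ^ (2 * J * α) =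
            (P / p + 1) ^ η⁻¹ * (eLpNorm (G t) q volume).toReal ^ η⁻¹ := by
          refine ⟨Real.logb 2 ((P / p + 1) ^ η⁻¹ *
            (eLpNorm (G t) q volume).toReal ^ η⁻¹) / (2 * α), ?_⟩
          rw [mul_right_comm, mul_div_cancel₀ _ (by positivity),
            Real.rpow_logb two_pos (by norm_num) (by positivity)]
        have hr := hratio t htδ J (by rw [hγ]; exact hJ)
        have hlow : SQG.lpNorm p (SQG.lowFreq χ J (w t)) ≤
            ENNReal.ofReal M * SQG.lpNorm p (SQG.highFreq χ J (w t)) := by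
          -- Clearing the quotient requires a finite denominator. A zero denominator is harmless: `a
          -- / 0 = ∞` for `a ≠ 0` forces the low part to vanish as well.
          have hfin : SQG.lpNorm p (SQG.highFreq χ J (w t)) ≠ ⊤ := by
            have hm := SQG.memLp_conv (SQG.continuous_lowKernel χ J).measurable
              (SQG.integrable_lowKernel χ J) hp.le (hw t htT)
            rw [← SQG.lowFreq_eq_conv] at hm
            exact ((hw t htT).sub hm).2.ne
          exact (ENNReal.div_le_iff_le_mul (Or.inr ENNReal.ofReal_ne_top) (Or.inl hfin)).1 hr
        have h4 := (bP J (w t) (V t) (v t) (G t) h2a (hw t htT) h2b (h1 htT) (hG t htT).2).2 hlow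
        calc _ ≤ |C| * _ := mul_le_mul_of_nonneg_left h4 (abs_nonneg C)
          _ = P * (eLpNorm (G t) q volume).toReal * SQG.freq J ^ (-(2 * α * η)) *
              SQG.lpPow p (V t) := by ring
          _ ≤ _ := mul_le_mul_of_nonneg_right (SQG.mul_freq_rpow_le hα hη hP hp0 h0 hJ) (hnn _)
    have := hCI (∫ x, inner ℝ (v t x) (G t x) * (|w t x| ^ (p - 2) * w t x))
    linarith
  have hlim' : Tendsto (fun t => SQG.lpPow p (w t)) (𝓝[>] 0) (𝓝 0) := by
    have h1 := (ENNReal.tendsto_toReal ENNReal.zero_ne_top).comp hlim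
    have h2 := h1.rpow_const (p := p) (Or.inr hp0.le)
    rw [ENNReal.toReal_zero, Real.zero_rpow hp0.ne'] at h2
    exact h2
  -- The norm at time `b` is at most its value at every earlier time, and these values tend to `0`.
  have hsmall : ∀ b ∈ Ioo 0 δ, SQG.lpPow p (w b) = 0 := by
    intro b hb
    refine le_antisymm (ge_of_tendsto hlim' ?_) (hnn _)
    filter_upwards [Ioo_mem_nhdsGT hb.1] with a ha
    exact hmono a b ha.1 ha.2 hb.2
  have hall : ∀ b ∈ Ioo 0 T, SQG.lpPow p (w b) = 0 := by
    intro b hb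
    rcases lt_or_ge b δ with hbδ | hbδ
    · exact hsmall b ⟨hb.1, hbδ⟩
    have hδ0 := hδ.1
    have ha0 : 0 < δ / 2 := by positivity
    have hab : δ / 2 < b := by linarith
    obtain ⟨B, hB⟩ := hGb (δ / 2) b ha0 hb.2
    -- On the compact interval `[δ/2, b]` a single `J` suffices to absorb the high-frequency term.
    -- The maximum with `0` is taken because `B` may be negative.
    obtain ⟨J, hJ⟩ := SQG.exists_mul_freq_rpow_le (a := 2 * α * η) (P := P * max B 0)
      (by positivity) hp0
    -- The constant `E` is the coefficient of the low-frequency term, which is not absorbed by the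
    -- dissipation. The starting time `δ/2` lies in the interval where `w` is already known to
    -- vanish.
    have h := SQG.gronwall_of_absolutelyContinuous
      (E := P * max B 0 * SQG.freq J ^ (2 * (κ / p) * p)) hab (hac _ b ha0 hab hb.2) ?_
    · rw [hsmall (δ / 2) ⟨ha0, by linarith⟩, mul_zero] at h
      exact le_antisymm h (hnn _)
    filter_upwards [hv, hV, hen] with t h1 h2 h3 ht
    have htT : t ∈ Ioo 0 T := ⟨ha0.trans ht.1, ht.2.trans hb.2⟩
    obtain ⟨h2a, h2b⟩ := h2 htT
    have h4 := (bP J (w t) (V t) (v t) (G t) h2a (hw t htT) h2b (h1 htT) (hG t htT).2).1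
    have h5 : (eLpNorm (G t) q volume).toReal ≤ max B 0 := by
      have := ENNReal.toReal_mono ENNReal.ofReal_ne_top (hB t (Ioo_subset_Icc_self ht))
      rwa [ENNReal.toReal_ofReal'] at this
    have hA := hnn (w t)
    have hBV := hnn (V t)
    have h6 : |C| * |∫ x, inner ℝ (v t x) (G t x) * (|w t x| ^ (p - 2) * w t x)| ≤
        P * max B 0 * SQG.freq J ^ (2 * (κ / p) * p) * SQG.lpPow p (w t) +
          p * SQG.lpPow p (V t) := by
      have hf := SQG.freq_pos J
      calc _ ≤ |C| * _ := mul_le_mul_of_nonneg_left h4 (abs_nonneg C)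
        _ = P * (eLpNorm (G t) q volume).toReal * (SQG.freq J ^ (2 * (κ / p) * p) *
            SQG.lpPow p (w t) + SQG.freq J ^ (-(2 * α * η)) * SQG.lpPow p (V t)) := by ring
        _ ≤ P * max B 0 * (SQG.freq J ^ (2 * (κ / p) * p) *
            SQG.lpPow p (w t) + SQG.freq J ^ (-(2 * α * η)) * SQG.lpPow p (V t)) := by gcongr
        _ = P * max B 0 * SQG.freq J ^ (2 * (κ / p) * p) * SQG.lpPow p (w t) +
            P * max B 0 * SQG.freq J ^ (-(2 * α * η)) * SQG.lpPow p (V t) := by ring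
        _ ≤ _ := by gcongr
    have := hCI (∫ x, inner ℝ (v t x) (G t x) * (|w t x| ^ (p - 2) * w t x))
    linarith [(h3 htT).2]
  intro t ht
  have h1 := hall t ht
  rw [SQG.lpPow, Real.rpow_eq_zero ENNReal.toReal_nonneg hp0.ne'] at h1
  have h2 : SQG.lpNorm p (w t) = 0 := ((ENNReal.toReal_eq_zero_iff _).1 h1).resolve_right
    (hw t ht).2.ne
  exact (eLpNorm_eq_zero_iff (hw t ht).1 (by simpa using hp0)).1 h2
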